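/- Let $G$ be a group and let $\mathcal S$ be an admissible family of subgroups of $G$, that is, a family closed under conjugation and such that the intersection of any finite number of members contains a member. Let $\mathrm{Mod}\text{-}\mathbb ZG/\mathcal S$ be the full subcategory of the category of $\mathbb ZG$-modules on the modules $M$ with $M=\bigcup_{H\in\mathcal S}M^H$; it is abelian with enough injectives. Let $H^0(\mathcal S,-)\colon \mathrm{Mod}\text{-}\mathbb ZG\to\mathrm{Mod}\text{-}\mathbb ZG/\mathcal S$ be the functor $M\mapsto\bigcup_{H\in\mathcal S}M^H$, with right derived functors $H^q(\mathcal S,-)$, and let $H^0(G/\mathcal S,-)\colon \mathrm{Mod}\text{-}\mathbb ZG/\mathcal S\to\mathrm{Mod}\text{-}\mathbb Z$ be the functor $M\mapsto M^G$, with right derived functors $H^p(G/\mathcal S,-)$. The $G$-fixed point functor on $\mathbb ZG$-modules, whose right derived functors are $H^n(G,-)$, is the composite of $H^0(\mathcal S,-)$ followed by $H^0(G/\mathcal S,-)$. (1) This factorization has a Grothendieck (composite functor) spectral sequence $$E_2^{p,q}=H^p(G/\mathcal S,H^q(\mathcal S,M))\implies H^{p+q}(G,M),$$ which is natural in the $\mathbb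 ZG$-module $M$. Explicitly, it is a functor of $M$ with values in first quadrant cohomological spectral sequences, with natural identifications of the $E_2$-page and of $E_\infty^{p,q}$ with $F^pH^{p+q}(G,M)/F^{p+1}H^{p+q}(G,M)$ for a natural finite decreasing filtration $H^n(G,M)=F^0\supseteq F^1\supseteq\dots\supseteq F^{n+1}=0$; and, for an injective resolution $I^\bullet$ of $M$ and a Cartan–Eilenberg injective resolution $J^{\bullet,\bullet}$ of the complex $H^0(\mathcal S,I^\bullet)$ in $\mathrm{Mod}\text{-}\mathbb ZG/\mathcal S$, it is the spectral sequence of the total complex of the double complex $(J^{\bullet,\bullet})^G$ filtered by the resolution degree, with the identifications induced by these resolutions. (2) For every $q\ge0$ there is an isomorphism $$H^q(\mathcal S,M)\cong\operatorname{colim}_{H\in\mathcal S}H^q(H,M),$$ natural in $M$, where the colimit is taken over the restriction maps $H^q(H,M)\to H^q(K,M)$ for $K\le H$ in $\mathcal S$; it is compatible with the actions of $G$, where $G$ acts on the colimit through the conjugation maps $H^q(H,M)\to H^q(gHg^{-1},M)$. -/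

import Mathlib

open CategoryTheory CategoryTheory.Limits

universe u v w

/-! ### Admissible families of subgroups -/

/-- An admissible family of subgroups of `G`: it is closed under conjugation, and the intersection
of any finite number of members contains a member. (The intersection of no members is `G`, so the
family is non-empty.) -/
structure AdmissibleFamily (G : Type u) [Group G] where
  /-- the set of members of the family -/
  carrier : Set (Subgroup G)
  conj_mem : ∀ H ∈ carrier, ∀ g : G, H.map (MulAut.conj g).toMonoidHom ∈ carrier
  directed : ∀ T : Set (Subgroup G), T.Finite → T ⊆ carrier → ∃ K ∈ carrier, K ≤ sInf T

namespace AdmissibleFamily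

variable {k : Type v} [CommRing k] {G : Type u} [Group G] (S : AdmissibleFamily G)

lemma exists_mem : ∃ K, K ∈ S.carrier := by
  obtain ⟨K, hK, -⟩ := S.directed ∅ Set.finite_empty (Set.empty_subset _)
  exact ⟨K, hK⟩

lemma exists_le {H K : Subgroup G} (hH : H ∈ S.carrier) (hK : K ∈ S.carrier) :
    ∃ L ∈ S.carrier, L ≤ H ∧ L ≤ K := by
  obtain ⟨L, hL, hle⟩ := S.directed {H, K} (Set.toFinite _) (by
    intro x hx; rcases hx with rfl | rfl <;> assumption)
  exact ⟨L, hL, hle.trans (sInf_le (by simp)), hle.trans (sInf_le (by simp))⟩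

/-! ### The union of the fixed points of the members of the family -/

/-- The union `⋃_{H ∈ S} M^H`, as a submodule of the `G`-module `M`. -/
def fixedSubmodule (M : Rep.{max u v} k G) : Submodule k M where
  carrier := {m | ∃ H ∈ S.carrier, ∀ h ∈ H, M.ρ h m = m}
  zero_mem' := by
    obtain ⟨K, hK⟩ := S.exists_mem
    exact ⟨K, hK, by simp⟩
  add_mem' := by
    rintro a b ⟨H, hH, ha⟩ ⟨K, hK, hb⟩
    obtain ⟨L, hL, h1, h2⟩ := S.exists_le hH hK
    exact ⟨L, hL, fun h hh => by rw [map_add, ha h (h1 hh), hb h (h2 hh)]⟩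
  smul_mem' := by
    rintro c a ⟨H, hH, ha⟩
    exact ⟨H, hH, fun h hh => by rw [map_smul, ha h hh]⟩

lemma ρ_mem_fixedSubmodule (M : Rep.{max u v} k G) (g : G) {m : M}
    (hm : m ∈ S.fixedSubmodule M) : M.ρ g m ∈ S.fixedSubmodule M := by
  obtain ⟨H, hH, h⟩ := hm
  refine ⟨_, S.conj_mem H hH g, ?_⟩
  rintro _ ⟨x, hx, rfl⟩
  have e : (MulAut.conj g).toMonoidHom x * g = g * x := by simp
  rw [← Module.End.mul_apply, ← map_mul, e, map_mul, Module.End.mul_apply, h x hx]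

lemma map_mem_fixedSubmodule {M N : Rep.{max u v} k G} (f : M ⟶ N) {m : M}
    (hm : m ∈ S.fixedSubmodule M) : f.hom m ∈ S.fixedSubmodule N := by
  obtain ⟨H, hH, h⟩ := hm
  exact ⟨H, hH, fun x hx => by rw [← Rep.hom_comm_apply, h x hx]⟩

variable (k) in
/-- The property `M = ⋃_{H ∈ S} M^H` of a `G`-module `M`. -/
def isUnionOfFixed : ObjectProperty (Rep.{max u v} k G) :=
  fun M => ∀ m : M, m ∈ S.fixedSubmodule M

variable (k) in
/-- The category `Mod-kG/S`: the full subcategory of the category of `G`-modules on those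
`M` with `M = ⋃_{H ∈ S} M^H`. -/
abbrev Mod : Type _ := (S.isUnionOfFixed k).FullSubcategory

lemma isUnionOfFixed_of_injective {M N : Rep.{max u v} k G} (f : M ⟶ N)
    (hf : Function.Injective f.hom) (hN : S.isUnionOfFixed k N) : S.isUnionOfFixed k M := by
  intro m
  obtain ⟨H, hH, h⟩ := hN (f.hom m)
  exact ⟨H, hH, fun x hx => hf (by rw [Rep.hom_comm_apply, h x hx])⟩

lemma isUnionOfFixed_of_surjective {M N : Rep.{max u v} k G} (f : M ⟶ N)
    (hf : Function.Surjective f.hom) (hM : S.isUnionOfFixed k M) : S.isUnionOfFixed k N := by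
  intro n
  obtain ⟨m, rfl⟩ := hf n
  exact S.map_mem_fixedSubmodule f (hM m)

instance : (S.isUnionOfFixed k).IsClosedUnderSubobjects where
  prop_of_mono f _ h :=
    S.isUnionOfFixed_of_injective f ((Rep.mono_iff_injective f).1 inferInstance) h

instance : (S.isUnionOfFixed k).IsClosedUnderQuotients where
  prop_of_epi f _ h :=
    S.isUnionOfFixed_of_surjective f ((Rep.epi_iff_surjective f).1 inferInstance) h

instance : (S.isUnionOfFixed k).ContainsZero where
  exists_zero := ⟨Rep.trivial k G PUnit, (Rep.isZero_iff _ _ _).2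
    (inferInstanceAs (Subsingleton PUnit)), fun m => by
    have : m = 0 := Subsingleton.elim (α := PUnit) _ _
    rw [this]; exact zero_mem _⟩

instance : (S.isUnionOfFixed k).IsClosedUnderBinaryProducts where
  limitsOfShape_le := by
    rintro X ⟨p⟩
    let A := p.diag.obj ⟨.left⟩
    let B := p.diag.obj ⟨.right⟩
    let P : Rep.{max u v} k G := Rep.of (A.ρ.prod B.ρ)
    let f : X ⟶ P := Rep.ofHom
      { toLinearMap := (p.π.app ⟨.left⟩).hom.toLinearMap.prod (p.π.app ⟨.right⟩).hom.toLinearMap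
        isIntertwining' := fun g => by
          ext m
          · exact Rep.hom_comm_apply (p.π.app ⟨.left⟩) g m
          · exact Rep.hom_comm_apply (p.π.app ⟨.right⟩) g m }
    have hfst : f ≫ Rep.ofHom (.fst k A.ρ B.ρ) = p.π.app ⟨.left⟩ := rfl
    have hsnd : f ≫ Rep.ofHom (.snd k A.ρ B.ρ) = p.π.app ⟨.right⟩ := rfl
    have hf : Mono f := ⟨fun a b hab => p.isLimit.hom_ext (by
      rintro ⟨_ | _⟩
      · change a ≫ p.π.app _ = b ≫ p.π.app _
        rw [← hfst, reassoc_of% hab]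
      · change a ≫ p.π.app _ = b ≫ p.π.app _
        rw [← hsnd, reassoc_of% hab])⟩
    refine S.isUnionOfFixed_of_injective f ((Rep.mono_iff_injective f).1 hf) ?_
    rintro ⟨x, y⟩
    obtain ⟨H, hH, h1⟩ := p.prop_diag_obj ⟨.left⟩ x
    obtain ⟨K, hK, h2⟩ := p.prop_diag_obj ⟨.right⟩ y
    obtain ⟨L, hL, hLH, hLK⟩ := S.exists_le hH hK
    exact ⟨L, hL, fun g hg => Prod.ext (h1 g (hLH hg)) (h2 g (hLK hg))⟩

instance : (S.isUnionOfFixed k).IsClosedUnderFiniteProducts :=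
  ObjectProperty.IsClosedUnderFiniteProducts.mk'

noncomputable instance : Abelian (S.Mod k) := inferInstance

variable (k) in
/-- The functor `H⁰(S, -)`, sending a `G`-module `M` to `⋃_{H ∈ S} M^H`. -/
def H0 : Rep.{max u v} k G ⥤ S.Mod k where
  obj M :=
    { obj := Rep.of (X := S.fixedSubmodule M)
        { toFun := fun g => (M.ρ g).restrict fun _ hm => S.ρ_mem_fixedSubmodule M g hm
          map_one' := by ext; simp
          map_mul' := fun _ _ => by ext; simp }
      property := by
        rintro ⟨m, H, hH, h⟩
        exact ⟨H, hH, fun x hx => Subtype.ext (h x hx)⟩ }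
  map {M N} f := ObjectProperty.homMk (Rep.ofHom
    { toLinearMap := f.hom.toLinearMap.restrict fun _ hm => S.map_mem_fixedSubmodule f hm
      isIntertwining' := fun g => by
        ext ⟨m, hm⟩
        exact Rep.hom_comm_apply f g m })

instance : (S.H0 k).Additive where
  map_add := rfl

/-- The functor `H⁰(S, -)` is right adjoint to the inclusion of `Mod-kG/S` in `Mod-kG`. -/
def adj : (S.isUnionOfFixed k).ι ⊣ S.H0 k := Adjunction.mkOfHomEquiv
  { homEquiv := fun M N =>
      { toFun := fun f => ObjectProperty.homMk (Rep.ofHom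
          { toLinearMap := f.hom.toLinearMap.codRestrict _
              fun m => S.map_mem_fixedSubmodule f (M.property m)
            isIntertwining' := fun g => by
              ext m
              exact Rep.hom_comm_apply f g m })
        invFun := fun f => Rep.ofHom
          { toLinearMap := (S.fixedSubmodule N).subtype ∘ₗ f.hom.hom.toLinearMap
            isIntertwining' := fun g => by
              ext m
              exact congrArg Subtype.val (Rep.hom_comm_apply f.hom g m) }
        left_inv := fun _ => rfl
        right_inv := fun _ => rfl }
    homEquiv_naturality_left_symm := fun _ _ => rfl
    homEquiv_naturality_right := fun _ _ => rfl }

end AdmissibleFamily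

instance Rep.enoughInjectives {k : Type v} [CommRing k] {G : Type u} [Group G] :
    EnoughInjectives (Rep.{max u v} k G) :=
  (Rep.equivalenceModuleMonoidAlgebra (k := k) (G := G)).enoughInjectives_iff.2
    (ModuleCat.enoughInjectives.{max u v} _)

namespace AdmissibleFamily
variable {k : Type v} [CommRing k] {G : Type u} [Group G] (S : AdmissibleFamily G)

instance : (S.isUnionOfFixed k).ι.PreservesMonomorphisms :=
  (S.isUnionOfFixed k).preservesMonomorphisms_ι_of_isNormalEpiCategory

instance : EnoughInjectives (S.Mod k) := EnoughInjectives.of_adjunction S.adj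

end AdmissibleFamily

/-! ### Restriction to subgroups preserves injectives -/

section general

lemma comp_square {C : Type*} [Category* C] {X X' M M' Y Y' : C} {p : X ⟶ X'} {a : X ⟶ M} {a' : X' ⟶ M'} {m : M ⟶ M'}
    {b : M ⟶ Y} {b' : M' ⟶ Y'} {q : Y ⟶ Y'} (h1 : p ≫ a' = a ≫ m) (h2 : b ≫ q = m ≫ b') :
    p ≫ a' ≫ b' = (a ≫ b) ≫ q := by
  rw [Category.assoc, h2, reassoc_of% h1]

lemma comp_square_aux {C : Type*} [Category* C] {X X' M M' Y' : C} {p : X ⟶ X'} {a : X ⟶ M}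
    {a' : X' ⟶ M'} {m : M ⟶ M'} (h : p ≫ a' = a ≫ m) (q : M' ⟶ Y') :
    a ≫ m ≫ q = p ≫ a' ≫ q := by
  rw [reassoc_of% h]


variable {A B C : Type*} [Category* A] [Category* B] [Category* C] [Abelian A] [Abelian B]
  [Abelian C]

/-- An exact functor which preserves injectives maps injective resolutions to injective
resolutions. -/
noncomputable def mapInjectiveResolution (T : A ⥤ B) [T.Additive] [T.PreservesInjectiveObjects]
    [T.PreservesHomology] {X : A} (I : InjectiveResolution X) :
    InjectiveResolution (T.obj X) where
  cocomplex := (T.mapHomologicalComplex _).obj I.cocomplex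
  injective n := T.injective_obj_of_injective (I.injective n)
  ι := (HomologicalComplex.singleMapHomologicalComplex _ _ _).inv.app _ ≫
    (T.mapHomologicalComplex _).map I.ι
  quasiIso := inferInstance

variable [HasInjectiveResolutions A] [HasInjectiveResolutions B]

/-- If `T` is exact and preserves injectives then `Rⁿ(F ∘ T) ≅ (RⁿF) ∘ T`, by computing both
sides with `T(I)` for an injective resolution `I`. -/
noncomputable def rightDerivedCompIso (T : A ⥤ B) [T.Additive] [T.PreservesInjectiveObjects]
    [T.PreservesHomology] (F : B ⥤ C) [F.Additive] (n : ℕ) :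
    (T ⋙ F).rightDerived n ≅ T ⋙ F.rightDerived n :=
  NatIso.ofComponents
    (fun X => (injectiveResolution X).isoRightDerivedObj (T ⋙ F) n ≪≫
      ((mapInjectiveResolution T (injectiveResolution X)).isoRightDerivedObj F n).symm)
    (fun {X Y} f => by
      let I := injectiveResolution X
      let J := injectiveResolution Y
      let φ : I.cocomplex ⟶ J.cocomplex := InjectiveResolution.desc f J I
      have hφ : I.ι.f 0 ≫ φ.f 0 = f ≫ J.ι.f 0 := InjectiveResolution.desc_commutes_zero f J I
      have h1 := InjectiveResolution.isoRightDerivedObj_hom_naturality f I J φ hφ (T ⋙ F) n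
      have h2 := InjectiveResolution.isoRightDerivedObj_inv_naturality (T.map f)
        (mapInjectiveResolution T I) (mapInjectiveResolution T J)
        ((T.mapHomologicalComplex _).map φ) (by
          have h : (mapInjectiveResolution T I).ι ≫ (T.mapHomologicalComplex _).map φ =
              (CochainComplex.single₀ B).map (T.map f) ≫ (mapInjectiveResolution T J).ι := by
            dsimp only [mapInjectiveResolution]
            rw [Category.assoc, ← Functor.map_comp, InjectiveResolution.desc_commutes,
              Functor.map_comp]
            exact comp_square_aux ((HomologicalComplex.singleMapHomologicalComplex T
              (ComplexShape.up ℕ) 0).inv.naturality f) _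
          exact (HomologicalComplex.congr_hom h 0).trans (by simp; rfl)) F n
      exact comp_square h1 h2)

end general

namespace Rep

variable {k : Type v} [CommRing k] {G : Type u} [Group G]

instance resFunctor_preservesInjectiveObjects (H : Subgroup G) :
    (resFunctor.{max u v} (k := k) H.subtype).PreservesInjectiveObjects where
  injective_obj {I} hI := by
    have : EnoughInjectives (ModuleCat.{max u v} k) := ModuleCat.enoughInjectives.{u} k
    let D : ModuleCat.{max u v} k := Injective.under (ModuleCat.of k I)
    let j₀ : ModuleCat.of k I ⟶ D := Injective.ι _
    have hj₀ : Function.Injective j₀ := (ModuleCat.mono_iff_injective j₀).1 inferInstance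
    let P : Rep.{max u v} k G := Rep.of (X := G → D)
      { toFun := fun g => LinearMap.funLeft k D (fun u => u * g)
        map_one' := by ext; simp [LinearMap.funLeft]
        map_mul' := fun _ _ => by ext; simp [LinearMap.funLeft, mul_assoc] }
    let j : I ⟶ P := Rep.ofHom
      { toLinearMap := LinearMap.pi fun u => j₀.hom ∘ₗ I.ρ u
        isIntertwining' := fun g => by
          ext m u
          change j₀ (I.ρ u (I.ρ g m)) = j₀ (I.ρ (u * g) m)
          rw [map_mul]; rfl }
    have hj : Mono j := (Rep.mono_iff_injective j).2 fun a b hab => by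
      have h := congrFun (show (fun u => j₀ (I.ρ u a)) = fun u => j₀ (I.ρ u b) from hab) 1
      simpa using hj₀ h
    let r : Retract I P := ⟨j, Injective.factorThru (𝟙 I) j, Injective.comp_factorThru _ _⟩
    have hP : Injective ((resFunctor.{max u v} (k := k) H.subtype).obj P) := ⟨by
      intro X Y f i hi
      have hi' : Mono (ModuleCat.ofHom i.hom.toLinearMap) :=
        (ModuleCat.mono_iff_injective _).2 ((Rep.mono_iff_injective i).1 hi)
      let t : G → G := fun u => Quotient.out (s := QuotientGroup.leftRel H) ⟦u⟧
      have ht : ∀ u, (t u)⁻¹ * u ∈ H := fun u =>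
        QuotientGroup.leftRel_apply.1 (Quotient.mk_out (s := QuotientGroup.leftRel H) u)
      have htt : ∀ u, ∀ h ∈ H, t (u * h) = t u := fun u h hh => by
        have e : (Quotient.mk (QuotientGroup.leftRel H) (u * h)) =
            Quotient.mk (QuotientGroup.leftRel H) u :=
          Quotient.sound (QuotientGroup.leftRel_apply.2 (by simpa using H.inv_mem hh))
        exact congrArg Quotient.out e
      let F₀ : X → G → D := fun x => f.hom x
      let fu : ∀ u : G, ModuleCat.of k X ⟶ D := fun u =>
        ModuleCat.ofHom (LinearMap.proj (R := k) (φ := fun _ : G => D) u ∘ₗ f.hom.toLinearMap)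
      let F : ∀ u : G, ModuleCat.of k Y ⟶ D := fun u =>
        Injective.factorThru (fu u) (ModuleCat.ofHom i.hom.toLinearMap)
      have hF : ∀ u x, F u (i.hom x) = F₀ x u := fun u x =>
        congrArg (fun q => q.hom x)
          (Injective.comp_factorThru (fu u) (ModuleCat.ofHom i.hom.toLinearMap))
      refine ⟨Rep.ofHom
        { toLinearMap := LinearMap.pi fun u => (F (t u)).hom ∘ₗ Y.ρ ⟨_, ht u⟩
          isIntertwining' := fun h => ?_ }, ?_⟩
      · ext y u
        change F (t u) (Y.ρ ⟨_, ht u⟩ (Y.ρ h y)) =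
          F (t (u * h.1)) (Y.ρ ⟨_, ht (u * h.1)⟩ y)
        have e : (⟨_, ht (u * h.1)⟩ : H) = ⟨_, ht u⟩ * h :=
          Subtype.ext (by simp [htt u h.1 h.2, mul_assoc])
        rw [e, map_mul, htt u h.1 h.2]
        rfl
      · ext x u
        change F (t u) (Y.ρ ⟨_, ht u⟩ (i.hom x)) = F₀ x u
        rw [← Rep.hom_comm_apply, hF]
        have := congrFun (Rep.hom_comm_apply f ⟨_, ht u⟩ x) (t u)
        refine this.trans ?_
        change F₀ x (t u * ((t u)⁻¹ * u)) = F₀ x u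
        simp⟩
    exact (r.map (resFunctor.{max u v} (k := k) H.subtype)).injective

end Rep

/-! ### Cohomology of subgroups, and the functors attached to an admissible family -/

namespace Subgroup

variable (k : Type v) [CommRing k] {G : Type u} [Group G]

/-- The functor `M ↦ M^H` on `G`-modules. -/
noncomputable abbrev fixedPoints (H : Subgroup G) :
    Rep.{max u v} k G ⥤ ModuleCat.{max u v} k :=
  Rep.resFunctor H.subtype ⋙ Rep.invariantsFunctor k H

/-- The functor `M ↦ Hⁿ(H, M)` on `G`-modules: the `G`-module `M` is regarded as an `H`-module,
and `Hⁿ(H, -)` is the `n`th right derived functor of the `H`-fixed point functor. -/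
noncomputable abbrev cohomology (H : Subgroup G) (n : ℕ) :
    Rep.{max u v} k G ⥤ ModuleCat.{max u v} k :=
  Rep.resFunctor H.subtype ⋙ (Rep.invariantsFunctor k H).rightDerived n

/-- `Hⁿ(H, M)` can be computed by applying `H`-fixed points to an injective resolution of `M`
as a `G`-module. -/
noncomputable def cohomologyIso (H : Subgroup G) (n : ℕ) :
    (H.fixedPoints k).rightDerived n ≅ H.cohomology k n :=
  rightDerivedCompIso (Rep.resFunctor H.subtype) (Rep.invariantsFunctor k H) n

variable {H K L : Subgroup G}

/-- For `g⁻¹Kg ⊆ H`, the map `M^H → M^K`, `m ↦ g m`. -/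
noncomputable def fixedPointsMap (g : G) (h : ∀ x ∈ K, g⁻¹ * x * g ∈ H) :
    H.fixedPoints k ⟶ K.fixedPoints k where
  app M := ModuleCat.ofHom ((M.ρ g ∘ₗ (Submodule.subtype _)).codRestrict _ fun m => by
    rintro ⟨x, hx⟩
    have e : x * g = g * (g⁻¹ * x * g) := by group
    change M.ρ x (M.ρ g m.1) = M.ρ g m.1
    rw [← Module.End.mul_apply, ← map_mul, e, map_mul, Module.End.mul_apply]
    exact congrArg (M.ρ g) (m.2 ⟨_, h x hx⟩))
  naturality M N f := by
    ext m
    exact Subtype.ext (Rep.hom_comm_apply f g m.1).symm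

lemma fixedPointsMap_one (h : ∀ x ∈ H, (1 : G)⁻¹ * x * 1 ∈ H) :
    fixedPointsMap k 1 h = 𝟙 (H.fixedPoints k) := by
  ext M m
  refine Subtype.ext ?_
  change M.ρ 1 m.1 = m.1
  rw [map_one]; rfl

lemma fixedPointsMap_one_comp (h : ∀ x ∈ K, (1 : G)⁻¹ * x * 1 ∈ H)
    (h' : ∀ x ∈ L, (1 : G)⁻¹ * x * 1 ∈ K) (h'' : ∀ x ∈ L, (1 : G)⁻¹ * x * 1 ∈ H) :
    fixedPointsMap k 1 h ≫ fixedPointsMap k 1 h' = fixedPointsMap k 1 h'' := by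
  ext M m
  refine Subtype.ext ?_
  change M.ρ 1 (M.ρ 1 m.1) = M.ρ 1 m.1
  rw [map_one]; rfl

/-- For `g⁻¹Kg ⊆ H`, the map `Hⁿ(H, M) → Hⁿ(K, M)` induced by `m ↦ g m`. It is the restriction
map when `g = 1` and `K ⊆ H`, and the conjugation map when `K = gHg⁻¹`. -/
noncomputable def cohomologyMap (n : ℕ) (g : G) (h : ∀ x ∈ K, g⁻¹ * x * g ∈ H) :
    H.cohomology k n ⟶ K.cohomology k n :=
  (H.cohomologyIso k n).inv ≫ NatTrans.rightDerived (fixedPointsMap k g h) n ≫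
    (K.cohomologyIso k n).hom

end Subgroup

namespace AdmissibleFamily

variable (k : Type v) [CommRing k] {G : Type u} [Group G] (S : AdmissibleFamily G)

/-- The functor `Hⁿ(S, -)`, the `n`th right derived functor of `H⁰(S, -)`. -/
noncomputable abbrev H (n : ℕ) : Rep.{max u v} k G ⥤ S.Mod k :=
  (S.H0 k).rightDerived n

/-- The functor `H⁰(G/S, -)`: the restriction of the `G`-fixed point functor to `Mod-kG/S`. -/
noncomputable abbrev H0Quot : S.Mod k ⥤ ModuleCat.{max u v} k :=
  (S.isUnionOfFixed k).ι ⋙ Rep.invariantsFunctor k G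

/-- The factorization of the `G`-fixed point functor as `H⁰(S, -)` followed by `H⁰(G/S, -)`. -/
noncomputable def factorization : S.H0 k ⋙ S.H0Quot k ≅ Rep.invariantsFunctor.{max u v} k G :=
  NatIso.ofComponents (fun M => LinearEquiv.toModuleIso
    { toFun := fun m => ⟨m.1.1, fun g => congrArg Subtype.val (m.2 g)⟩
      invFun := fun m => ⟨⟨m.1, by
        obtain ⟨K, hK⟩ := S.exists_mem
        exact ⟨K, hK, fun x _ => m.2 x⟩⟩, fun g => Subtype.ext (m.2 g)⟩
      left_inv := fun _ => rfl
      right_inv := fun _ => rfl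
      map_add' := fun _ _ => rfl
      map_smul' := fun _ _ => rfl })
    (fun _ => rfl)

/-- The underlying `k`-module of an object of `Mod-kG/S`. -/
noncomputable abbrev toModule : S.Mod k ⥤ ModuleCat.{max u v} k :=
  (S.isUnionOfFixed k).ι ⋙ forget₂ (Rep.{max u v} k G) (ModuleCat.{max u v} k)

/-- The directed system of the functors `Hⁿ(H, -)`, for `H` in `S`, with the restriction maps
`Hⁿ(H, M) → Hⁿ(K, M)` for `K ≤ H`. -/
noncomputable def cohomologyDiagram (n : ℕ) :
    {H : Subgroup G // H ∈ S.carrier}ᵒᵖ ⥤ Rep.{max u v} k G ⥤ ModuleCat.{max u v} k where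
  obj H := H.unop.1.cohomology k n
  map {H K} f := Subgroup.cohomologyMap k n 1 fun x hx => by simpa using leOfHom f.unop hx
  map_id H := by
    simp [Subgroup.cohomologyMap, Subgroup.fixedPointsMap_one]
  map_comp f g := by
    simp only [Subgroup.cohomologyMap, Category.assoc, Iso.hom_inv_id_assoc]
    rw [← NatTrans.rightDerived_comp_assoc, Subgroup.fixedPointsMap_one_comp]

end AdmissibleFamily

/-! ### First quadrant double complexes of modules and their spectral sequence -/

/-- A first quadrant double complex of modules: `(D.X a).X b` is the module in bidegree `(a, b)`. -/
abbrev DoubleComplex (R : Type v) [Ring R] :=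
  CochainComplex (CochainComplex (ModuleCat.{w} R) ℕ) ℕ

namespace DoubleComplex

variable {R : Type v} [Ring R] (D : DoubleComplex.{v, w} R)

/-- The product of all modules of the double complex. The degree `n` part of the total complex
is the submodule `D.totDegree n`. -/
abbrev Tot : Type w := ∀ a b : ℕ, (D.X a).X b

/-- The elements of the total complex which are homogeneous of degree `n`. -/
def totDegree (n : ℤ) : Submodule R D.Tot where
  carrier := {x | ∀ a b : ℕ, (a : ℤ) + b ≠ n → x a b = 0}
  zero_mem' := fun _ _ _ => rfl
  add_mem' := fun hx hy a b h => by simp [hx a b h, hy a b h]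
  smul_mem' := fun c x hx a b h => by simp [hx a b h]

/-- The filtration of the total complex by the first index. -/
def fil (s : ℤ) : Submodule R D.Tot where
  carrier := {x | ∀ a b : ℕ, (a : ℤ) < s → x a b = 0}
  zero_mem' := fun _ _ _ => rfl
  add_mem' := fun hx hy a b h => by simp [hx a b h, hy a b h]
  smul_mem' := fun c x hx a b h => by simp [hx a b h]

/-- The total differential `d' + (-1)^a d''`. (For `a = 0` or `b = 0` the corresponding
differential `D.d 0 0` or `(D.X a).d 0 0` is zero.) -/
def totD : D.Tot →ₗ[R] D.Tot where
  toFun x := fun a b =>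
    ((D.d (a - 1) a).f b).hom (x (a - 1) b) +
      (-1 : ℤ) ^ a • ((D.X a).d (b - 1) b).hom (x a (b - 1))
  map_add' x y := by
    ext a b
    simp only [Pi.add_apply, map_add, smul_add]
    abel
  map_smul' c x := by
    ext a b
    simp only [Pi.smul_apply, map_smul, RingHom.id_apply, smul_add]
    rw [smul_comm]

/-- The element `x` of bidegree `(a, b)`, as an element of the total complex. -/
noncomputable def single (a b : ℕ) (x : (D.X a).X b) : D.Tot :=
  Pi.single a (Pi.single b x)

/-- `Z_r^{s,n}`: the elements `x ∈ F^s Totⁿ` with `d x ∈ F^{s+r}`. -/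
def approxCycles (r s n : ℤ) : Submodule R D.Tot :=
  D.totDegree n ⊓ D.fil s ⊓ (D.fil (s + r)).comap D.totD

/-- The data identifying `E` with the spectral sequence of the filtered complex `Tot D`: the
page `E_r^{a,b}` is the quotient of `Z_r^a` by `Z_{r-1}^{a+1} + d Z_{r-1}^{a-r+1}`
(in total degree `a + b`), the differential `d_r` is induced by the total differential, and the
isomorphism `H(E_r) ≅ E_{r+1}` is induced by the inclusion `Z_{r+1}^a ⊆ Z_r^a`. -/
structure SpectralSequenceData (E : E₂CohomologicalSpectralSequenceNat (ModuleCat.{w} R)) where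
  /-- the projection `Z_r^a → E_r^{a,b}` -/
  π (r : ℤ) (hr : 2 ≤ r) (a b : ℕ) :
    D.approxCycles r a (a + b) →ₗ[R] (E.page r hr).X (a, b)
  π_surjective (r : ℤ) (hr : 2 ≤ r) (a b : ℕ) : Function.Surjective (π r hr a b)
  π_eq_zero_iff (r : ℤ) (hr : 2 ≤ r) (a b : ℕ) (x : D.approxCycles r a (a + b)) :
    π r hr a b x = 0 ↔
      ∃ w ∈ D.approxCycles (r - 1) (a + 1) (a + b),
      ∃ y ∈ D.approxCycles (r - 1) (a - r + 1) (a + b - 1), x.1 = w + D.totD y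
  d_π (r : ℤ) (hr : 2 ≤ r) (a b a' b' : ℕ) (ha : (a : ℤ) + r = a') (hb : (b : ℤ) + (1 - r) = b')
    (x : D.approxCycles r a (a + b)) (x' : D.approxCycles r a' (a' + b'))
    (hx : x'.1 = D.totD x.1) :
    ((E.page r hr).d (a, b) (a', b')).hom (π r hr a b x) = π r hr a' b' x'
  iso_π (r : ℤ) (hr : 2 ≤ r) (a b : ℕ) (x : D.approxCycles r a (a + b))
    (x' : D.approxCycles (r + 1) a (a + b)) (hx : x'.1 = x.1)
    (z : (E.page r hr).cycles (a, b)) (hz : ((E.page r hr).iCycles (a, b)).hom z = π r hr a b x) :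
    (E.iso r (r + 1) (a, b) rfl hr).hom.hom (((E.page r hr).homologyπ (a, b)).hom z) =
      π (r + 1) (by lia) a b x'

end DoubleComplex

/-! ### Convergence of first quadrant spectral sequences -/

/-- Convergence `E_2^{p,q} ⇒ H^{p+q}` of a first quadrant spectral sequence: a finite decreasing
filtration `Hⁿ = F⁰Hⁿ ⊇ F¹Hⁿ ⊇ ⋯ ⊇ F^{n+1}Hⁿ = 0`, together with isomorphisms
`F^aH^{a+b} / F^{a+1}H^{a+b} ≅ E_r^{a,b}` for all large `r` (that is, `r > a` and `r > b + 1`,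
so that `E_r^{a,b} = E_∞^{a,b}`), compatible with the identifications `E_r^{a,b} ≅ E_{r+1}^{a,b}`. -/
structure SpectralSequenceConvergence {R : Type v} [Ring R]
    (E : E₂CohomologicalSpectralSequenceNat (ModuleCat.{w} R)) (H : ℕ → ModuleCat.{w} R) where
  /-- the filtration on the abutment -/
  fil (n s : ℕ) : Submodule R (H n)
  fil_antitone (n : ℕ) : Antitone (fil n)
  fil_zero (n : ℕ) : fil n 0 = ⊤
  fil_succ (n : ℕ) : fil n (n + 1) = ⊥
  /-- the projection `F^aH^{a+b} → E_r^{a,b} = E_∞^{a,b}` for large `r` -/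
  π (r : ℤ) (hr : 2 ≤ r) (a b : ℕ) (ha : (a : ℤ) < r) (hb : (b : ℤ) + 1 < r) :
    fil (a + b) a →ₗ[R] (E.page r hr).X (a, b)
  π_surjective (r : ℤ) (hr : 2 ≤ r) (a b : ℕ) (ha : (a : ℤ) < r) (hb : (b : ℤ) + 1 < r) :
    Function.Surjective (π r hr a b ha hb)
  π_eq_zero_iff (r : ℤ) (hr : 2 ≤ r) (a b : ℕ) (ha : (a : ℤ) < r) (hb : (b : ℤ) + 1 < r)
    (h : fil (a + b) a) : π r hr a b ha hb h = 0 ↔ h.1 ∈ fil (a + b) (a + 1)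
  iso_π (r : ℤ) (hr : 2 ≤ r) (a b : ℕ) (ha : (a : ℤ) < r) (hb : (b : ℤ) + 1 < r)
    (h : fil (a + b) a) (z : (E.page r hr).cycles (a, b))
    (hz : ((E.page r hr).iCycles (a, b)).hom z = π r hr a b ha hb h) :
    (E.iso r (r + 1) (a, b) rfl hr).hom.hom (((E.page r hr).homologyπ (a, b)).hom z) =
      π (r + 1) (by lia) a b (by lia) (by lia) h

/-! ### Cartan–Eilenberg resolutions -/

section CartanEilenberg

variable {B : Type*} [Category* B] [Abelian B]

/-- The complex `C⁰ ⟶ C¹ ⟶ ⋯`, with the augmentation `i : Z ⟶ C⁰`, is an injective resolution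
of `Z`. -/
structure IsInjectiveResolution {Z : B} (C : CochainComplex B ℕ) (i : Z ⟶ C.X 0)
    (w : i ≫ C.d 0 1 = 0) : Prop where
  injective (n : ℕ) : Injective (C.X n)
  quasiIso : QuasiIso ((CochainComplex.fromSingle₀Equiv C Z).symm ⟨i, w⟩)

/-- The bundled injective resolution. -/
noncomputable def IsInjectiveResolution.toInjectiveResolution {Z : B} {C : CochainComplex B ℕ}
    {i : Z ⟶ C.X 0} {w : i ≫ C.d 0 1 = 0} (h : IsInjectiveResolution C i w) :
    InjectiveResolution Z where
  cocomplex := C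
  injective := h.injective
  ι := (CochainComplex.fromSingle₀Equiv C Z).symm ⟨i, w⟩
  quasiIso := h.quasiIso

lemma map_comp_map_d {X : Type*} [Category* X] [HasZeroMorphisms X] (Φ : X ⥤ B)
    [Φ.PreservesZeroMorphisms] {Z : X} {C : CochainComplex X ℕ} {i : Z ⟶ C.X 0}
    (w : i ≫ C.d 0 1 = 0) :
    Φ.map i ≫ ((Φ.mapHomologicalComplex (ComplexShape.up ℕ)).obj C).d 0 1 = 0 := by
  change Φ.map i ≫ Φ.map (C.d 0 1) = 0
  rw [← Φ.map_comp, w, Φ.map_zero]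

/-- A Cartan–Eilenberg injective resolution of a complex `K`: complexes `J^{a,•}` for `a = 0, 1, …`
and a complex `0 → K → J^{0,•} → J^{1,•} → ⋯` of complexes such that, for every `b`, the terms
`J^{•,b}`, the cocycles `Z^b(J^{•,*})` and the cohomology objects `H^b(J^{•,*})` are injective
resolutions of `K^b`, `Z^b(K)` and `H^b(K)`. (It follows that the coboundaries `B^b(J^{•,*})` are
an injective resolution of `B^b(K)`.) -/
structure CartanEilenbergResolution (K : CochainComplex B ℕ) where
  /-- the double complex `J`; `(cocomplex.X a).X b` is `J^{a,b}` -/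
  cocomplex : CochainComplex (CochainComplex B ℕ) ℕ
  /-- the augmentation -/
  ι : K ⟶ cocomplex.X 0
  ι_comp_d : ι ≫ cocomplex.d 0 1 = 0
  terms (b : ℕ) :
    IsInjectiveResolution
      (((HomologicalComplex.eval B (ComplexShape.up ℕ) b).mapHomologicalComplex _).obj cocomplex)
      ((HomologicalComplex.eval B (ComplexShape.up ℕ) b).map ι) (map_comp_map_d _ ι_comp_d)
  cycles (b : ℕ) :
    IsInjectiveResolution
      (((HomologicalComplex.cyclesFunctor B (ComplexShape.up ℕ) b).mapHomologicalComplex _).obj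
        cocomplex)
      ((HomologicalComplex.cyclesFunctor B (ComplexShape.up ℕ) b).map ι)
      (map_comp_map_d _ ι_comp_d)
  homology (b : ℕ) :
    IsInjectiveResolution
      (((HomologicalComplex.homologyFunctor B (ComplexShape.up ℕ) b).mapHomologicalComplex _).obj
        cocomplex)
      ((HomologicalComplex.homologyFunctor B (ComplexShape.up ℕ) b).map ι)
      (map_comp_map_d _ ι_comp_d)

end CartanEilenberg

/-! ### Composite functor spectral sequences -/

section Grothendieck

variable {A : Type*} [Category* A] [Abelian A] [HasInjectiveResolutions A]
  {B : Type*} [Category* B] [Abelian B] [HasInjectiveResolutions B]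
  {R : Type v} [Ring R] {F : A ⥤ B} [F.Additive] {Γ : B ⥤ ModuleCat.{w} R} [Γ.Additive]
  {L : A ⥤ ModuleCat.{w} R} [L.Additive]

/-- The resolutions from which the composite functor spectral sequence of `F`, followed by some
functor `Γ`, is built at the object `M`. -/
structure CompositeResolution (F : A ⥤ B) [F.Additive] (M : A) where
  /-- an injective resolution of `M` -/
  res : InjectiveResolution M
  /-- a Cartan–Eilenberg resolution of `F(I)` -/
  ce : CartanEilenbergResolution ((F.mapHomologicalComplex (ComplexShape.up ℕ)).obj res.cocomplex)

namespace CompositeResolution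

variable {M : A} (J : CompositeResolution F M)

/-- The double complex `Γ(J)`. -/
noncomputable def doubleComplex (Γ : B ⥤ ModuleCat.{w} R) [Γ.Additive] : DoubleComplex.{v, w} R :=
  ((Γ.mapHomologicalComplex (ComplexShape.up ℕ)).mapHomologicalComplex (ComplexShape.up ℕ)).obj
    J.ce.cocomplex

/-- The augmentation `Γ(F(Iⁿ)) → Γ(J^{0,n}) ⊆ Totⁿ Γ(J)`. -/
noncomputable def aug (Γ : B ⥤ ModuleCat.{w} R) [Γ.Additive] (n : ℕ)
    (c : Γ.obj (F.obj (J.res.cocomplex.X n))) : (J.doubleComplex Γ).Tot :=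
  (J.doubleComplex Γ).single 0 n ((Γ.map (J.ce.ι.f n)).hom c)

/-- `h ∈ RⁿL(M)` is represented by the cocycle `x` of `Tot Γ(J)`: if `h` is the class of a cocycle
`c` of the complex `L(I) ≅ Γ(F(I))`, then `x` is cohomologous to the image of `c` under the
augmentation `Γ(F(I)) → Tot Γ(J)`. -/
def RepresentsAbutment (θ : F ⋙ Γ ≅ L) (n : ℕ) (x : (J.doubleComplex Γ).Tot)
    (h : (L.rightDerived n).obj M) : Prop :=
  let LI := (L.mapHomologicalComplex (ComplexShape.up ℕ)).obj J.res.cocomplex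
  ∃ (z : LI.cycles n) (c : Γ.obj (F.obj (J.res.cocomplex.X n))),
    (J.res.isoRightDerivedObj L n).hom.hom h = (LI.homologyπ n).hom z ∧
    (LI.iCycles n).hom z = (θ.hom.app (J.res.cocomplex.X n)).hom c ∧
    ∃ y ∈ (J.doubleComplex Γ).totDegree (n - 1), x = J.aug Γ n c + (J.doubleComplex Γ).totD y

/-- `e ∈ RᵃΓ(RᵇF(M))` is represented by the element `x` of `Tot Γ(J)`: the component of `x` in
bidegree `(a, b)` is the image of an element `y` of `Γ(Z^b(J^{a,•}))`, all components of `x` of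
smaller first index vanish, and `e` is the class of the image of `y` in `Γ(H^b(J^{a,•}))`, the
complex `H^b(J)` being an injective resolution of `H^b(F(I)) ≅ RᵇF(M)`. -/
def RepresentsE₂ (a b : ℕ) (x : (J.doubleComplex Γ).Tot)
    (e : (Γ.rightDerived a).obj ((F.rightDerived b).obj M)) : Prop :=
  let ΓH := (Γ.mapHomologicalComplex (ComplexShape.up ℕ)).obj
    (J.ce.homology b).toInjectiveResolution.cocomplex
  ∃ (y : Γ.obj ((J.ce.cocomplex.X a).cycles b)) (ζ : ΓH.cycles a),
    x - (J.doubleComplex Γ).single a b ((Γ.map ((J.ce.cocomplex.X a).iCycles b)).hom y) ∈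
      (J.doubleComplex Γ).fil (a + 1) ∧
    (ΓH.iCycles a).hom ζ = (Γ.map ((J.ce.cocomplex.X a).homologyπ b)).hom y ∧
    ((J.ce.homology b).toInjectiveResolution.isoRightDerivedObj Γ a).hom.hom
      (((Γ.rightDerived a).map (J.res.isoRightDerivedObj F b).hom).hom e) =
        (ΓH.homologyπ a).hom ζ

end CompositeResolution

/-- The Grothendieck (composite functor) spectral sequence `RᵖΓ(R^qF(M)) ⇒ R^{p+q}L(M)` of a
factorization `θ : Γ ∘ F ≅ L`. It is natural in `M`: a functor `E` to first quadrant spectral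
sequences, natural isomorphisms `E_2^{p,q} ≅ (RᵖΓ)(R^qF)`, and a natural convergence to the right
derived functors of `L`. Moreover, it is the spectral sequence which arises from the factorization:
for each `M`, with `I` an injective resolution of `M` and `J` a Cartan–Eilenberg resolution of
`F(I)`, it is the spectral sequence of the complex `Tot Γ(J)` filtered by the resolution degree,
and the identifications of the second page and of the abutment are those given by the resolutions
`H^q(F(I)) → H^q(J)` and the augmentation `L(I) ≅ Γ(F(I)) → Tot Γ(J)`. -/
structure GrothendieckSpectralSequence (θ : F ⋙ Γ ≅ L) where
  /-- the spectral sequence, as a functor -/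
  E : A ⥤ E₂CohomologicalSpectralSequenceNat (ModuleCat.{w} R)
  /-- the identification of the second page -/
  e₂ (p q : ℕ) : E ⋙ SpectralSequence.pageFunctor _ _ 2 2 ⋙ HomologicalComplex.eval _ _ (p, q) ≅
    F.rightDerived q ⋙ Γ.rightDerived p
  /-- the convergence of `E(M)` to `RⁿL(M)` -/
  conv (M : A) : SpectralSequenceConvergence (E.obj M) (fun n => (L.rightDerived n).obj M)
  map_mem_fil {M N : A} (f : M ⟶ N) (n s : ℕ) (h : (L.rightDerived n).obj M)
    (hh : h ∈ (conv M).fil n s) : ((L.rightDerived n).map f).hom h ∈ (conv N).fil n s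
  map_π {M N : A} (f : M ⟶ N) (r : ℤ) (hr : 2 ≤ r) (a b : ℕ) (ha : (a : ℤ) < r)
    (hb : (b : ℤ) + 1 < r) (h : (conv M).fil (a + b) a) :
    (((E.map f).hom r hr).f (a, b)).hom ((conv M).π r hr a b ha hb h) =
      (conv N).π r hr a b ha hb ⟨_, map_mem_fil f (a + b) a h.1 h.2⟩
  /-- an injective resolution `I` of `M` and a Cartan–Eilenberg resolution `J` of `F(I)` -/
  res (M : A) : CompositeResolution F M
  /-- `E(M)` is the spectral sequence of the filtered complex `Tot Γ(J)` -/
  data (M : A) : ((res M).doubleComplex Γ).SpectralSequenceData (E.obj M)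
  e₂_eq (M : A) (a b : ℕ) (x : ((res M).doubleComplex Γ).approxCycles 2 a (a + b))
    (e : (F.rightDerived b ⋙ Γ.rightDerived a).obj M) (h : (res M).RepresentsE₂ a b x.1 e) :
    ((e₂ a b).hom.app M).hom ((data M).π 2 le_rfl a b x) = e
  mem_fil_iff (M : A) (n s : ℕ) (h : (L.rightDerived n).obj M) :
    h ∈ (conv M).fil n s ↔
      ∃ x ∈ ((res M).doubleComplex Γ).fil s, (res M).RepresentsAbutment θ n x h
  conv_π_eq (M : A) (r : ℤ) (hr : 2 ≤ r) (a b : ℕ) (ha : (a : ℤ) < r) (hb : (b : ℤ) + 1 < r)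
    (h : (conv M).fil (a + b) a) (x : ((res M).doubleComplex Γ).approxCycles r a (a + b))
    (hx : (res M).RepresentsAbutment θ (a + b) x.1 h.1) :
    (conv M).π r hr a b ha hb h = (data M).π r hr a b x

end Grothendieck

/-! The inclusion of `Mod-kG/S` in `Mod-kG` is exact and left adjoint to `H0`, so `H0` preserves
injective objects. This is the hypothesis of Grothendieck's theorem, and the spectral sequence is
the one of a double complex `Γ(J)`, where `J` is a Cartan–Eilenberg resolution of `F(I)`, filtered
by the resolution degree.

Naturality is obtained without homotopies, by making every choice functorial. A Grothendieck abelian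
category has a functorial embedding of its objects into injective ones; it is transported along
adjunctions to `Rep` and to `S.Mod k`, and iterating it gives functorial injective resolutions.
Applied to a suitable embedding of complexes into split complexes of injectives (`complexEmbedding`,
which is a monomorphism on homology), the same construction gives a functorial Cartan–Eilenberg
resolution.

The pages are the quotients of `Z_r = {x ∈ F^s : dx ∈ F^{s+r}}` by `Z_{r-1}^{s+1} + d
Z_{r-1}^{s-r+1}`, and `exists_pageIso` identifies the homology of one page with the next. The second
page comes from the columns `J^{a,•}`: they are split, so `Γ` commutes with their cycles and
cohomology, and `H^b(J)` is an injective resolution of `H^b(F(I)) ≅ R^bF(M)` (`exists_e₂Equiv`). The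
abutment comes from the rows: they are injective resolutions of the objects `F(I^b)`, which are
themselves injective, so they are contractible and stay exact under `Γ`; hence `Γ(F(I)) → Tot Γ(J)`
is an isomorphism on cohomology (`exists_representsAbutment'`, `RepresentsAbutment.eq_zero_iff`).
Both identifications are given as linear relations "the element `x` represents the class `e`"; these
turn out to be graphs of linear maps, and morphisms of resolutions visibly preserve them.

For the colimit, let `I` be an injective resolution of `M`. The complex `⋃ I^H` is a directed union
of the complexes `I^H`, and `I^H` computes `H^q(H, M)` because restriction to a subgroup preserves
injectives. A class of the union is represented by one cocycle, which lies in some `I^H`; a class of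
`I^H` that dies in the union is bounded by one cochain, which lies in some `I^K`
(`exists_rightDerived_app_eq`, `exists_rightDerived_app_eq_zero`). Equivariance holds because `m ↦
gm` on fixed points is compatible with `m ↦ gm` on the union, and this identity can be derived. -/

open scoped ZeroObject

/-! ### Functorial coresolutions -/

namespace CategoryTheory

/-- An endofunctor `T` of a category with a natural monomorphism `X ⟶ T X`. -/
structure FunctorialEmbedding (C : Type*) [Category* C] where
  /-- the endofunctor -/
  T : C ⥤ C
  /-- the natural embedding -/
  η (X : C) : X ⟶ T.obj X
  naturality {X Y : C} (f : X ⟶ Y) : f ≫ η Y = η X ≫ T.map f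
  mono_η (X : C) : Mono (η X) := by infer_instance

namespace FunctorialEmbedding

attribute [instance] mono_η

/-- A functorial embedding pulls back along an adjunction whose left adjoint preserves and reflects
monomorphisms. -/
def ofAdjunction {C D : Type*} [Category* C] [Category* D] {L : C ⥤ D} {R : D ⥤ C} (adj : L ⊣ R)
    [L.PreservesMonomorphisms] [L.ReflectsMonomorphisms] (E : FunctorialEmbedding D) :
    FunctorialEmbedding C where
  T := L ⋙ E.T ⋙ R
  η X := adj.homEquiv _ _ (E.η (L.obj X))
  naturality {X Y} f := by
    rw [← adj.homEquiv_naturality_left, E.naturality, adj.homEquiv_naturality_right]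
    rfl
  mono_η X := by
    -- `L` reflects monomorphisms, and the image under `L` of the adjunct, followed by the counit,
    -- is the monomorphism `E.η` itself.
    apply L.mono_of_mono_map
    have h : L.map (adj.homEquiv _ _ (E.η (L.obj X))) ≫ adj.counit.app _ = E.η (L.obj X) := by
      have := (adj.homEquiv _ _).symm_apply_apply (E.η (L.obj X))
      rwa [adj.homEquiv_counit] at this
    exact mono_of_mono_fac h

/-- The functorial embedding into injective objects of a Grothendieck abelian category. -/
noncomputable def ofIsGrothendieckAbelian (C : Type*) [Category* C] [Abelian C]
    [IsGrothendieckAbelian.{w} C] : FunctorialEmbedding C :=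
  -- The map `X ⟶ 0` is factored functorially as a monomorphism followed by a map with the right
  -- lifting property against all monomorphisms; `A` makes `X ⟶ 0` functorial in `X`.
  let data := MorphismProperty.functorialFactorizationData (MorphismProperty.monomorphisms C)
    (MorphismProperty.monomorphisms C).rlp
  let A : C ⥤ Arrow C :=
    { obj X := Arrow.mk (0 : X ⟶ (0 : C))
      map f := Arrow.homMk f (𝟙 _) }
  { T := A ⋙ data.Z
    η X := data.i.app (A.obj X)
    naturality f := data.i.naturality (A.map f)
    mono_η X := data.hi _ }

/-- Injectivity means that the map to zero lifts against monomorphisms, and the second factor of `X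
⟶ 0` has this property by construction. -/
instance (C : Type*) [Category* C] [Abelian C] [IsGrothendieckAbelian.{w} C] (X : C) :
    Injective ((ofIsGrothendieckAbelian.{w} C).T.obj X) := by
  rw [injective_iff_rlp_monomorphisms_zero]
  let data := MorphismProperty.functorialFactorizationData (MorphismProperty.monomorphisms C)
    (MorphismProperty.monomorphisms C).rlp
  have := data.hp (Arrow.mk (0 : X ⟶ (0 : C)))
  rwa [(isZero_zero C).eq_of_tgt (data.p.app (Arrow.mk (0 : X ⟶ (0 : C)))) 0] at this

variable {C : Type*} [Category* C] [Abelian C] (E : FunctorialEmbedding C)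

/-- The functor sending `X` to the cokernel of `X ⟶ T X`. -/
noncomputable def coker : C ⥤ C where
  obj X := cokernel (E.η X)
  map f := cokernel.map _ _ f (E.T.map f) (E.naturality f).symm

/-- The projection from `T X` to the cokernel of `X ⟶ T X`. -/
noncomputable def toCoker (X : C) : E.T.obj X ⟶ E.coker.obj X := cokernel.π (E.η X)

lemma toCoker_naturality {X Y : C} (f : X ⟶ Y) :
    E.T.map f ≫ E.toCoker Y = E.toCoker X ≫ E.coker.map f :=
  (cokernel.π_desc _ _ _).symm

lemma η_toCoker (X : C) : E.η X ≫ E.toCoker X = 0 := cokernel.condition _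

/-- The short exact sequence `0 ⟶ X ⟶ T X ⟶ coker ⟶ 0`. -/
noncomputable abbrev shortComplex (X : C) : ShortComplex C :=
  ShortComplex.mk (E.η X) (E.toCoker X) (E.η_toCoker X)

lemma shortExact (X : C) : (E.shortComplex X).ShortExact where
  exact := ShortComplex.exact_cokernel _
  mono_f := E.mono_η X
  epi_g := inferInstanceAs (Epi (cokernel.π _))

/-- The iterated cokernels. -/
noncomputable def syzygy : ℕ → C ⥤ C
  | 0 => 𝟭 C
  | n + 1 => syzygy n ⋙ E.coker

/-- The projection from `T K` to the next syzygy, where `K` is a syzygy. -/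
noncomputable def toSyzygy (n : ℕ) (X : C) :
    E.T.obj ((E.syzygy n).obj X) ⟶ (E.syzygy (n + 1)).obj X := E.toCoker _

lemma toSyzygy_naturality (n : ℕ) {X Y : C} (f : X ⟶ Y) :
    E.T.map ((E.syzygy n).map f) ≫ E.toSyzygy n Y = E.toSyzygy n X ≫ (E.syzygy (n + 1)).map f :=
  E.toCoker_naturality _

lemma η_toSyzygy (n : ℕ) (X : C) : E.η ((E.syzygy n).obj X) ≫ E.toSyzygy n X = 0 :=
  E.η_toCoker _

/-- The functorial coresolution `T X ⟶ T (coker X) ⟶ ⋯`. -/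
noncomputable def coresolution : C ⥤ CochainComplex C ℕ where
  obj X := CochainComplex.of (fun n => E.T.obj ((E.syzygy n).obj X))
    (fun n => E.toSyzygy n X ≫ E.η ((E.syzygy (n + 1)).obj X)) (fun n => by
      rw [Category.assoc, reassoc_of% (E.η_toSyzygy (n + 1) X), zero_comp, comp_zero])
  map {X Y} f :=
    { f n := E.T.map ((E.syzygy n).map f)
      comm' i j h := by
        obtain rfl : i + 1 = j := h
        dsimp only
        rw [CochainComplex.of_d, CochainComplex.of_d, reassoc_of% (E.toSyzygy_naturality i f),
          E.naturality, Category.assoc] }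
  map_id X := by ext n; simp
  map_comp f g := by ext n; simp

/-- The inclusion of a syzygy in the coresolution. -/
noncomputable def resι (n : ℕ) (X : C) : (E.syzygy n).obj X ⟶ (E.coresolution.obj X).X n :=
  E.η _

/-- The projection from the coresolution to a syzygy. -/
noncomputable def resπ (n : ℕ) (X : C) :
    (E.coresolution.obj X).X n ⟶ (E.syzygy (n + 1)).obj X :=
  E.toSyzygy n X

lemma resι_resπ (n : ℕ) (X : C) : E.resι n X ≫ E.resπ n X = 0 := E.η_toSyzygy n X

lemma coresolution_d (X : C) (n : ℕ) :
    (E.coresolution.obj X).d n (n + 1) = E.resπ n X ≫ E.resι (n + 1) X :=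
  CochainComplex.of_d (fun n => E.T.obj ((E.syzygy n).obj X))
    (fun n => E.toSyzygy n X ≫ E.η ((E.syzygy (n + 1)).obj X)) n

/-- The augmentation of the coresolution. -/
noncomputable def augmentation (X : C) : X ⟶ (E.coresolution.obj X).X 0 := E.resι 0 X

lemma augmentation_naturality {X Y : C} (f : X ⟶ Y) :
    E.augmentation X ≫ (E.coresolution.map f).f 0 = f ≫ E.augmentation Y :=
  (E.naturality f).symm

lemma augmentation_comp_d (X : C) : E.augmentation X ≫ (E.coresolution.obj X).d 0 1 = 0 := by
  have h := E.resι_resπ 0 X =≫ E.resι 1 X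
  rw [Category.assoc, ← coresolution_d, zero_comp] at h
  exact h

end FunctorialEmbedding

/-- A complex obtained by splicing short exact sequences `0 ⟶ Kᵃ ⟶ Cᵃ ⟶ Kᵃ⁺¹ ⟶ 0` with injective
middle terms is an injective resolution of `K⁰`. -/
lemma isInjectiveResolution_of_shortExact {B : Type*} [Category* B] [Abelian B]
    (C : CochainComplex B ℕ) (K : ℕ → B) (i : ∀ a, K a ⟶ C.X a) (p : ∀ a, C.X a ⟶ K (a + 1))
    (w : ∀ a, i a ≫ p a = 0) (h : ∀ a, (ShortComplex.mk _ _ (w a)).ShortExact)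
    (hd : ∀ a, C.d a (a + 1) = p a ≫ i (a + 1)) (hC : ∀ a, Injective (C.X a))
    (w' : i 0 ≫ C.d 0 1 = 0) :
    IsInjectiveResolution C (i 0) w' where
  injective := hC
  quasiIso := ⟨fun n => by
    have hm : ∀ a, Mono (i a) := fun a => (h a).mono_f
    have he : ∀ a, Epi (p a) := fun a => (h a).epi_g
    cases n with
    | zero =>
      rw [CochainComplex.quasiIsoAt₀_iff]
      refine (ShortComplex.quasiIso_iff_of_zeros _ rfl rfl (C.shape 0 0 (by simp))).2 ?_
      -- Since `d = p ≫ i` with `i` a monomorphism, `d` and `p` have the same kernel, so exactness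
      -- at `C⁰` is that of the given short exact sequence.
      let φ : ShortComplex.mk (i 0) (p 0) (w 0) ⟶ ShortComplex.mk (i 0) (C.d 0 1) w' :=
        { τ₁ := 𝟙 _
          τ₂ := 𝟙 _
          τ₃ := i 1
          comm₂₃ := by simp [hd] }
      have : Mono φ.τ₃ := hm 1
      have : IsIso φ.τ₂ := inferInstanceAs (IsIso (𝟙 _))
      have : Epi φ.τ₁ := inferInstanceAs (Epi (𝟙 _))
      exact (ShortComplex.exact_and_mono_f_iff_of_iso (S₁ := ShortComplex.mk (i 0) (C.d 0 1) w')
        (ShortComplex.isoMk (Iso.refl (K 0)) (Iso.refl (C.X 0)) (Iso.refl (C.X 1))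
        ((Category.id_comp _).trans ((CochainComplex.fromSingle₀Equiv_symm_apply_f_zero
          (i 0) w').trans (Category.comp_id _).symm))
        ((Category.id_comp _).trans (Category.comp_id _).symm))).1
        ⟨(ShortComplex.exact_iff_of_epi_of_isIso_of_mono φ).1 (h 0).exact, hm 0⟩
    | succ n =>
      rw [quasiIsoAt_iff_exactAt]
      · rw [HomologicalComplex.exactAt_iff' _ n (n + 1) (n + 1 + 1) (by simp) (by simp)]
        have w₁ : i (n + 1) ≫ C.d (n + 1) (n + 1 + 1) = 0 := by
          rw [hd, reassoc_of% (w (n + 1)), zero_comp]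
        -- Both the complex and the given short exact sequence are compared with the sequence with
        -- maps `i` and `d`: `φ` replaces `Cⁿ` by its quotient along the epimorphism `p`, and `ψ`
        -- enlarges the last term along the monomorphism `i`.
        let φ : ShortComplex.mk (C.d n (n + 1)) (C.d (n + 1) (n + 1 + 1))
            (C.d_comp_d n (n + 1) (n + 1 + 1)) ⟶ ShortComplex.mk (i (n + 1)) _ w₁ :=
          { τ₁ := p n
            τ₂ := 𝟙 _
            τ₃ := 𝟙 _
            comm₁₂ := by simp [hd] }
        let ψ : ShortComplex.mk (i (n + 1)) (p (n + 1)) (w (n + 1)) ⟶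
            ShortComplex.mk (i (n + 1)) _ w₁ :=
          { τ₁ := 𝟙 _
            τ₂ := 𝟙 _
            τ₃ := i (n + 2)
            comm₂₃ := by simp [hd] }
        have : Mono ψ.τ₃ := hm (n + 2)
        have : IsIso ψ.τ₂ := inferInstanceAs (IsIso (𝟙 _))
        have : Epi ψ.τ₁ := inferInstanceAs (Epi (𝟙 _))
        have : Mono φ.τ₃ := inferInstanceAs (Mono (𝟙 _))
        have : IsIso φ.τ₂ := inferInstanceAs (IsIso (𝟙 _))
        have : Epi φ.τ₁ := he n
        exact (ShortComplex.exact_iff_of_epi_of_isIso_of_mono φ).2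
          ((ShortComplex.exact_iff_of_epi_of_isIso_of_mono ψ).1 (h (n + 1)).exact)
      · apply CochainComplex.exactAt_succ_single_obj⟩

namespace FunctorialEmbedding

variable {C : Type*} [Category* C] [Abelian C] (E : FunctorialEmbedding C)
  {B : Type*} [Category* B] [Abelian B]

/-- The functor `Φ` need not be exact; it only has to preserve the short exact sequences from which
the coresolution is spliced. This is what allows `Φ` to be the cycles or the homology of complexes.
-/
lemma isInjectiveResolution_map (Φ : C ⥤ B) [Φ.PreservesZeroMorphisms]
    (hΦ : ∀ X, ((E.shortComplex X).map Φ).ShortExact) (hT : ∀ X, Injective (Φ.obj (E.T.obj X)))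
    (X : C) :
    IsInjectiveResolution ((Φ.mapHomologicalComplex (ComplexShape.up ℕ)).obj (E.coresolution.obj X))
      (Φ.map (E.augmentation X)) (map_comp_map_d Φ (E.augmentation_comp_d X)) :=
  isInjectiveResolution_of_shortExact
    ((Φ.mapHomologicalComplex (ComplexShape.up ℕ)).obj (E.coresolution.obj X))
    (fun a => Φ.obj ((E.syzygy a).obj X))
    (fun a => Φ.map (E.resι a X)) (fun a => Φ.map (E.resπ a X))
    (fun a => (Φ.map_comp _ _).symm.trans
      ((congrArg Φ.map (E.resι_resπ a X)).trans (Φ.map_zero _ _)))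
    (fun a => hΦ ((E.syzygy a).obj X))
    (fun a => (congrArg Φ.map (E.coresolution_d X a)).trans (Φ.map_comp _ _)) (fun _ => hT _) _

lemma isInjectiveResolution (hT : ∀ X, Injective (E.T.obj X)) (X : C) :
    IsInjectiveResolution (E.coresolution.obj X) (E.augmentation X) (E.augmentation_comp_d X) :=
  isInjectiveResolution_of_shortExact _ (fun a => (E.syzygy a).obj X)
    (fun a => E.resι a X) (fun a => E.resπ a X) _ (fun a => E.shortExact ((E.syzygy a).obj X))
    (fun a => E.coresolution_d X a) (fun _ => hT _) _

end FunctorialEmbedding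

end CategoryTheory

/-! ### Cartan–Eilenberg resolutions -/

namespace HomologicalComplex

variable {B : Type*} [Category* B] [Abelian B] {ι : Type*} {c : ComplexShape ι}

/-- The complex `K` is split: every differential `d` satisfies `d s d = d` for some `s`. -/
def IsSplit (K : HomologicalComplex B c) : Prop :=
  ∀ i j, ∃ s : K.X j ⟶ K.X i, K.d i j ≫ s ≫ K.d i j = K.d i j

variable (K : HomologicalComplex B c) {i j : ι} {t : K.X j ⟶ K.X i}

/-- The retraction `1 - d s` on cycles. -/
noncomputable def retractionCycles (hj : c.next i = j) (ht : K.d i j ≫ t ≫ K.d i j = K.d i j) :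
    K.X i ⟶ K.cycles i :=
  K.liftCycles (𝟙 _ - K.d i j ≫ t) j hj (by simp [ht])

lemma iCycles_retractionCycles (hj : c.next i = j) (ht : K.d i j ≫ t ≫ K.d i j = K.d i j) :
    K.iCycles i ≫ K.retractionCycles hj ht = 𝟙 _ := by
  rw [← cancel_mono (K.iCycles i)]
  simp [retractionCycles]

lemma retractionCycles_iCycles (hj : c.next i = j) (ht : K.d i j ≫ t ≫ K.d i j = K.d i j) :
    K.retractionCycles hj ht ≫ K.iCycles i = 𝟙 _ - K.d i j ≫ t := by
  simp [retractionCycles]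

/-- The section `1 - s d` of the projection to the homology. -/
noncomputable def sectionHomology (hi : c.prev j = i) (ht : K.d i j ≫ t ≫ K.d i j = K.d i j) :
    K.homology j ⟶ K.X j :=
  K.homologyι j ≫ K.descOpcycles (𝟙 _ - t ≫ K.d i j) i hi (by simp [ht])

lemma homologyπ_sectionHomology (hi : c.prev j = i) (ht : K.d i j ≫ t ≫ K.d i j = K.d i j) :
    K.homologyπ j ≫ K.sectionHomology hi ht = K.iCycles j ≫ (𝟙 _ - t ≫ K.d i j) := by
  simp [sectionHomology]

/-- Precomposed with the epimorphism `homologyπ`, the correction term `t ≫ d` factors through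
`toCycles` and dies in homology, while the remaining identity term is retracted onto the cycles.
Hence the homology is a retract of the term `K.X j`. -/
lemma sectionHomology_homologyπ {k : ι} {s : K.X k ⟶ K.X j} (hi : c.prev j = i)
    (ht : K.d i j ≫ t ≫ K.d i j = K.d i j) (hk : c.next j = k)
    (hs : K.d j k ≫ s ≫ K.d j k = K.d j k) :
    K.sectionHomology hi ht ≫ K.retractionCycles hk hs ≫ K.homologyπ j = 𝟙 _ := by
  have h : K.d i j ≫ K.retractionCycles hk hs = K.toCycles i j := by
    rw [← cancel_mono (K.iCycles j), Category.assoc, retractionCycles_iCycles]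
    simp
  rw [← cancel_epi (K.homologyπ j), ← Category.assoc, homologyπ_sectionHomology, Category.assoc,
    Preadditive.sub_comp, Category.assoc, reassoc_of% h]
  simp only [Category.id_comp, toCycles_comp_homologyπ, comp_zero, sub_zero]
  rw [← Category.assoc, iCycles_retractionCycles, Category.id_comp, Category.comp_id]

lemma IsSplit.injective_cycles {K : HomologicalComplex B c} (h : K.IsSplit) (i : ι)
    [Injective (K.X i)] : Injective (K.cycles i) := by
  obtain ⟨s, hs⟩ := h i (c.next i)
  exact Retract.injective ⟨K.iCycles i, K.retractionCycles rfl hs,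
    K.iCycles_retractionCycles rfl hs⟩

lemma IsSplit.injective_homology {K : HomologicalComplex B c} (h : K.IsSplit) (i : ι)
    [Injective (K.X i)] : Injective (K.homology i) := by
  obtain ⟨s, hs⟩ := h i (c.next i)
  obtain ⟨t, ht⟩ := h (c.prev i) i
  exact Retract.injective ⟨K.sectionHomology rfl ht, K.retractionCycles rfl hs ≫ K.homologyπ i,
    K.sectionHomology_homologyπ rfl ht rfl hs⟩

/-- If the homology maps of `X₁ ⟶ X₂` are monomorphisms, a short exact sequence of complexes
induces short exact sequences in homology. -/
lemma shortExact_map_homologyFunctor {S : ShortComplex (CochainComplex B ℕ)} (hS : S.ShortExact)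
    (h : ∀ n, Mono (homologyMap S.f n)) (n : ℕ) :
    (S.map (homologyFunctor B (ComplexShape.up ℕ) n)).ShortExact where
  exact := hS.homology_exact₂ n
  mono_f := h n
  epi_g := by
    -- The connecting map followed by `homologyMap S.f (n + 1)` is zero and the latter is a
    -- monomorphism, so the long exact sequence breaks into short ones.
    have h1 : hS.δ n (n + 1) rfl = 0 := by
      have := h (n + 1)
      exact (cancel_mono (homologyMap S.f (n + 1))).1
        ((hS.δ_comp n (n + 1) rfl).trans zero_comp.symm)
    exact (ShortComplex.exact_iff_epi _ h1).1 (hS.homology_exact₃ n (n + 1) rfl)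

/-- Cycles are always left exact. Surjectivity on cycles follows from surjectivity on boundaries,
which lift through the terms of the preceding degree, and on homology. -/
lemma shortExact_map_cyclesFunctor {S : ShortComplex (CochainComplex B ℕ)} (hS : S.ShortExact)
    (h : ∀ n, Mono (homologyMap S.f n)) (n : ℕ) :
    (S.map (cyclesFunctor B (ComplexShape.up ℕ) n)).ShortExact where
  exact := by
    have := hS.mono_f
    exact cycles_left_exact S hS.exact n
  mono_f := by
    have := hS.mono_f
    have : Mono (S.f.f n) := inferInstance
    have : Mono (S.X₁.iCycles n ≫ S.f.f n) := inferInstance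
    rw [← cyclesMap_i] at this
    exact mono_of_mono (cyclesMap S.f n) (S.X₂.iCycles n)
  epi_g := by
    have := hS.epi_g
    have h2 : Epi (homologyMap S.g n) := (shortExact_map_homologyFunctor hS h n).epi_g
    have h3 : ∀ j, Epi (S.g.f j) := fun j => inferInstance
    change Epi (cyclesMap S.g n)
    -- A map `φ` that kills the image of the cycles of `X₂` kills the boundaries of `X₃`, so it
    -- factors through the homology of `X₃`, where the map from the homology of `X₂` is already epi.
    refine Preadditive.epi_of_cancel_zero _ fun {W} φ hφ => ?_
    let p := (ComplexShape.up ℕ).prev n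
    have h4 : S.X₃.toCycles p n ≫ φ = 0 := by
      rw [← cancel_epi (S.g.f p)]
      have : S.g.f p ≫ S.X₃.toCycles p n = S.X₂.toCycles p n ≫ cyclesMap S.g n := by
        rw [← cancel_mono (S.X₃.iCycles n)]
        simp
      rw [reassoc_of% this, hφ, comp_zero, comp_zero]
    obtain ⟨ψ, rfl⟩ : ∃ ψ, φ = S.X₃.homologyπ n ≫ ψ :=
      ⟨_, ((S.X₃.homologyIsCokernel p n rfl).fac (CokernelCofork.ofπ φ h4)
        WalkingParallelPair.one).symm⟩
    rw [← homologyπ_naturality_assoc] at hφ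
    have h5 : homologyMap S.g n ≫ ψ = 0 :=
      (cancel_epi (S.X₂.homologyπ n)).1 (hφ.trans comp_zero.symm)
    rw [(cancel_epi (homologyMap S.g n)).1 (h5.trans comp_zero.symm), comp_zero]

end HomologicalComplex

/-! ### Functorial Cartan–Eilenberg resolutions -/

namespace CategoryTheory.FunctorialEmbedding

open HomologicalComplex

variable {B : Type*} [Category* B] [Abelian B] (E : FunctorialEmbedding B)

/-- The functorial embedding of complexes in split complexes. -/
noncomputable def complexEmbedding : FunctorialEmbedding (CochainComplex B ℕ) where
  T :=
    -- The differential carries the first summand `T(K^{n+1})` identically onto the second summand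
    -- in degree `n + 1`, so these two form a contractible complex. The third summand has zero
    -- differential and receives the homology of `K`.
    { obj K := CochainComplex.of
        (fun n => E.T.obj (K.X (n + 1)) ⊞ (E.T.obj (K.X n) ⊞ E.T.obj (K.opcycles n)))
        (fun n => biprod.fst ≫ biprod.inl ≫ biprod.inr) (fun n => by simp)
      map f :=
        { f n := biprod.map (E.T.map (f.f (n + 1)))
            (biprod.map (E.T.map (f.f n)) (E.T.map (opcyclesMap f n)))
          comm' i j h := by
            obtain rfl : i + 1 = j := h
            dsimp only
            rw [CochainComplex.of_d, CochainComplex.of_d]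
            simp }
      map_id K := by
        ext n : 1
        apply biprod.hom_ext
        · simp
        · apply biprod.hom_ext <;> simp
      map_comp f g := by
        ext n : 1
        apply biprod.hom_ext
        · simp
        · apply biprod.hom_ext <;> simp [opcyclesMap_comp] }
  η K :=
    { f n := biprod.lift (K.d n (n + 1) ≫ E.η _)
        (biprod.lift (E.η _) (K.pOpcycles n ≫ E.η _))
      comm' i j h := by
        obtain rfl : i + 1 = j := h
        dsimp only
        rw [CochainComplex.of_d]
        apply biprod.hom_ext
        · simp
        · apply biprod.hom_ext <;> simp }
  naturality {K L} f := by
    ext n : 1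
    apply biprod.hom_ext
    · simp [← E.naturality]
    · apply biprod.hom_ext <;> simp [← E.naturality]
  mono_η K := by
    have : ∀ n, Mono (biprod.lift (K.d n (n + 1) ≫ E.η _)
        (biprod.lift (E.η _) (K.pOpcycles n ≫ E.η _))) := fun n =>
      -- The component in `T(Kⁿ)` alone is a monomorphism.
      mono_of_mono_fac (show _ ≫ biprod.snd ≫ biprod.fst = E.η (K.X n) by simp)
    exact HomologicalComplex.mono_of_mono_f _ this

/-- The differential is an identity between summands, and the splitting is the same identity in the
opposite direction. -/
lemma isSplit_complexEmbedding (K : CochainComplex B ℕ) :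
    (E.complexEmbedding.T.obj K).IsSplit := by
  intro i j
  by_cases h : i + 1 = j
  · obtain rfl := h
    let Y := fun n => E.T.obj (K.X (n + 1)) ⊞ (E.T.obj (K.X n) ⊞ E.T.obj (K.opcycles n))
    let s : Y (i + 1) ⟶ Y i := biprod.snd ≫ biprod.fst ≫ biprod.inl
    let d : ∀ n, Y n ⟶ Y (n + 1) := fun n => biprod.fst ≫ biprod.inl ≫ biprod.inr
    have hd : (E.complexEmbedding.T.obj K).d i (i + 1) = d i := CochainComplex.of_d Y d i
    refine ⟨s, ?_⟩
    rw [hd]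
    exact (by simp [d, s] : d i ≫ s ≫ d i = d i)
  · exact ⟨0, by rw [(E.complexEmbedding.T.obj K).shape i j h]; simp⟩

lemma injective_complexEmbedding (hE : ∀ X, Injective (E.T.obj X)) (K : CochainComplex B ℕ)
    (n : ℕ) : Injective ((E.complexEmbedding.T.obj K).X n) :=
  inferInstanceAs (Injective (E.T.obj _ ⊞ (E.T.obj _ ⊞ E.T.obj _)))

/-- This is the purpose of the summand `T(opcycles)`. The projection `p` to it kills boundaries, so
it is defined on homology, and there the composite is the inclusion of the homology of `K` in its
opcycles followed by the monomorphism `E.η`. -/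
lemma mono_homologyMap_complexEmbedding (K : CochainComplex B ℕ) (n : ℕ) :
    Mono (homologyMap (E.complexEmbedding.η K) n) := by
  let L := E.complexEmbedding.T.obj K
  let p : L.X n ⟶ E.T.obj (K.opcycles n) := biprod.snd ≫ biprod.snd
  have hp : L.d ((ComplexShape.up ℕ).prev n) n ≫ p = 0 := by
    by_cases h : (ComplexShape.up ℕ).prev n + 1 = n
    · generalize (ComplexShape.up ℕ).prev n = m at *
      obtain rfl := h
      let Y := fun n => E.T.obj (K.X (n + 1)) ⊞ (E.T.obj (K.X n) ⊞ E.T.obj (K.opcycles n))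
      let d : ∀ n, Y n ⟶ Y (n + 1) := fun n => biprod.fst ≫ biprod.inl ≫ biprod.inr
      have hd : L.d m (m + 1) = d m := CochainComplex.of_d Y d m
      rw [hd]
      exact (by simp [d] : d m ≫ (biprod.snd ≫ biprod.snd) = 0)
    · rw [L.shape _ _ h, zero_comp]
  have h1 : (E.complexEmbedding.η K).f n ≫ p = K.pOpcycles n ≫ E.η _ := by
    exact (by simp : biprod.lift (K.d n (n + 1) ≫ E.η _)
        (biprod.lift (E.η _) (K.pOpcycles n ≫ E.η _)) ≫ biprod.snd ≫ biprod.snd =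
          K.pOpcycles n ≫ E.η _)
  have h2 : opcyclesMap (E.complexEmbedding.η K) n ≫ L.descOpcycles p _ rfl hp = E.η _ := by
    rw [← cancel_epi (K.pOpcycles n), p_opcyclesMap_assoc, p_descOpcycles, h1]
  have h3 : homologyMap (E.complexEmbedding.η K) n ≫ L.homologyι n ≫ L.descOpcycles p _ rfl hp =
      K.homologyι n ≫ E.η _ := by
    rw [← h2]
    simp [L]
  have : Mono (homologyMap (E.complexEmbedding.η K) n ≫ L.homologyι n ≫
      L.descOpcycles p _ rfl hp) := by
    rw [h3]; infer_instance
  exact mono_of_mono _ (L.homologyι n ≫ L.descOpcycles p _ rfl hp)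

/-- The functorial Cartan–Eilenberg resolution. -/
noncomputable def cartanEilenbergResolution (hE : ∀ X, Injective (E.T.obj X))
    (K : CochainComplex B ℕ) : CartanEilenbergResolution K where
  cocomplex := E.complexEmbedding.coresolution.obj K
  ι := E.complexEmbedding.augmentation K
  ι_comp_d := E.complexEmbedding.augmentation_comp_d K
  terms b := E.complexEmbedding.isInjectiveResolution_map (HomologicalComplex.eval B _ b)
    (fun X => (E.complexEmbedding.shortExact X).map_of_exact _)
    (fun X => E.injective_complexEmbedding hE X b) K
  cycles b := E.complexEmbedding.isInjectiveResolution_map (HomologicalComplex.cyclesFunctor B _ b)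
    (fun X => shortExact_map_cyclesFunctor (E.complexEmbedding.shortExact X)
      (E.mono_homologyMap_complexEmbedding X) b)
    (fun X => by
      have := E.injective_complexEmbedding hE X b
      exact (E.isSplit_complexEmbedding X).injective_cycles b) K
  homology b := E.complexEmbedding.isInjectiveResolution_map
    (HomologicalComplex.homologyFunctor B _ b)
    (fun X => shortExact_map_homologyFunctor (E.complexEmbedding.shortExact X)
      (E.mono_homologyMap_complexEmbedding X) b)
    (fun X => by
      have := E.injective_complexEmbedding hE X b
      exact (E.isSplit_complexEmbedding X).injective_homology b) K

/-- Splitness of the columns is not part of the notion of a Cartan–Eilenberg resolution used here;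
it is recorded because it makes an additive functor commute with the cycles and the homology of the
columns. -/
lemma isSplit_cartanEilenbergResolution (hE : ∀ X, Injective (E.T.obj X))
    (K : CochainComplex B ℕ) (a : ℕ) :
    ((E.cartanEilenbergResolution hE K).cocomplex.X a).IsSplit :=
  E.isSplit_complexEmbedding _

end CategoryTheory.FunctorialEmbedding

/-! ### Homology of complexes of modules -/

namespace HomologicalComplex

variable {R : Type v} [Ring R] {ι : Type*} {c : ComplexShape ι}
  (K : HomologicalComplex (ModuleCat.{w} R) c) (i : ι)

lemma iCycles_injective : Function.Injective (K.iCycles i).hom :=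
  (ModuleCat.mono_iff_injective _).1 inferInstance

lemma homologyπ_surjective : Function.Surjective (K.homologyπ i).hom :=
  (ModuleCat.epi_iff_surjective _).1 inferInstance

lemma d_iCycles_apply (z : K.cycles i) (j : ι) : (K.d i j).hom ((K.iCycles i).hom z) = 0 :=
  congrArg (fun f => f.hom z) (K.iCycles_d i j)

lemma homologyπ_eq_zero_iff (z : K.cycles i) :
    (K.homologyπ i).hom z = 0 ↔ ∃ (j : ι) (y : K.X j), (K.d j i).hom y = (K.iCycles i).hom z := by
  constructor
  · intro hz
    let S := ShortComplex.mk (K.toCycles (c.prev i) i) (K.homologyπ i)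
      (K.toCycles_comp_homologyπ _ _)
    have hS : S.Exact := S.exact_of_g_is_cokernel (K.homologyIsCokernel _ i rfl)
    obtain ⟨y, hy⟩ := (ShortComplex.moduleCat_exact_iff S).1 hS z hz
    refine ⟨_, y, ?_⟩
    rw [← hy]
    exact (congrArg (fun f => f.hom y) (K.toCycles_i (c.prev i) i)).symm
  · rintro ⟨j, y, hy⟩
    have h : z = (K.toCycles j i).hom y := K.iCycles_injective i (hy.symm.trans
      (congrArg (fun f => f.hom y) (K.toCycles_i j i)).symm)
    rw [h]
    exact congrArg (fun f => f.hom y) (K.toCycles_comp_homologyπ j i)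

lemma exists_iCycles_eq (x : K.X i) (hx : ∀ j, (K.d i j).hom x = 0) :
    ∃ z : K.cycles i, (K.iCycles i).hom z = x := by
  let f : ModuleCat.of R (LinearMap.ker (K.d i (c.next i)).hom) ⟶ K.X i :=
    ModuleCat.ofHom (Submodule.subtype _)
  have hf : f ≫ K.d i (c.next i) = 0 := by
    ext y
    exact y.2
  exact ⟨(K.liftCycles f _ rfl hf).hom ⟨x, hx _⟩,
    congrArg (fun g => g.hom ⟨x, hx _⟩) (K.liftCycles_i f _ rfl hf)⟩

/-- An identification of the homology of a complex of modules. -/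
lemma exists_homologyIso {Z : Type*} [AddCommGroup Z] [Module R Z] {N : ModuleCat.{w} R}
    (p : Z →ₗ[R] K.X i) (q : Z →ₗ[R] N) (hp : ∀ z j, (K.d i j).hom (p z) = 0)
    (hp' : ∀ x, (∀ j, (K.d i j).hom x = 0) → ∃ z, p z = x) (hq : Function.Surjective q)
    (hpq : ∀ z, q z = 0 ↔ ∃ (j : ι) (y : K.X j), (K.d j i).hom y = p z) :
    ∃ e : K.homology i ≅ N, ∀ (y : K.cycles i) (z : Z), (K.iCycles i).hom y = p z →
      e.hom.hom ((K.homologyπ i).hom y) = q z := by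
  choose l hl using fun z => K.exists_iCycles_eq i (p z) (hp z)
  -- The map `m` takes the homology class of `p z`. Then `m` and `q` are surjections from `Z` with
  -- the same kernel, and their targets are isomorphic.
  let m : Z →ₗ[R] K.homology i :=
    { toFun z := (K.homologyπ i).hom (l z)
      map_add' z z' := by
        rw [← map_add]
        exact congrArg _ (K.iCycles_injective i (by simp only [map_add, hl]))
      map_smul' r z := by
        rw [RingHom.id_apply, ← map_smul]
        exact congrArg _ (K.iCycles_injective i (by simp only [map_smul, hl])) }
  have hm : Function.Surjective m := fun h => by
    obtain ⟨y, rfl⟩ := K.homologyπ_surjective i h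
    obtain ⟨z, hz⟩ := hp' ((K.iCycles i).hom y) (K.d_iCycles_apply i y)
    exact ⟨z, congrArg (K.homologyπ i).hom (K.iCycles_injective i ((hl z).trans hz))⟩
  have hk : LinearMap.ker m = LinearMap.ker q := by
    ext z
    rw [LinearMap.mem_ker, LinearMap.mem_ker, hpq, ← hl z]
    exact K.homologyπ_eq_zero_iff i (l z)
  let e : K.homology i ≃ₗ[R] N := (m.quotKerEquivOfSurjective hm).symm ≪≫ₗ
    Submodule.quotEquivOfEq _ _ hk ≪≫ₗ q.quotKerEquivOfSurjective hq
  refine ⟨e.toModuleIso, fun y z hy => ?_⟩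
  have : (K.homologyπ i).hom y = m z :=
    congrArg (K.homologyπ i).hom (K.iCycles_injective i (hy.trans (hl z).symm))
  change e ((K.homologyπ i).hom y) = q z
  rw [this]
  have h1 : (m.quotKerEquivOfSurjective hm).symm (m z) = Submodule.Quotient.mk z := by
    rw [LinearEquiv.symm_apply_eq]; rfl
  change q.quotKerEquivOfSurjective hq (Submodule.quotEquivOfEq _ _ hk
    ((m.quotKerEquivOfSurjective hm).symm (m z))) = q z
  rw [h1]
  rfl

end HomologicalComplex

/-! ### The total complex of a double complex -/

namespace DoubleComplex

variable {R : Type v} [Ring R] (D : DoubleComplex.{v, w} R)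

lemma totD_apply (x : D.Tot) (a b : ℕ) :
    D.totD x a b = ((D.d (a - 1) a).f b).hom (x (a - 1) b) +
      (-1 : ℤ) ^ a • ((D.X a).d (b - 1) b).hom (x a (b - 1)) := rfl

lemma d_d_apply (a a' a'' b : ℕ) (x : (D.X a).X b) :
    ((D.d a' a'').f b).hom (((D.d a a').f b).hom x) = 0 :=
  congrArg (fun f => (f.f b).hom x) (D.d_comp_d a a' a'')

lemma d_d_apply' (a b b' b'' : ℕ) (x : (D.X a).X b) :
    ((D.X a).d b' b'').hom (((D.X a).d b b').hom x) = 0 :=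
  congrArg (fun f => f.hom x) ((D.X a).d_comp_d b b' b'')

lemma d_comm_apply (a a' b b' : ℕ) (x : (D.X a).X b) :
    ((D.X a').d b b').hom (((D.d a a').f b).hom x) =
      ((D.d a a').f b').hom (((D.X a).d b b').hom x) :=
  congrArg (fun f => f.hom x) ((D.d a a').comm b b')

lemma d_zero_apply (b : ℕ) (x : (D.X 0).X b) : ((D.d 0 0).f b).hom x = 0 :=
  congrArg (fun f => (f.f b).hom x) (D.shape 0 0 (by simp))

lemma d_zero_apply' (a : ℕ) (x : (D.X a).X 0) : ((D.X a).d 0 0).hom x = 0 :=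
  congrArg (fun f => f.hom x) ((D.X a).shape 0 0 (by simp))

lemma totD_totD (x : D.Tot) : D.totD (D.totD x) = 0 := by
  funext a b
  rw [totD_apply, totD_apply, totD_apply]
  simp only [map_add, map_zsmul, d_d_apply, d_d_apply', zero_add, smul_zero, add_zero]
  rw [d_comm_apply]
  -- For `a > 0` the mixed terms carry opposite signs and cancel. For `a = 0` the truncated exponent
  -- makes the signs equal, but then `D.d 0 0` is zero.
  cases a with
  | zero =>
    rw [d_zero_apply, smul_zero, add_zero]
    rfl
  | succ a =>
    simp only [Nat.add_sub_cancel]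
    rw [← add_smul, pow_succ]
    simp

variable {D}

lemma totD_mem_totDegree {x : D.Tot} {n : ℤ} (hx : x ∈ D.totDegree n) {m : ℤ} (hm : n + 1 = m) :
    D.totD x ∈ D.totDegree m := by
  intro a b hab
  rw [totD_apply]
  have h1 : ((D.d (a - 1) a).f b).hom (x (a - 1) b) = 0 := by
    cases a with
    | zero => exact D.d_zero_apply b _
    | succ a => rw [Nat.add_sub_cancel, hx a b (by push_cast at hab; lia), map_zero]
  have h2 : ((D.X a).d (b - 1) b).hom (x a (b - 1)) = 0 := by
    cases b with
    | zero => exact D.d_zero_apply' a _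
    | succ b => rw [Nat.add_sub_cancel, hx a b (by push_cast at hab; lia), map_zero]
  rw [h1, h2, smul_zero, add_zero]

lemma totD_mem_fil {x : D.Tot} {s : ℤ} (hx : x ∈ D.fil s) : D.totD x ∈ D.fil s := by
  intro a b hab
  rw [totD_apply, hx a _ hab, hx (a - 1) b (by lia), map_zero, map_zero, smul_zero, add_zero]

lemma fil_le {s t : ℤ} (h : s ≤ t) : D.fil t ≤ D.fil s :=
  fun _ hx a b hab => hx a b (by lia)

lemma mem_fil_of_nonpos (x : D.Tot) {s : ℤ} (h : s ≤ 0) : x ∈ D.fil s :=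
  fun a b hab => by lia

/-- In the first quadrant the first index is at most the total degree. All finiteness statements
rest on this: the filtration stops, and differentials that leave the quadrant vanish already on
representatives. -/
lemma eq_zero_of_mem_fil {x : D.Tot} {n s : ℤ} (h : x ∈ D.totDegree n) (h' : x ∈ D.fil s)
    (hs : n < s) : x = 0 := by
  funext a b
  by_cases ha : (a : ℤ) < s
  · exact h' a b ha
  · exact h a b (by lia)

lemma mem_approxCycles {r s n : ℤ} {x : D.Tot} :
    x ∈ D.approxCycles r s n ↔ x ∈ D.totDegree n ∧ x ∈ D.fil s ∧ D.totD x ∈ D.fil (s + r) :=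
  and_assoc

lemma approxCycles_le {r r' s s' n : ℤ} (hs : s' ≤ s) (hr : s' + r' ≤ s + r) :
    D.approxCycles r s n ≤ D.approxCycles r' s' n := fun _ hx => by
  rw [mem_approxCycles] at hx ⊢
  exact ⟨hx.1, fil_le hs hx.2.1, fil_le hr hx.2.2⟩

lemma totD_mem_approxCycles {r r' s s' n n' : ℤ} {x : D.Tot} (hx : x ∈ D.approxCycles r s n)
    (hs : s' ≤ s + r) (hn : n + 1 = n') : D.totD x ∈ D.approxCycles r' s' n' := by
  rw [mem_approxCycles] at hx ⊢
  refine ⟨totD_mem_totDegree hx.1 hn, fil_le hs hx.2.2, ?_⟩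
  rw [totD_totD]
  exact zero_mem _

variable (D) in
/-- The boundaries `Z_{r-1}^{s+1} + d Z_{r-1}^{s-r+1}` in total degree `n`. -/
def approxBoundaries (r s n : ℤ) : Submodule R D.Tot :=
  D.approxCycles (r - 1) (s + 1) n ⊔ (D.approxCycles (r - 1) (s - r + 1) (n - 1)).map D.totD

lemma mem_approxBoundaries {r s n : ℤ} {x : D.Tot} :
    x ∈ D.approxBoundaries r s n ↔ ∃ w ∈ D.approxCycles (r - 1) (s + 1) n,
      ∃ y ∈ D.approxCycles (r - 1) (s - r + 1) (n - 1), x = w + D.totD y := by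
  rw [approxBoundaries, Submodule.mem_sup]
  constructor
  · rintro ⟨w, hw, _, ⟨y, hy, rfl⟩, rfl⟩
    exact ⟨w, hw, y, hy, rfl⟩
  · rintro ⟨w, hw, y, hy, rfl⟩
    exact ⟨w, hw, _, ⟨y, hy, rfl⟩, rfl⟩

lemma totD_mem_approxBoundaries {r s n : ℤ} {x : D.Tot} (hx : x ∈ D.approxBoundaries r s n)
    {s' n' : ℤ} (hs : s + r = s') (hn : n + 1 = n') : D.totD x ∈ D.approxBoundaries r s' n' := by
  obtain ⟨w, hw, y, hy, rfl⟩ := mem_approxBoundaries.1 hx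
  obtain rfl : n = n' - 1 := by lia
  refine mem_approxBoundaries.2 ⟨0, zero_mem _, w, ?_, ?_⟩
  · exact approxCycles_le (by lia) (by lia) hw
  · rw [map_add, totD_totD, zero_add, add_zero]

/-! ### Morphisms of double complexes -/

section map

variable {D' D'' : DoubleComplex.{v, w} R} (f : D ⟶ D')

/-- The map induced by a morphism of double complexes on the total complexes. -/
def totMap : D.Tot →ₗ[R] D'.Tot where
  toFun x := fun a b => ((f.f a).f b).hom (x a b)
  map_add' x y := by funext a b; exact map_add _ _ _
  map_smul' c x := by funext a b; exact map_smul _ _ _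

lemma totMap_totD (x : D.Tot) : totMap f (D.totD x) = D'.totD (totMap f x) := by
  funext a b
  have h1 : ∀ y, ((f.f a).f b).hom (((D.d (a - 1) a).f b).hom y) =
      ((D'.d (a - 1) a).f b).hom (((f.f (a - 1)).f b).hom y) := fun y =>
    (congrArg (fun g => (g.f b).hom y) (f.comm (a - 1) a)).symm
  have h2 : ∀ y, ((f.f a).f b).hom (((D.X a).d (b - 1) b).hom y) =
      ((D'.X a).d (b - 1) b).hom (((f.f a).f (b - 1)).hom y) := fun y =>
    (congrArg (fun g => g.hom y) ((f.f a).comm (b - 1) b)).symm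
  change ((f.f a).f b).hom (D.totD x a b) = D'.totD (totMap f x) a b
  rw [totD_apply, totD_apply, map_add, map_zsmul, h1, h2]
  rfl

lemma totMap_mem_totDegree {x : D.Tot} {n : ℤ} (hx : x ∈ D.totDegree n) :
    totMap f x ∈ D'.totDegree n := fun a b hab => by
  change ((f.f a).f b).hom (x a b) = 0
  rw [hx a b hab, map_zero]

lemma totMap_mem_fil {x : D.Tot} {s : ℤ} (hx : x ∈ D.fil s) : totMap f x ∈ D'.fil s :=
  fun a b hab => by
    change ((f.f a).f b).hom (x a b) = 0
    rw [hx a b hab, map_zero]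

lemma totMap_mem_approxCycles {x : D.Tot} {r s n : ℤ} (hx : x ∈ D.approxCycles r s n) :
    totMap f x ∈ D'.approxCycles r s n := by
  rw [mem_approxCycles] at hx ⊢
  refine ⟨totMap_mem_totDegree f hx.1, totMap_mem_fil f hx.2.1, ?_⟩
  rw [← totMap_totD]
  exact totMap_mem_fil f hx.2.2

lemma totMap_mem_approxBoundaries {x : D.Tot} {r s n : ℤ} (hx : x ∈ D.approxBoundaries r s n) :
    totMap f x ∈ D'.approxBoundaries r s n := by
  obtain ⟨w, hw, y, hy, rfl⟩ := mem_approxBoundaries.1 hx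
  exact mem_approxBoundaries.2 ⟨_, totMap_mem_approxCycles f hw, _, totMap_mem_approxCycles f hy,
    by rw [map_add, totMap_totD]⟩

lemma totMap_single (a b : ℕ) (x : (D.X a).X b) :
    totMap f (D.single a b x) = D'.single a b (((f.f a).f b).hom x) := by
  funext a' b'
  change ((f.f a').f b').hom (D.single a b x a' b') = D'.single a b _ a' b'
  unfold single
  by_cases ha : a' = a
  · subst ha
    rw [Pi.single_eq_same, Pi.single_eq_same]
    by_cases hb : b' = b
    · subst hb
      rw [Pi.single_eq_same, Pi.single_eq_same]
    · rw [Pi.single_eq_of_ne hb, Pi.single_eq_of_ne hb, map_zero]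
  · rw [Pi.single_eq_of_ne ha, Pi.single_eq_of_ne ha]
    exact map_zero _

end map

/-! ### The spectral sequence of a double complex -/

variable (D)

/-- The module `E_r^{a,b}`. -/
abbrev PageX (r : ℤ) (a b : ℕ) : Type w :=
  D.approxCycles r a (a + b) ⧸ (D.approxBoundaries r a (a + b)).submoduleOf
    (D.approxCycles r a (a + b))

/-- The projection from `Z_r^{a,b}` to `E_r^{a,b}`. -/
def pageπ (r : ℤ) (a b : ℕ) : D.approxCycles r a (a + b) →ₗ[R] D.PageX r a b :=
  Submodule.mkQ _

lemma pageπ_surjective (r : ℤ) (a b : ℕ) : Function.Surjective (D.pageπ r a b) :=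
  Submodule.mkQ_surjective _

lemma pageπ_eq_zero_iff (r : ℤ) (a b : ℕ) (x : D.approxCycles r a (a + b)) :
    D.pageπ r a b x = 0 ↔ x.1 ∈ D.approxBoundaries r a (a + b) :=
  Submodule.Quotient.mk_eq_zero _

lemma pageπ_eq_iff (r : ℤ) (a b : ℕ) (x y : D.approxCycles r a (a + b)) :
    D.pageπ r a b x = D.pageπ r a b y ↔ x.1 - y.1 ∈ D.approxBoundaries r a (a + b) := by
  rw [← sub_eq_zero, ← map_sub, pageπ_eq_zero_iff]
  rfl

/-- The differential `E_r^{a,b} → E_r^{a+r,b-r+1}`. -/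
def pageD (r : ℤ) (a b a' b' : ℕ) (ha : (a : ℤ) + r = a') (hb : (b : ℤ) + (1 - r) = b') :
    D.PageX r a b →ₗ[R] D.PageX r a' b' :=
  Submodule.mapQ _ _ (D.totD.restrict fun _ hx =>
    totD_mem_approxCycles (r' := r) (s' := a') (n' := a' + b') hx ha.ge (by lia))
    fun _ hx => totD_mem_approxBoundaries hx ha (by lia)

lemma pageD_pageπ (r : ℤ) (a b a' b' : ℕ) (ha : (a : ℤ) + r = a') (hb : (b : ℤ) + (1 - r) = b')
    (x : D.approxCycles r a (a + b)) :
    D.pageD r a b a' b' ha hb (D.pageπ r a b x) = D.pageπ r a' b' ⟨D.totD x.1,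
      totD_mem_approxCycles x.2 ha.ge (by lia)⟩ := rfl

open Classical in
/-- The page `E_r`. -/
noncomputable def page (r : ℤ) :
    HomologicalComplex (ModuleCat.{w} R) (ComplexShape.spectralSequenceNat (r, 1 - r)) where
  X p := ModuleCat.of R (D.PageX r p.1 p.2)
  d p q := if h : (p.1 : ℤ) + r = q.1 ∧ (p.2 : ℤ) + (1 - r) = q.2 then
    ModuleCat.ofHom (D.pageD r p.1 p.2 q.1 q.2 h.1 h.2) else 0
  shape p q h := dif_neg h
  d_comp_d' p q s h h' := by
    rw [dif_pos (show _ ∧ _ from h), dif_pos (show _ ∧ _ from h')]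
    ext x
    change D.pageD r q.1 q.2 s.1 s.2 h'.1 h'.2
      (D.pageD r p.1 p.2 q.1 q.2 h.1 h.2 (D.pageπ r p.1 p.2 x)) = 0
    rw [pageD_pageπ, pageD_pageπ, pageπ_eq_zero_iff]
    change D.totD (D.totD x.1) ∈ _
    rw [totD_totD]
    exact zero_mem _

lemma page_d (r : ℤ) (a b a' b' : ℕ) (ha : (a : ℤ) + r = a') (hb : (b : ℤ) + (1 - r) = b') :
    (D.page r).d (a, b) (a', b') = ModuleCat.ofHom (D.pageD r a b a' b' ha hb) :=
  dif_pos (show (a : ℤ) + r = a' ∧ (b : ℤ) + (1 - r) = b' from ⟨ha, hb⟩)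

/-- The map `Z_{r+1}^{a,b} → E_r^{a,b}`. -/
def pageπ' (r r' : ℤ) (h : r + 1 = r') (a b : ℕ) :
    D.approxCycles r' a (a + b) →ₗ[R] D.PageX r a b :=
  D.pageπ r a b ∘ₗ Submodule.inclusion (approxCycles_le le_rfl (by lia))

/-- If `d_r` kills the class of `x`, then `dx = w + dy` with `w ∈ F^{a+r+1}` and `y ∈
Z_{r-1}^{a+1}`. So `x - y` lies in `Z_{r+1}`, and it has the same class as `x` because `y` is among
the elements divided out in `E_r`. -/
lemma exists_pageπ'_eq (r r' : ℤ) (h : r + 1 = r') (hr : 2 ≤ r) (a b : ℕ) (x : D.PageX r a b)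
    (hx : ∀ j, ((D.page r).d (a, b) j).hom x = 0) : ∃ z, D.pageπ' r r' h a b z = x := by
  obtain ⟨x, rfl⟩ := D.pageπ_surjective r a b x
  have hxx := mem_approxCycles.1 x.2
  by_cases hb : 0 ≤ (b : ℤ) + (1 - r)
  · obtain ⟨b', hb'⟩ := Int.eq_ofNat_of_zero_le hb
    obtain ⟨a', ha'⟩ := Int.eq_ofNat_of_zero_le (show 0 ≤ (a : ℤ) + r by lia)
    have := hx (a', b')
    rw [page_d D r a b a' b' ha' hb'] at this
    change D.pageD r a b a' b' ha' hb' (D.pageπ r a b _) = 0 at this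
    rw [pageD_pageπ, pageπ_eq_zero_iff] at this
    obtain ⟨w, hw, y, hy, e⟩ := mem_approxBoundaries.1 this
    rw [mem_approxCycles] at hw hy
    have e' : D.totD (x.1 - y) = w := by
      rw [map_sub]
      exact sub_eq_of_eq_add e
    have hy1 : y ∈ D.totDegree (a + b) := by
      have : (a' : ℤ) + b' - 1 = a + b := by lia
      rw [← this]; exact hy.1
    refine ⟨⟨x.1 - y, mem_approxCycles.2 ⟨sub_mem hxx.1 hy1,
      sub_mem hxx.2.1 (fil_le (by lia) hy.2.1), ?_⟩⟩, ?_⟩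
    · rw [e']
      exact fil_le (by lia) hw.2.1
    · refine (D.pageπ_eq_iff r a b _ _).2 ?_
      change x.1 - y - x.1 ∈ _
      rw [sub_sub_cancel_left]
      refine neg_mem (mem_approxBoundaries.2 ⟨y, mem_approxCycles.2 ⟨hy1, fil_le (by lia) hy.2.1,
        fil_le (by lia) hy.2.2⟩, 0, zero_mem _, by rw [map_zero, add_zero]⟩)
  -- Here the target of `d_r` is outside the quadrant: `dx` lies in `F^{a+r}` and has degree `a + b
  -- + 1 < a + r`.
  · have h0 : D.totD x.1 = 0 :=
      eq_zero_of_mem_fil (totD_mem_totDegree hxx.1 rfl) hxx.2.2 (by lia)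
    exact ⟨⟨x.1, mem_approxCycles.2 ⟨hxx.1, hxx.2.1, by rw [h0]; exact zero_mem _⟩⟩, rfl⟩

/-- Both sides are quotients of `Z_{r+1}`: it maps onto the cycles of `E_r` by `exists_pageπ'_eq`,
and the elements whose class is a `d_r`-boundary are exactly those of `Z_r^{a+1} + d Z_r^{a-r}`. -/
lemma exists_pageIso (r r' : ℤ) (h : r + 1 = r') (hr : 2 ≤ r) (a b : ℕ) :
    ∃ e : (D.page r).homology (a, b) ≅ (D.page r').X (a, b),
      ∀ (y : (D.page r).cycles (a, b)) (z : D.approxCycles r' a (a + b)),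
        ((D.page r).iCycles (a, b)).hom y = D.pageπ' r r' h a b z →
          e.hom.hom (((D.page r).homologyπ (a, b)).hom y) = D.pageπ r' a b z := by
  refine (D.page r).exists_homologyIso (a, b) (N := (D.page r').X (a, b)) (D.pageπ' r r' h a b)
    (D.pageπ r' a b) ?_
    (fun x hx => D.exists_pageπ'_eq r r' h hr a b x hx) (D.pageπ_surjective r' a b) ?_
  · rintro z ⟨a', b'⟩
    by_cases hab : (a : ℤ) + r = a' ∧ (b : ℤ) + (1 - r) = b'
    · rw [page_d D r a b a' b' hab.1 hab.2]
      change D.pageD r a b a' b' hab.1 hab.2 (D.pageπ r a b _) = 0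
      rw [pageD_pageπ, pageπ_eq_zero_iff]
      refine mem_approxBoundaries.2 ⟨D.totD z.1, ?_, 0, zero_mem _, by rw [map_zero, add_zero]; rfl⟩
      exact totD_mem_approxCycles z.2 (by lia) (by lia)
    · rw [(D.page r).shape (a, b) (a', b') hab]
      rfl
  · intro z
    have hz := mem_approxCycles.1 z.2
    refine (D.pageπ_eq_zero_iff r' a b z).trans ?_
    constructor
    · intro hzb
      obtain ⟨w, hw, y, hy, e⟩ := mem_approxBoundaries.1 hzb
      rw [mem_approxCycles] at hw hy
      by_cases ha : 0 ≤ (a : ℤ) - r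
      · obtain ⟨a', ha'⟩ := Int.eq_ofNat_of_zero_le ha
        obtain ⟨b', hb'⟩ := Int.eq_ofNat_of_zero_le (show 0 ≤ (b : ℤ) + r - 1 by lia)
        refine ⟨(a', b'), D.pageπ r a' b' ⟨y, mem_approxCycles.2 ⟨?_, fil_le (by lia) hy.2.1,
          fil_le (by lia) hy.2.2⟩⟩, ?_⟩
        · have : (a' : ℤ) + b' = a + b - 1 := by lia
          rw [this]; exact hy.1
        · rw [page_d D r a' b' a b (by lia) (by lia)]
          change D.pageD r a' b' a b (by lia) (by lia) (D.pageπ r a' b' _) = D.pageπ r a b _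
          rw [pageD_pageπ, pageπ_eq_iff]
          change D.totD y - z.1 ∈ _
          rw [e, sub_add_cancel_right]
          exact neg_mem (mem_approxBoundaries.2 ⟨w, mem_approxCycles.2 ⟨hw.1, hw.2.1,
            fil_le (by lia) hw.2.2⟩, 0, zero_mem _, by rw [map_zero, add_zero]⟩)
      -- If `a < r`, no differential enters from inside the quadrant. The element `y` satisfies the
      -- stronger filtration condition `a - r + 1 ≤ 0` for free, so `z` is already zero in `E_r`.
      · refine ⟨(a, b), 0, ?_⟩
        rw [map_zero]
        refine ((D.pageπ_eq_zero_iff r a b _).2 ?_).symm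
        exact mem_approxBoundaries.2 ⟨w, mem_approxCycles.2 ⟨hw.1, hw.2.1, fil_le (by lia) hw.2.2⟩,
          y, mem_approxCycles.2 ⟨hy.1, mem_fil_of_nonpos y (by lia), fil_le (by lia) hy.2.2⟩, e⟩
    · rintro ⟨⟨a', b'⟩, y, hy⟩
      by_cases hab : (a' : ℤ) + r = a ∧ (b' : ℤ) + (1 - r) = b
      · obtain ⟨y, rfl⟩ := D.pageπ_surjective r a' b' y
        rw [page_d D r a' b' a b hab.1 hab.2] at hy
        change D.pageD r a' b' a b hab.1 hab.2 (D.pageπ r a' b' _) = D.pageπ r a b _ at hy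
        rw [pageD_pageπ, pageπ_eq_iff] at hy
        obtain ⟨w, hw, t, ht, e⟩ := mem_approxBoundaries.1 hy
        change D.totD y.1 - z.1 = _ at e
        have hy' := mem_approxCycles.1 y.2
        rw [mem_approxCycles] at hw ht
        have e' : z.1 = -w + D.totD (y.1 - t) := by
          rw [map_sub, sub_eq_iff_eq_add.1 e]
          abel
        have hy1 : y.1 ∈ D.totDegree (a + b - 1) := by
          have : (a' : ℤ) + b' = a + b - 1 := by lia
          rw [← this]; exact hy'.1
        refine mem_approxBoundaries.2 ⟨-w, mem_approxCycles.2 ⟨neg_mem hw.1, neg_mem hw.2.1, ?_⟩,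
          y.1 - t, mem_approxCycles.2 ⟨sub_mem hy1 ht.1, sub_mem (fil_le (by lia) hy'.2.1)
            (fil_le (by lia) ht.2.1), ?_⟩, e'⟩
        -- The element `-w` differs from `z` by a boundary, so it has the differential of `z`, which
        -- lies in `F^{a+r+1}`.
        · rw [(sub_eq_of_eq_add e').symm, map_sub, totD_totD, sub_zero]
          exact fil_le (by lia) hz.2.2
        · rw [map_sub]
          exact sub_mem (fil_le (by lia) hy'.2.2) (fil_le (by lia) ht.2.2)
      · rw [(D.page r).shape (a', b') (a, b) hab] at hy
        have hy' := hy.symm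
        change D.pageπ r a b _ = 0 at hy'
        rw [pageπ_eq_zero_iff] at hy'
        obtain ⟨w, hw, t, ht, e⟩ := mem_approxBoundaries.1 hy'
        change z.1 = _ at e
        rw [mem_approxCycles] at hw ht
        refine mem_approxBoundaries.2 ⟨w, mem_approxCycles.2 ⟨hw.1, hw.2.1, ?_⟩,
          t, mem_approxCycles.2 ⟨ht.1, fil_le (by lia) ht.2.1, fil_le (by lia) ht.2.2⟩, e⟩
        rw [(sub_eq_of_eq_add e).symm, map_sub, totD_totD, sub_zero]
        exact fil_le (by lia) hz.2.2

/-- The spectral sequence of a double complex, filtered by the first index. -/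
noncomputable def spectralSequence : E₂CohomologicalSpectralSequenceNat (ModuleCat.{w} R) where
  page r _ := D.page r
  iso r r' pq h hr := (D.exists_pageIso r r' h hr pq.1 pq.2).choose

lemma spectralSequence_iso_apply (r r' : ℤ) (h : r + 1 = r') (hr : 2 ≤ r) (a b : ℕ)
    (y : (D.page r).cycles (a, b)) (z : D.approxCycles r' a (a + b))
    (hy : ((D.page r).iCycles (a, b)).hom y = D.pageπ' r r' h a b z) :
    (D.spectralSequence.iso r r' (a, b) h hr).hom.hom (((D.page r).homologyπ (a, b)).hom y) =
      D.pageπ r' a b z :=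
  (D.exists_pageIso r r' h hr a b).choose_spec y z hy

/-- The spectral sequence of a double complex is the spectral sequence of its filtered total
complex. -/
noncomputable def spectralSequenceData : D.SpectralSequenceData D.spectralSequence where
  π r _ a b := D.pageπ r a b
  π_surjective r _ a b := D.pageπ_surjective r a b
  π_eq_zero_iff r _ a b x := (D.pageπ_eq_zero_iff r a b x).trans mem_approxBoundaries
  d_π r hr a b a' b' ha hb x x' hx := by
    have : x' = ⟨D.totD x.1, totD_mem_approxCycles x.2 ha.ge (by lia)⟩ := Subtype.ext hx
    rw [this]
    exact congrArg (fun f => f.hom (D.pageπ r a b x)) (D.page_d r a b a' b' ha hb)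
  iso_π r hr a b x x' hx z hz :=
    D.spectralSequence_iso_apply r (r + 1) rfl hr a b z x' (hz.trans (congrArg (D.pageπ r a b)
      (Subtype.ext hx.symm)))

variable {D}

section functoriality

variable {D' : DoubleComplex.{v, w} R} (f : D ⟶ D')

/-- The map induced on `E_r^{a,b}` by a morphism of double complexes. -/
def pageXMap (r : ℤ) (a b : ℕ) : D.PageX r a b →ₗ[R] D'.PageX r a b :=
  Submodule.mapQ _ _ ((totMap f).restrict fun _ hx => totMap_mem_approxCycles f hx)
    fun _ hx => totMap_mem_approxBoundaries f hx

lemma pageXMap_pageπ (r : ℤ) (a b : ℕ) (x : D.approxCycles r a (a + b)) :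
    pageXMap f r a b (D.pageπ r a b x) =
      D'.pageπ r a b ⟨totMap f x.1, totMap_mem_approxCycles f x.2⟩ := rfl

/-- The map induced on the page `E_r` by a morphism of double complexes. -/
noncomputable def pageMap (r : ℤ) : D.page r ⟶ D'.page r where
  f p := ModuleCat.ofHom (pageXMap f r p.1 p.2)
  comm' := by
    rintro ⟨a, b⟩ ⟨a', b'⟩ h
    rw [page_d D r a b a' b' h.1 h.2, page_d D' r a b a' b' h.1 h.2]
    ext x
    obtain ⟨x, rfl⟩ := D.pageπ_surjective _ _ _ x
    exact congrArg (D'.pageπ r a' b') (Subtype.ext (totMap_totD f x.1).symm)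

/-- The morphism of spectral sequences induced by a morphism of double complexes. -/
noncomputable def spectralSequenceMap : D.spectralSequence ⟶ D'.spectralSequence where
  hom r _ := pageMap f r
  comm r r' := by
    rintro ⟨a, b⟩ h hr
    ext x
    obtain ⟨y, rfl⟩ := (D.page r).homologyπ_surjective (a, b) x
    -- A representative in `Z_{r+1}` computes both isomorphisms, and `totMap f` carries it to a
    -- representative for the other double complex.
    obtain ⟨z, hz⟩ : ∃ z, D.pageπ' r r' h a b z = ((D.page r).iCycles (a, b)).hom y :=
      D.exists_pageπ'_eq r r' h hr a b _ ((D.page r).d_iCycles_apply (a, b) y)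
    have h1 := D.spectralSequence_iso_apply r r' h hr a b y z hz.symm
    have h2 : ((D'.page r).iCycles (a, b)).hom
        ((HomologicalComplex.cyclesMap (pageMap f r) (a, b)).hom y) =
        D'.pageπ' r r' h a b ⟨totMap f z.1, totMap_mem_approxCycles f z.2⟩ := by
      refine (congrArg (fun g => g.hom y)
        (HomologicalComplex.cyclesMap_i (pageMap f r) (a, b))).trans ?_
      exact congrArg (pageXMap f r a b) hz.symm
    have h3 := D'.spectralSequence_iso_apply r r' h hr a b _ _ h2
    have h4 : (HomologicalComplex.homologyMap (pageMap f r) (a, b)).hom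
        (((D.page r).homologyπ (a, b)).hom y) = ((D'.page r).homologyπ (a, b)).hom
          ((HomologicalComplex.cyclesMap (pageMap f r) (a, b)).hom y) :=
      congrArg (fun g => g.hom y) (HomologicalComplex.homologyπ_naturality (pageMap f r) (a, b))
    refine (congrArg (D'.spectralSequence.iso r r' (a, b) h hr).hom.hom h4).trans
      (h3.trans (congrArg (pageXMap f r' a b) h1).symm)

end functoriality

variable (R) in
/-- The spectral sequence of a double complex, as a functor. -/
noncomputable def spectralSequenceFunctor :
    DoubleComplex.{v, w} R ⥤ E₂CohomologicalSpectralSequenceNat (ModuleCat.{w} R) where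
  obj D := D.spectralSequence
  map f := spectralSequenceMap f
  map_id D := by
    ext r hr p x
    obtain ⟨x, rfl⟩ := D.pageπ_surjective _ _ _ x
    rfl
  map_comp {D D' D''} f g := by
    ext r hr p x
    obtain ⟨x, rfl⟩ := D.pageπ_surjective _ _ _ x
    rfl

end DoubleComplex

/-! ### Elements of double complexes -/

namespace DoubleComplex

variable {R : Type v} [Ring R] {D : DoubleComplex.{v, w} R}

lemma single_same (a b : ℕ) (x : (D.X a).X b) : D.single a b x a b = x := by
  unfold single
  rw [Pi.single_eq_same, Pi.single_eq_same]

lemma single_of_ne {a b a' b' : ℕ} (x : (D.X a).X b) (h : ¬(a' = a ∧ b' = b)) :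
    D.single a b x a' b' = 0 := by
  unfold single
  by_cases ha : a' = a
  · subst ha
    rw [Pi.single_eq_same, Pi.single_eq_of_ne (fun hb => h ⟨rfl, hb⟩)]
  · rw [Pi.single_eq_of_ne ha]
    rfl

lemma single_add (a b : ℕ) (x y : (D.X a).X b) :
    D.single a b (x + y) = D.single a b x + D.single a b y := by
  unfold single
  rw [Pi.single_add, Pi.single_add]

lemma single_smul (a b : ℕ) (c : R) (x : (D.X a).X b) :
    D.single a b (c • x) = c • D.single a b x := by
  unfold single
  rw [Pi.single_smul, Pi.single_smul]

lemma single_zero (a b : ℕ) : D.single a b 0 = 0 := by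
  unfold single
  rw [Pi.single_zero, Pi.single_zero]

lemma single_mem_totDegree {a b : ℕ} (x : (D.X a).X b) {n : ℤ} (h : (a : ℤ) + b = n) :
    D.single a b x ∈ D.totDegree n :=
  fun a' b' hab => single_of_ne x (by rintro ⟨rfl, rfl⟩; exact hab h)

lemma single_mem_fil {a b : ℕ} (x : (D.X a).X b) {s : ℤ} (h : s ≤ a) :
    D.single a b x ∈ D.fil s :=
  fun a' b' hab => single_of_ne x (by rintro ⟨rfl, rfl⟩; lia)

lemma totD_single (a b : ℕ) (x : (D.X a).X b) :
    D.totD (D.single a b x) = D.single (a + 1) b (((D.d a (a + 1)).f b).hom x) +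
      D.single a (b + 1) ((-1 : ℤ) ^ a • ((D.X a).d b (b + 1)).hom x) := by
  funext a' b'
  rw [totD_apply]
  refine congrArg₂ (· + ·) ?_ ?_
  · cases a' with
    | zero => rw [single_of_ne (a := a + 1) _ (by simp)]; exact D.d_zero_apply b' _
    | succ k =>
      rw [Nat.add_sub_cancel]
      by_cases h : k = a ∧ b' = b
      · obtain ⟨rfl, rfl⟩ := h
        rw [single_same, single_same]
      · rw [single_of_ne x h, single_of_ne _ (by simpa using h), map_zero]
  · cases b' with
    | zero =>
      rw [single_of_ne (b := b + 1) _ (by simp)]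
      exact (congrArg _ (D.d_zero_apply' a' _)).trans (smul_zero _)
    | succ k =>
      rw [Nat.add_sub_cancel]
      by_cases h : a' = a ∧ k = b
      · obtain ⟨rfl, rfl⟩ := h
        rw [single_same, single_same]
      · rw [single_of_ne x h, single_of_ne (b := b + 1) _ (by simpa using h), map_zero, smul_zero]

/-- In total degree `a + b` the only bidegree with first index `a` is `(a, b)`, so an element of
`F^a` is determined modulo `F^{a+1}` by that component. -/
lemma sub_single_mem_fil_iff {a b : ℕ} {x : D.Tot} (hx : x ∈ D.totDegree (a + b))
    (hx' : x ∈ D.fil a) (y : (D.X a).X b) :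
    x - D.single a b y ∈ D.fil (a + 1) ↔ x a b = y := by
  constructor
  · intro h
    have := h a b (by lia)
    change x a b - D.single a b y a b = 0 at this
    rwa [single_same, sub_eq_zero] at this
  · rintro rfl a' b' hab
    change x a' b' - D.single a b _ a' b' = 0
    by_cases h : a' = a ∧ b' = b
    · obtain ⟨rfl, rfl⟩ := h
      rw [single_same, sub_self]
    · rw [single_of_ne _ h, sub_zero]
      by_cases ha : a' = a
      · exact hx a' b' (by lia)
      · exact hx' a' b' (by lia)

lemma mem_fil_succ {a b : ℕ} {x : D.Tot} (hx : x ∈ D.totDegree (a + b)) (hx' : x ∈ D.fil a)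
    (h : x a b = 0) : x ∈ D.fil (a + 1) := by
  have := (sub_single_mem_fil_iff hx hx' 0).2 h
  rwa [single_zero, sub_zero] at this

/-- The leading component of an element of `Z_1` is a vertical cocycle. -/
lemma d_apply_eq_zero {a b : ℕ} {x : D.Tot} (hx : x ∈ D.fil a) (h : D.totD x ∈ D.fil (a + 1)) :
    ((D.X a).d b (b + 1)).hom (x a b) = 0 := by
  have h1 := h a (b + 1) (by lia)
  rw [totD_apply, Nat.add_sub_cancel] at h1
  have h2 : ((D.d (a - 1) a).f (b + 1)).hom (x (a - 1) (b + 1)) = 0 := by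
    cases a with
    | zero => exact D.d_zero_apply _ _
    | succ a => rw [hx (a + 1 - 1) (b + 1) (by lia), map_zero]
  rw [h2, zero_add] at h1
  rcases Nat.even_or_odd a with h3 | h3
  · rwa [h3.neg_one_pow, one_smul] at h1
  · rwa [h3.neg_one_pow, neg_smul, one_smul, neg_eq_zero] at h1

lemma neg_one_pow_smul_smul {M : Type*} [AddCommGroup M] (a : ℕ) (x : M) :
    (-1 : ℤ) ^ a • (-1 : ℤ) ^ a • x = x := by
  rw [smul_smul, ← mul_pow]
  simp

/-- This lemma and `exists_totD_apply_eq_right` realize a prescribed component in bidegree `(a, b)`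
by a boundary, through the horizontal differential from column `a - 1` or the vertical one inside
column `a`. Truncated subtraction is harmless, since the differentials `d 0 0` are zero. -/
lemma exists_totD_apply_eq_left (a b : ℕ) (p : (D.X (a - 1)).X b)
    (hp : ((D.X (a - 1)).d b (b + 1)).hom p = 0) :
    ∃ y ∈ D.approxCycles 1 (a - 1) (a + b - 1), D.totD y ∈ D.fil a ∧
      D.totD y a b = ((D.d (a - 1) a).f b).hom p := by
  cases a with
  | zero => exact ⟨0, zero_mem _, by rw [map_zero]; exact zero_mem _, by
      rw [map_zero]; exact (D.d_zero_apply _ _).symm⟩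
  | succ a =>
    have h : D.totD (D.single a b p) = D.single (a + 1) b (((D.d a (a + 1)).f b).hom p) := by
      rw [totD_single]
      have hp' : ((D.X a).d b (b + 1)).hom p = 0 := hp
      rw [hp', smul_zero, single_zero, add_zero]
    have h' : D.totD (D.single a b p) ∈ D.fil (a + 1 : ℕ) := by
      rw [h]; exact single_mem_fil _ le_rfl
    refine ⟨D.single a b p, mem_approxCycles.2 ⟨single_mem_totDegree _ (by lia),
      single_mem_fil _ (by lia), fil_le (by lia) h'⟩, h', ?_⟩
    rw [h, single_same]
    rfl

lemma exists_totD_apply_eq_right (a b : ℕ) (u : (D.X a).X (b - 1)) :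
    ∃ y ∈ D.totDegree (a + b - 1), y ∈ D.fil a ∧
      D.totD y a b = ((D.X a).d (b - 1) b).hom u := by
  cases b with
  | zero => exact ⟨0, zero_mem _, zero_mem _, by
      rw [map_zero]; exact (D.d_zero_apply' _ _).symm⟩
  | succ b =>
    -- The sign compensates the factor `(-1)^a` in front of the vertical differential.
    refine ⟨D.single a b ((-1 : ℤ) ^ a • (show (D.X a).X b from u)),
      single_mem_totDegree _ (by lia), single_mem_fil _ le_rfl, ?_⟩
    rw [totD_single]
    change D.single (a + 1) b _ a (b + 1) + D.single a (b + 1) _ a (b + 1) = _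
    rw [single_same, single_of_ne (a := a + 1) _ (by simp), zero_add, map_zsmul,
      neg_one_pow_smul_smul]
    rfl

/-- The first step of the usual zigzag: the total differential of `p` is concentrated in column `a +
1`, and if it is a vertical boundary there, subtracting an element of column `a + 1` moves the
differential into `F^{a+2}`. -/
lemma exists_mem_approxCycles_two (a b : ℕ) (p : (D.X a).X b)
    (hp : ((D.X a).d b (b + 1)).hom p = 0) (u : (D.X (a + 1)).X (b - 1))
    (hu : ((D.X (a + 1)).d (b - 1) b).hom u = ((D.d a (a + 1)).f b).hom p) :
    ∃ x ∈ D.approxCycles 2 a (a + b), x a b = p := by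
  obtain ⟨y, hy, hy', h⟩ := D.exists_totD_apply_eq_right (a + 1) b u
  have h1 : D.totD (D.single a b p) = D.single (a + 1) b (((D.d a (a + 1)).f b).hom p) := by
    rw [totD_single, hp, smul_zero, single_zero, add_zero]
  have hd : (a : ℤ) + b = (a + 1 : ℕ) + b - 1 := by lia
  refine ⟨D.single a b p - y, mem_approxCycles.2 ⟨sub_mem (single_mem_totDegree _ rfl) ?_,
    sub_mem (single_mem_fil _ le_rfl) (fil_le (by lia) hy'), ?_⟩, ?_⟩
  · rw [hd]; exact hy
  · have : D.totD (D.single a b p - y) ∈ D.fil ((a + 1 : ℕ) + 1 : ℤ) := by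
      refine mem_fil_succ (b := b) ?_ ?_ ?_
      · exact totD_mem_totDegree (sub_mem (single_mem_totDegree _ hd) hy) (by lia)
      · rw [map_sub, h1]
        exact sub_mem (single_mem_fil _ le_rfl) (totD_mem_fil hy')
      · rw [map_sub, h1]
        change D.single (a + 1) b _ (a + 1) b - D.totD y (a + 1) b = 0
        rw [h, single_same, hu, sub_self]
    exact fil_le (by lia) this
  · change D.single a b p a b - y a b = p
    rw [single_same, hy' a b (by lia), sub_zero]

/-- If the rows of `D` are exact in positive degrees, a homogeneous element whose total
differential is concentrated in the column `0` is, up to a boundary, concentrated in the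
column `0`. -/
lemma exists_sub_totD_concentrated
    (hD : ∀ a b (x : (D.X (a + 1)).X b), ((D.d (a + 1) (a + 1 + 1)).f b).hom x = 0 →
      ∃ u : (D.X a).X b, ((D.d a (a + 1)).f b).hom u = x)
    (n : ℤ) (t : ℕ) : ∀ y ∈ D.totDegree n, D.totD y ∈ D.totDegree (n + 1) →
      (∀ a b, 0 < a → D.totD y a b = 0) → (∀ a b, t < a → y a b = 0) →
      ∃ y' ∈ D.totDegree (n - 1), ∀ a b, 0 < a → (y - D.totD y') a b = 0 := by
  induction t with
  | zero =>
    intro y _ _ _ h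
    exact ⟨0, zero_mem _, fun a b ha => by rw [map_zero, sub_zero]; exact h a b ha⟩
  | succ t ih =>
    intro y hy hdy hd h
    -- The component of `y` in the last column `t + 1` is a horizontal cocycle, because `dy`
    -- vanishes in column `t + 2`. Row exactness gives `u` in column `t`, and subtracting `du`
    -- clears column `t + 1`. If `n < t + 1`, that column is zero for degree reasons.
    by_cases hb : 0 ≤ n - (t + 1)
    · obtain ⟨b, hb'⟩ := Int.eq_ofNat_of_zero_le hb
      have h1 := hd (t + 1 + 1) b (by lia)
      rw [totD_apply, h (t + 1 + 1) _ (by lia), map_zero, smul_zero, add_zero] at h1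
      obtain ⟨u, hu⟩ := hD t b (y (t + 1) b) h1
      have hs : D.single t b u ∈ D.totDegree (n - 1) := single_mem_totDegree _ (by lia)
      have hy1 : y - D.totD (D.single t b u) ∈ D.totDegree n :=
        sub_mem hy (totD_mem_totDegree hs (by lia))
      have hdd : D.totD (y - D.totD (D.single t b u)) = D.totD y := by
        rw [map_sub, totD_totD, sub_zero]
      obtain ⟨y', hy', h'⟩ := ih (y - D.totD (D.single t b u)) hy1 (by rwa [hdd])
        (by rwa [hdd]) (fun a b' hab => by
          by_cases hdeg : (a : ℤ) + b' = n
          · rw [totD_single]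
            change y a b' - (D.single (t + 1) b _ a b' + D.single t (b + 1) _ a b') = 0
            rw [single_of_ne (a := t) _ (by lia), add_zero]
            by_cases ha : a = t + 1
            · subst ha
              obtain rfl : b' = b := by lia
              rw [single_same, hu, sub_self]
            · rw [single_of_ne _ (by lia), sub_zero, h a b' (by lia)]
          · exact hy1 a b' hdeg)
      refine ⟨D.single t b u + y', add_mem hs hy', fun a b' ha => ?_⟩
      rw [map_add, ← sub_sub]
      exact h' a b' ha
    · exact ih y hy hdy hd (fun a b' hab => by
        by_cases ha : t + 1 < a
        · exact h a b' ha
        · exact hy a b' (by lia))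

end DoubleComplex

/-! ### Additive functors, split complexes and resolutions of injective objects -/

namespace HomologicalComplex

variable {B : Type*} [Category* B] [Abelian B] {R : Type v} [Ring R]
  (Γ : B ⥤ ModuleCat.{w} R) [Γ.Additive] {K : CochainComplex B ℕ} (hK : K.IsSplit) (b : ℕ)

include hK

-- Splittings survive under `Γ`, although `Γ` is not assumed exact. This lemma and the ones that
-- follow say that `Γ` commutes with the cycles and the homology of a split complex.
omit [Γ.Additive] in
lemma IsSplit.map_iCycles_injective : Function.Injective (Γ.map (K.iCycles b)).hom := by
  obtain ⟨s, hs⟩ := hK b (b + 1)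
  have h := congrArg Γ.map (K.iCycles_retractionCycles (CochainComplex.next ℕ b) hs)
  rw [Γ.map_comp, Γ.map_id] at h
  exact Function.LeftInverse.injective (g := (Γ.map (K.retractionCycles _ hs)).hom)
    fun x => congrArg (fun g => g.hom x) h

lemma IsSplit.exists_map_iCycles_eq (x : Γ.obj (K.X b))
    (hx : (Γ.map (K.d b (b + 1))).hom x = 0) :
    ∃ y, (Γ.map (K.iCycles b)).hom y = x := by
  obtain ⟨s, hs⟩ := hK b (b + 1)
  have h := congrArg Γ.map (K.retractionCycles_iCycles (CochainComplex.next ℕ b) hs)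
  rw [Γ.map_comp, Γ.map_sub, Γ.map_comp, Γ.map_id] at h
  refine ⟨(Γ.map (K.retractionCycles (CochainComplex.next ℕ b) hs)).hom x,
    (congrArg (fun g => g.hom x) h).trans ?_⟩
  change x - (Γ.map s).hom ((Γ.map (K.d b (b + 1))).hom x) = x
  rw [hx, map_zero, sub_zero]

omit [Γ.Additive] in
lemma IsSplit.map_homologyπ_surjective : Function.Surjective (Γ.map (K.homologyπ b)).hom := by
  obtain ⟨s, hs⟩ := hK b (b + 1)
  obtain ⟨t, ht⟩ := hK ((ComplexShape.up ℕ).prev b) b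
  have h := congrArg Γ.map (K.sectionHomology_homologyπ rfl ht (CochainComplex.next ℕ b) hs)
  rw [← Category.assoc, Γ.map_comp, Γ.map_id] at h
  exact fun x => ⟨_, congrArg (fun g => g.hom x) h⟩

/-- On cycles, the projection to homology followed by its section subtracts `d(ty)` from `y`. If the
projection kills `y`, then `y = d(ty)`. -/
lemma IsSplit.exists_of_map_homologyπ_eq_zero (y : Γ.obj (K.cycles b))
    (hy : (Γ.map (K.homologyπ b)).hom y = 0) :
    ∃ u, (Γ.map (K.d (b - 1) b)).hom u = (Γ.map (K.iCycles b)).hom y := by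
  -- At `b = 0` both sides are the default value `0`, and the differential is zero.
  have hb : (ComplexShape.up ℕ).prev b = b - 1 := by cases b <;> simp
  obtain ⟨t, ht⟩ := hK (b - 1) b
  have h := congrArg Γ.map (K.homologyπ_sectionHomology hb ht)
  rw [Γ.map_comp, Γ.map_comp, Γ.map_sub, Γ.map_comp, Γ.map_id] at h
  have h1 := congrArg (fun g => g.hom y) h
  change (Γ.map (K.sectionHomology hb ht)).hom ((Γ.map (K.homologyπ b)).hom y) =
    (Γ.map (K.iCycles b)).hom y -
      (Γ.map (K.d (b - 1) b)).hom ((Γ.map t).hom ((Γ.map (K.iCycles b)).hom y)) at h1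
  rw [hy, map_zero] at h1
  exact ⟨_, (sub_eq_zero.1 h1.symm).symm⟩

lemma IsSplit.map_homologyπ_eq_zero (y : Γ.obj (K.cycles b)) {b' : ℕ} (u : Γ.obj (K.X b'))
    (hu : (Γ.map (K.d b' b)).hom u = (Γ.map (K.iCycles b)).hom y) :
    (Γ.map (K.homologyπ b)).hom y = 0 := by
  have h : (Γ.map (K.toCycles b' b)).hom u = y := hK.map_iCycles_injective Γ b (by
    rw [← hu, ← K.toCycles_i b' b, Γ.map_comp]
    rfl)
  rw [← h]
  have h1 := congrArg Γ.map (K.toCycles_comp_homologyπ b' b)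
  rw [Γ.map_comp, Γ.map_zero] at h1
  exact congrArg (fun g => g.hom u) h1

end HomologicalComplex

namespace IsInjectiveResolution

variable {B : Type*} [Category* B] [Abelian B] {Z : B} {C : CochainComplex B ℕ}
  {i : Z ⟶ C.X 0} {w₀ : i ≫ C.d 0 1 = 0} (h : IsInjectiveResolution C i w₀) [Injective Z]

include h

omit [Injective Z] in
lemma exact₀ : (ShortComplex.mk i (C.d 0 1) w₀).Exact ∧ Mono i := by
  have e : h.toInjectiveResolution.ι.f 0 = i :=
    CochainComplex.fromSingle₀Equiv_symm_apply_f_zero i w₀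
  have aux : ∀ (j : Z ⟶ C.X 0) (hj : j ≫ C.d 0 1 = 0), j = i →
      (ShortComplex.mk j (C.d 0 1) hj).Exact ∧ Mono j →
      (ShortComplex.mk i (C.d 0 1) w₀).Exact ∧ Mono i := by
    rintro _ _ rfl H
    exact H
  exact aux _ h.toInjectiveResolution.ι_f_zero_comp_complex_d e
    ⟨h.toInjectiveResolution.exact₀, (inferInstance : Mono (h.toInjectiveResolution.ι.f 0))⟩

/-- An injective resolution of an injective object is contractible. Injectivity of `Z` splits `i`;
then `1 - r ≫ i` kills `i`, so by exactness and injectivity of `C⁰` it factors through `d`. This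
starts the induction in `exists_splitting`, and it makes the augmented complex stay exact under any
additive functor. -/
lemma exists_retraction : ∃ (r : C.X 0 ⟶ Z) (s : C.X 1 ⟶ C.X 0),
    i ≫ r = 𝟙 Z ∧ C.d 0 1 ≫ s = 𝟙 _ - r ≫ i := by
  obtain ⟨h1, h2⟩ := h.exact₀
  have hi : i ≫ Injective.factorThru (𝟙 Z) i = 𝟙 Z := Injective.comp_factorThru _ _
  have := h.injective 0
  exact ⟨Injective.factorThru (𝟙 Z) i, h1.descToInjective (𝟙 _ - Injective.factorThru (𝟙 Z) i ≫ i)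
    (by rw [Preadditive.comp_sub, reassoc_of% hi, Category.comp_id, sub_self]), hi,
    h1.comp_descToInjective _ _⟩

-- The equation `d s d = d` says that `1 - s ≫ d` kills the incoming differential, so it factors
-- through the outgoing one.
omit [Injective Z] in
lemma exists_contraction_succ (n : ℕ) (s : C.X (n + 1) ⟶ C.X n)
    (hs : C.d n (n + 1) ≫ s ≫ C.d n (n + 1) = C.d n (n + 1)) :
    ∃ s' : C.X (n + 1 + 1) ⟶ C.X (n + 1), C.d (n + 1) (n + 1 + 1) ≫ s' =
      𝟙 _ - s ≫ C.d n (n + 1) := by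
  have := h.injective (n + 1)
  have h1 : (ShortComplex.mk (C.d n (n + 1)) (C.d (n + 1) (n + 1 + 1))
    (C.d_comp_d _ _ _)).Exact := h.toInjectiveResolution.exact_succ n
  exact ⟨h1.descToInjective (𝟙 _ - s ≫ C.d n (n + 1))
    ((Preadditive.comp_sub _ _ _).trans (sub_eq_zero.2 ((Category.comp_id _).trans hs.symm))),
    h1.comp_descToInjective _ _⟩

lemma exists_splitting (n : ℕ) :
    ∃ s : C.X (n + 1) ⟶ C.X n, C.d n (n + 1) ≫ s ≫ C.d n (n + 1) = C.d n (n + 1) := by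
  induction n with
  | zero =>
    obtain ⟨r, s, -, hs⟩ := h.exists_retraction
    refine ⟨s, ?_⟩
    have := hs =≫ C.d 0 1
    rw [Category.assoc, Preadditive.sub_comp, Category.assoc, w₀] at this
    simpa using this
  | succ n ih =>
    obtain ⟨s, hs⟩ := ih
    obtain ⟨s', hs'⟩ := h.exists_contraction_succ n s hs
    refine ⟨s', ?_⟩
    have := hs' =≫ C.d (n + 1) (n + 1 + 1)
    rw [Category.assoc, Preadditive.sub_comp, Category.assoc, C.d_comp_d] at this
    simpa using this

variable {R : Type v} [Ring R] (Γ : B ⥤ ModuleCat.{w} R) [Γ.Additive]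

omit [Γ.Additive] in
lemma map_injective : Function.Injective (Γ.map i).hom := by
  obtain ⟨r, s, hr, -⟩ := h.exists_retraction
  have h1 := congrArg Γ.map hr
  rw [Γ.map_comp, Γ.map_id] at h1
  exact Function.LeftInverse.injective (g := (Γ.map r).hom) fun x => congrArg (fun g => g.hom x) h1

lemma map_exact₀ (x : Γ.obj (C.X 0)) (hx : (Γ.map (C.d 0 1)).hom x = 0) :
    ∃ c, (Γ.map i).hom c = x := by
  obtain ⟨r, s, -, hs⟩ := h.exists_retraction
  have h1 := congrArg Γ.map hs
  rw [Γ.map_comp, Γ.map_sub, Γ.map_comp, Γ.map_id] at h1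
  have h2 := congrArg (fun g => g.hom x) h1
  change (Γ.map s).hom ((Γ.map (C.d 0 1)).hom x) = x - (Γ.map i).hom ((Γ.map r).hom x) at h2
  rw [hx, map_zero] at h2
  exact ⟨_, (sub_eq_zero.1 h2.symm).symm⟩

lemma map_exact_succ (n : ℕ) (x : Γ.obj (C.X (n + 1)))
    (hx : (Γ.map (C.d (n + 1) (n + 1 + 1))).hom x = 0) :
    ∃ u, (Γ.map (C.d n (n + 1))).hom u = x := by
  obtain ⟨s, hs⟩ := h.exists_splitting n
  obtain ⟨s', hs'⟩ := h.exists_contraction_succ n s hs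
  have h1 := congrArg Γ.map hs'
  rw [Γ.map_comp, Γ.map_sub, Γ.map_comp, Γ.map_id] at h1
  have h2 := congrArg (fun g => g.hom x) h1
  change (Γ.map s').hom ((Γ.map (C.d (n + 1) (n + 1 + 1))).hom x) =
    x - (Γ.map (C.d n (n + 1))).hom ((Γ.map s).hom x) at h2
  rw [hx, map_zero] at h2
  exact ⟨_, (sub_eq_zero.1 h2.symm).symm⟩

end IsInjectiveResolution

/-- An additive relation between modules, induced by an isomorphism. -/
lemma exists_linearEquiv_of_relation {R : Type*} [Ring R] {Z E N : Type*} [AddCommGroup Z]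
    [Module R Z] [AddCommGroup E] [Module R E] [AddCommGroup N] [Module R N] (p : Z →ₗ[R] E)
    (hp : Function.Surjective p) (ρ : Submodule R (Z × N)) (h₁ : ∀ z, ∃ n, (z, n) ∈ ρ)
    (h₂ : ∀ n, ∃ z, (z, n) ∈ ρ) (h₃ : ∀ z n, (z, n) ∈ ρ → (p z = 0 ↔ n = 0)) :
    ∃ e : E ≃ₗ[R] N, ∀ z n, (z, n) ∈ ρ → e (p z) = n := by
  choose f hf using h₁
  have uniq : ∀ z n n', (z, n) ∈ ρ → (z, n') ∈ ρ → n = n' := fun z n n' h h' => by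
    have := ρ.sub_mem h h'
    rw [Prod.mk_sub_mk, sub_self] at this
    exact sub_eq_zero.1 ((h₃ _ _ this).1 (map_zero p))
  let F : Z →ₗ[R] N :=
    { toFun := f
      map_add' z z' := uniq (z + z') _ _ (hf _) (ρ.add_mem (hf z) (hf z'))
      map_smul' c z := uniq (c • z) _ _ (hf _) (ρ.smul_mem c (hf z)) }
  have hF : Function.Surjective F := fun n => by
    obtain ⟨z, hz⟩ := h₂ n
    exact ⟨z, uniq z _ _ (hf z) hz⟩
  have hk : LinearMap.ker p = LinearMap.ker F := by
    ext z
    exact h₃ z _ (hf z)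
  refine ⟨(p.quotKerEquivOfSurjective hp).symm ≪≫ₗ
    Submodule.quotEquivOfEq _ _ hk ≪≫ₗ F.quotKerEquivOfSurjective hF, fun z n hz => ?_⟩
  have h1 : (p.quotKerEquivOfSurjective hp).symm (p z) = Submodule.Quotient.mk z := by
    rw [LinearEquiv.symm_apply_eq]; rfl
  rw [LinearEquiv.trans_apply, LinearEquiv.trans_apply, h1]
  exact uniq z _ _ (hf z) hz

/-! ### The second page and the abutment -/

namespace CompositeResolution

variable {A : Type*} [Category* A] [Abelian A] [HasInjectiveResolutions A]
  {B : Type*} [Category* B] [Abelian B] [HasInjectiveResolutions B]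
  {R : Type v} [Ring R] {F : A ⥤ B} [F.Additive] (Γ : B ⥤ ModuleCat.{w} R) [Γ.Additive]
  {M : A} (J : CompositeResolution F M)

section secondPage

/-- The complex `Γ(H^b(J))`. -/
noncomputable abbrev homologyComplex (b : ℕ) : CochainComplex (ModuleCat.{w} R) ℕ :=
  (Γ.mapHomologicalComplex (ComplexShape.up ℕ)).obj
    (J.ce.homology b).toInjectiveResolution.cocomplex

/-- The isomorphism `RᵃΓ(RᵇF(M)) ≅ Hᵃ(Γ(H^b(J)))`. -/
noncomputable def rightDerivedIso (a b : ℕ) :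
    (Γ.rightDerived a).obj ((F.rightDerived b).obj M) ≅ (J.homologyComplex Γ b).homology a :=
  (Γ.rightDerived a).mapIso (J.res.isoRightDerivedObj F b) ≪≫
    (J.ce.homology b).toInjectiveResolution.isoRightDerivedObj Γ a

/-- The map `Γ(Z^b(J^{a,•})) → Γ(J^{a,b})`. -/
noncomputable def inclZ (a b : ℕ) :
    Γ.obj ((J.ce.cocomplex.X a).cycles b) →ₗ[R] ((J.doubleComplex Γ).X a).X b :=
  (Γ.map ((J.ce.cocomplex.X a).iCycles b)).hom

/-- The map `Γ(Z^b(J^{a,•})) → Γ(H^b(J^{a,•}))`. -/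
noncomputable def projH (a b : ℕ) :
    Γ.obj ((J.ce.cocomplex.X a).cycles b) →ₗ[R] (J.homologyComplex Γ b).X a :=
  (Γ.map ((J.ce.cocomplex.X a).homologyπ b)).hom

/-- The differential `Γ(Z^b(J^{a,•})) → Γ(Z^b(J^{a',•}))`. -/
noncomputable def dZ (a a' b : ℕ) :
    Γ.obj ((J.ce.cocomplex.X a).cycles b) →ₗ[R] Γ.obj ((J.ce.cocomplex.X a').cycles b) :=
  (Γ.map (HomologicalComplex.cyclesMap (J.ce.cocomplex.d a a') b)).hom

lemma representsE₂_iff (a b : ℕ) (x : (J.doubleComplex Γ).Tot)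
    (e : (Γ.rightDerived a).obj ((F.rightDerived b).obj M)) :
    J.RepresentsE₂ a b x e ↔
      ∃ (y : Γ.obj ((J.ce.cocomplex.X a).cycles b)) (ζ : (J.homologyComplex Γ b).cycles a),
        x - (J.doubleComplex Γ).single a b (J.inclZ Γ a b y) ∈
          (J.doubleComplex Γ).fil (a + 1) ∧
        ((J.homologyComplex Γ b).iCycles a).hom ζ =
          J.projH Γ a b y ∧
        (J.rightDerivedIso Γ a b).hom.hom e = ((J.homologyComplex Γ b).homologyπ a).hom ζ :=
  Iff.rfl

variable {Γ J}

/-- Stability under sums and scalars makes representation a linear relation, as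
`exists_linearEquiv_of_relation` requires. -/
lemma RepresentsE₂.add {a b : ℕ} {x x' : (J.doubleComplex Γ).Tot}
    {e e' : (Γ.rightDerived a).obj ((F.rightDerived b).obj M)}
    (h : J.RepresentsE₂ a b x e) (h' : J.RepresentsE₂ a b x' e') :
    J.RepresentsE₂ a b (x + x') (e + e') := by
  rw [representsE₂_iff] at h h' ⊢
  obtain ⟨y, ζ, h1, h2, h3⟩ := h
  obtain ⟨y', ζ', h1', h2', h3'⟩ := h'
  refine ⟨y + y', ζ + ζ', ?_, by rw [map_add, map_add, h2, h2'], by rw [map_add, map_add, h3, h3']⟩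
  rw [map_add, DoubleComplex.single_add, add_sub_add_comm]
  exact add_mem h1 h1'

lemma RepresentsE₂.smul {a b : ℕ} (c : R) {x : (J.doubleComplex Γ).Tot}
    {e : (Γ.rightDerived a).obj ((F.rightDerived b).obj M)}
    (h : J.RepresentsE₂ a b x e) : J.RepresentsE₂ a b (c • x) (c • e) := by
  rw [representsE₂_iff] at h ⊢
  obtain ⟨y, ζ, h1, h2, h3⟩ := h
  refine ⟨c • y, c • ζ, ?_, by rw [map_smul, map_smul, h2], by rw [map_smul, map_smul, h3]⟩
  rw [map_smul, DoubleComplex.single_smul, ← smul_sub]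
  exact Submodule.smul_mem _ _ h1

variable (J)

variable (Γ)

omit [HasInjectiveResolutions A] [HasInjectiveResolutions B] in
lemma inclZ_dZ (a a' b : ℕ) (y : Γ.obj ((J.ce.cocomplex.X a).cycles b)) :
    J.inclZ Γ a' b (J.dZ Γ a a' b y) =
      (((J.doubleComplex Γ).d a a').f b).hom (J.inclZ Γ a b y) := by
  have h := congrArg Γ.map (HomologicalComplex.cyclesMap_i (J.ce.cocomplex.d a a') b)
  rw [Γ.map_comp, Γ.map_comp] at h
  exact congrArg (fun f => f.hom y) h

omit [HasInjectiveResolutions A] [HasInjectiveResolutions B] in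
lemma projH_dZ (a a' b : ℕ) (y : Γ.obj ((J.ce.cocomplex.X a).cycles b)) :
    J.projH Γ a' b (J.dZ Γ a a' b y) = ((J.homologyComplex Γ b).d a a').hom (J.projH Γ a b y) := by
  have h := congrArg Γ.map (HomologicalComplex.homologyπ_naturality (J.ce.cocomplex.d a a') b)
  rw [Γ.map_comp, Γ.map_comp] at h
  exact congrArg (fun f => f.hom y) h.symm

omit [HasInjectiveResolutions A] [HasInjectiveResolutions B] in
lemma d_inclZ (a b : ℕ) (y : Γ.obj ((J.ce.cocomplex.X a).cycles b)) :
    (((J.doubleComplex Γ).X a).d b (b + 1)).hom (J.inclZ Γ a b y) = 0 := by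
  have h := congrArg Γ.map ((J.ce.cocomplex.X a).iCycles_d b (b + 1))
  rw [Γ.map_comp, Γ.map_zero] at h
  exact congrArg (fun f => f.hom y) h

variable (hJ : ∀ a, (J.ce.cocomplex.X a).IsSplit)
include hJ

omit [HasInjectiveResolutions A] [HasInjectiveResolutions B] in
lemma exists_inclZ_eq (a b : ℕ) (x : ((J.doubleComplex Γ).X a).X b)
    (hx : (((J.doubleComplex Γ).X a).d b (b + 1)).hom x = 0) : ∃ y, J.inclZ Γ a b y = x :=
  (hJ a).exists_map_iCycles_eq Γ b x hx

omit [HasInjectiveResolutions A] [HasInjectiveResolutions B] [Γ.Additive] in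
lemma projH_surjective [Γ.Additive] (a b : ℕ) : Function.Surjective (J.projH Γ a b) :=
  (hJ a).map_homologyπ_surjective Γ b

omit [HasInjectiveResolutions A] [HasInjectiveResolutions B] in
lemma projH_eq_zero_iff (a b : ℕ) (y : Γ.obj ((J.ce.cocomplex.X a).cycles b)) :
    J.projH Γ a b y = 0 ↔
      ∃ u, (((J.doubleComplex Γ).X a).d (b - 1) b).hom u = J.inclZ Γ a b y :=
  ⟨fun h => (hJ a).exists_of_map_homologyπ_eq_zero Γ b y h,
    fun ⟨u, hu⟩ => (hJ a).map_homologyπ_eq_zero Γ b y (b' := b - 1) u hu⟩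

/-- Since `dx ∈ F^{a+2}`, the component of `x` at `(a, b)` is a vertical cocycle, so it comes from
`Γ(Z^b)` by splitness. Vanishing of `dx` at `(a + 1, b)` makes its horizontal differential a
vertical boundary, so its image in `Γ(H^b)` is a cocycle. -/
lemma exists_representsE₂ (a b : ℕ) {x : (J.doubleComplex Γ).Tot}
    (hx : x ∈ (J.doubleComplex Γ).approxCycles 2 a (a + b)) : ∃ e, J.RepresentsE₂ a b x e := by
  have hx' := DoubleComplex.mem_approxCycles.1 hx
  obtain ⟨y, hy⟩ := J.exists_inclZ_eq Γ hJ a b (x a b)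
    (DoubleComplex.d_apply_eq_zero hx'.2.1 (DoubleComplex.fil_le (by lia) hx'.2.2))
  obtain ⟨ζ, hζ⟩ := (J.homologyComplex Γ b).exists_iCycles_eq a
    (J.projH Γ a b y) (fun j => by
      by_cases hj : a + 1 = j
      · subst hj
        rw [← projH_dZ]
        have h1 : (J.doubleComplex Γ).totD x (a + 1) b = 0 := hx'.2.2 (a + 1) b (by lia)
        rw [DoubleComplex.totD_apply, add_eq_zero_iff_eq_neg, ← smul_neg, ← map_neg,
          ← map_zsmul] at h1
        refine (J.projH_eq_zero_iff Γ hJ (a + 1) b _).2 ⟨_, h1.symm.trans ?_⟩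
        rw [inclZ_dZ, hy]
        rfl
      · rw [(J.homologyComplex Γ b).shape a j hj]
        rfl)
  refine ⟨(J.rightDerivedIso Γ a b).inv.hom (((J.homologyComplex Γ b).homologyπ a).hom ζ),
    (J.representsE₂_iff Γ a b x _).2 ⟨y, ζ, ?_, hζ, ?_⟩⟩
  · exact (DoubleComplex.sub_single_mem_fil_iff hx'.1 hx'.2.1 _).2 hy.symm
  · exact congrArg (fun f => f.hom (((J.homologyComplex Γ b).homologyπ a).hom ζ))
      (J.rightDerivedIso Γ a b).inv_hom_id

/-- A cocycle of `Γ(H^b(J))` lifts to `Γ(Z^b)`. The horizontal differential of the lift dies in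
`Γ(H^b)`, so it is a vertical boundary, and `exists_mem_approxCycles_two` completes the lift to an
element of `Z_2`. -/
lemma exists_representsE₂' (a b : ℕ) (e : (Γ.rightDerived a).obj ((F.rightDerived b).obj M)) :
    ∃ x ∈ (J.doubleComplex Γ).approxCycles 2 a (a + b), J.RepresentsE₂ a b x e := by
  obtain ⟨ζ, hζ⟩ := (J.homologyComplex Γ b).homologyπ_surjective a
    ((J.rightDerivedIso Γ a b).hom.hom e)
  obtain ⟨y, hy⟩ := J.projH_surjective Γ hJ a b
    (((J.homologyComplex Γ b).iCycles a).hom ζ)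
  have h1 := J.projH_dZ Γ a (a + 1) b y
  have h2 := (J.homologyComplex Γ b).d_iCycles_apply a ζ (a + 1)
  obtain ⟨u, hu⟩ := (J.projH_eq_zero_iff Γ hJ (a + 1) b _).1
    (h1.trans ((congrArg _ hy).trans h2))
  obtain ⟨x, hx, hxy⟩ := (J.doubleComplex Γ).exists_mem_approxCycles_two a b _
    (J.d_inclZ Γ a b y) u (hu.trans (J.inclZ_dZ Γ a (a + 1) b y))
  have hx' := DoubleComplex.mem_approxCycles.1 hx
  exact ⟨x, hx, (J.representsE₂_iff Γ a b x _).2 ⟨y, ζ,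
    (DoubleComplex.sub_single_mem_fil_iff hx'.1 hx'.2.1 _).2 hxy, hy.symm, hζ.symm⟩⟩

/-- Both conditions say that the leading component of `x` is a horizontal differential of a vertical
cocycle plus a vertical boundary. -/
lemma mem_approxBoundaries_iff_of_representsE₂ (a b : ℕ) {x : (J.doubleComplex Γ).Tot}
    (hx : x ∈ (J.doubleComplex Γ).approxCycles 2 a (a + b))
    {e : (Γ.rightDerived a).obj ((F.rightDerived b).obj M)} (h : J.RepresentsE₂ a b x e) :
    x ∈ (J.doubleComplex Γ).approxBoundaries 2 a (a + b) ↔ e = 0 := by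
  have hx' := DoubleComplex.mem_approxCycles.1 hx
  obtain ⟨y, ζ, h1, h2, h3⟩ := (J.representsE₂_iff Γ a b x e).1 h
  have hy := (DoubleComplex.sub_single_mem_fil_iff hx'.1 hx'.2.1 _).1 h1
  -- For `a = 0` the differential from index `a - 1 = 0` is zero, so the right side correctly says
  -- that the image of `y` in `Γ(H^b)` vanishes.
  have he : e = 0 ↔ ∃ y' : Γ.obj ((J.ce.cocomplex.X (a - 1)).cycles b),
      ((J.homologyComplex Γ b).d (a - 1) a).hom
        (J.projH Γ (a - 1) b y') =
      J.projH Γ a b y := by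
    rw [← ((ConcreteCategory.bijective_of_isIso (J.rightDerivedIso Γ a b).hom).1).eq_iff]
    change (J.rightDerivedIso Γ a b).hom.hom e = (J.rightDerivedIso Γ a b).hom.hom 0 ↔ _
    rw [map_zero, h3, HomologicalComplex.homologyπ_eq_zero_iff, h2]
    constructor
    · rintro ⟨j, w, hw⟩
      by_cases hj : j + 1 = a
      · subst hj
        obtain ⟨y', rfl⟩ := J.projH_surjective Γ hJ j b w
        exact ⟨y', hw⟩
      · rw [(J.homologyComplex Γ b).shape j a hj] at hw
        exact ⟨0, by rw [map_zero, map_zero]; exact hw⟩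
    · rintro ⟨y', hy'⟩
      exact ⟨a - 1, _, hy'⟩
  rw [he]
  constructor
  · intro hb
    obtain ⟨w, hw, t, ht, hwt⟩ := DoubleComplex.mem_approxBoundaries.1 hb
    rw [DoubleComplex.mem_approxCycles] at hw ht
    have h4 : x a b = (J.doubleComplex Γ).totD t a b := by
      rw [hwt]
      change w a b + _ = _
      rw [hw.2.1 a b (by lia), zero_add]
    obtain ⟨y', hy'⟩ : ∃ y' : Γ.obj ((J.ce.cocomplex.X (a - 1)).cycles b),
        (((J.doubleComplex Γ).d (a - 1) a).f b).hom
          (J.inclZ Γ (a - 1) b y') =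
        (((J.doubleComplex Γ).d (a - 1) a).f b).hom (t (a - 1) b) := by
      cases a with
      | zero =>
        exact ⟨0, ((J.doubleComplex Γ).d_zero_apply b _).trans
          ((J.doubleComplex Γ).d_zero_apply b _).symm⟩
      | succ a =>
        obtain ⟨y', hy'⟩ := J.exists_inclZ_eq Γ hJ a b (t a b)
          (DoubleComplex.d_apply_eq_zero (DoubleComplex.fil_le (by lia) ht.2.1)
            (DoubleComplex.fil_le (by lia) ht.2.2))
        exact ⟨y', congrArg _ hy'⟩
    refine ⟨y', ?_⟩
    rw [← sub_eq_zero, ← projH_dZ, ← map_sub]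
    rw [DoubleComplex.totD_apply, ← hy', hy, ← inclZ_dZ, ← sub_eq_iff_eq_add',
      ← map_sub, ← map_zsmul] at h4
    rw [← neg_eq_zero, ← map_neg, neg_sub]
    exact (J.projH_eq_zero_iff Γ hJ a b _).2 ⟨_, h4.symm⟩
  · rintro ⟨y', hy'⟩
    rw [← projH_dZ, eq_comm, ← sub_eq_zero, ← map_sub] at hy'
    obtain ⟨u, hu⟩ := (J.projH_eq_zero_iff Γ hJ a b _).1 hy'
    -- The boundary of `t₁` has leading component `d'y'` and that of `t₂` has `d''u`; subtracting
    -- both from `x` clears its leading component.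
    obtain ⟨t₁, ht₁, ht₁', e₁⟩ := (J.doubleComplex Γ).exists_totD_apply_eq_left a b
      (J.inclZ Γ (a - 1) b y') (J.d_inclZ Γ (a - 1) b y')
    obtain ⟨t₂, ht₂, ht₂', e₂⟩ := (J.doubleComplex Γ).exists_totD_apply_eq_right a b u
    have ht₁'' := DoubleComplex.mem_approxCycles.1 ht₁
    have ht : (J.doubleComplex Γ).totD (t₁ + t₂) ∈ (J.doubleComplex Γ).fil a := by
      rw [map_add]
      exact add_mem ht₁' (DoubleComplex.totD_mem_fil ht₂')
    have hdeg : t₁ + t₂ ∈ (J.doubleComplex Γ).totDegree (a + b - 1) := add_mem ht₁''.1 ht₂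
    have hw : x - (J.doubleComplex Γ).totD (t₁ + t₂) ∈ (J.doubleComplex Γ).totDegree (a + b) :=
      sub_mem hx'.1 (DoubleComplex.totD_mem_totDegree hdeg (by lia))
    refine DoubleComplex.mem_approxBoundaries.2 ⟨x - (J.doubleComplex Γ).totD (t₁ + t₂),
      DoubleComplex.mem_approxCycles.2 ⟨hw, DoubleComplex.mem_fil_succ hw (sub_mem hx'.2.1 ht) ?_,
        ?_⟩, t₁ + t₂, DoubleComplex.mem_approxCycles.2 ⟨hdeg, add_mem
          (DoubleComplex.fil_le (by lia) ht₁''.2.1) (DoubleComplex.fil_le (by lia) ht₂'),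
          DoubleComplex.fil_le (by lia) ht⟩, (sub_add_cancel _ _).symm⟩
    · rw [map_add]
      change x a b - ((J.doubleComplex Γ).totD t₁ a b + (J.doubleComplex Γ).totD t₂ a b) = 0
      rw [e₁, e₂, ← inclZ_dZ, hy, ← sub_sub, ← map_sub]
      exact sub_eq_zero.2 hu.symm
    · rw [map_sub, DoubleComplex.totD_totD, sub_zero]
      exact DoubleComplex.fil_le (by lia) hx'.2.2

lemma exists_e₂Equiv (a b : ℕ) :
    ∃ e : (J.doubleComplex Γ).PageX 2 a b ≃ₗ[R] (Γ.rightDerived a).obj ((F.rightDerived b).obj M),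
      ∀ (x : (J.doubleComplex Γ).approxCycles 2 a (a + b)) z, J.RepresentsE₂ a b x.1 z →
        e ((J.doubleComplex Γ).pageπ 2 a b x) = z := by
  let ρ : Submodule R ((J.doubleComplex Γ).approxCycles 2 a (a + b) ×
      (Γ.rightDerived a).obj ((F.rightDerived b).obj M)) :=
    { carrier := {p | J.RepresentsE₂ a b p.1.1 p.2}
      zero_mem' := by
        obtain ⟨z, hz⟩ := J.exists_representsE₂ Γ hJ a b (zero_mem _)
        have := hz.smul 0
        rwa [zero_smul, zero_smul] at this
      add_mem' := fun h h' => RepresentsE₂.add h h'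
      smul_mem' := fun c _ h => RepresentsE₂.smul c h }
  exact exists_linearEquiv_of_relation _ ((J.doubleComplex Γ).pageπ_surjective 2 a b) ρ
    (fun x => J.exists_representsE₂ Γ hJ a b x.2)
    (fun z => by
      obtain ⟨x, hx, h⟩ := J.exists_representsE₂' Γ hJ a b z
      exact ⟨⟨x, hx⟩, h⟩)
    (fun x z h => ((J.doubleComplex Γ).pageπ_eq_zero_iff 2 a b x).trans
      (J.mem_approxBoundaries_iff_of_representsE₂ Γ hJ a b x.2 h))

end secondPage

end CompositeResolution

/-! ### The abutment: cohomology of the total complex -/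

namespace CompositeResolution

variable {A : Type*} [Category* A] [Abelian A] [HasInjectiveResolutions A]
  {B : Type*} [Category* B] [Abelian B]
  {R : Type v} [Ring R] {F : A ⥤ B} [F.Additive] (Γ : B ⥤ ModuleCat.{w} R) [Γ.Additive]
  {L : A ⥤ ModuleCat.{w} R} [L.Additive] {M : A} (J : CompositeResolution F M)

section abutment

variable (L) in
/-- The complex `L(I)`. -/
noncomputable abbrev resComplex : CochainComplex (ModuleCat.{w} R) ℕ :=
  (L.mapHomologicalComplex (ComplexShape.up ℕ)).obj J.res.cocomplex

variable (L) in
/-- The isomorphism `RⁿL(M) ≅ Hⁿ(L(I))`. -/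
noncomputable def resIso (n : ℕ) : (L.rightDerived n).obj M ≅ (J.resComplex L).homology n :=
  J.res.isoRightDerivedObj L n

/-- The differential `Γ(F(Iⁿ)) → Γ(F(Iᵐ))`. -/
noncomputable def dRes (n m : ℕ) :
    Γ.obj (F.obj (J.res.cocomplex.X n)) →ₗ[R] Γ.obj (F.obj (J.res.cocomplex.X m)) :=
  (Γ.map (F.map (J.res.cocomplex.d n m))).hom

variable {Γ} in
/-- The isomorphism `Γ(F(Iⁿ)) → L(Iⁿ)`. -/
noncomputable def toResComplex (θ : F ⋙ Γ ≅ L) (n : ℕ) :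
    Γ.obj (F.obj (J.res.cocomplex.X n)) →ₗ[R] (J.resComplex L).X n :=
  (θ.hom.app (J.res.cocomplex.X n)).hom

omit [HasInjectiveResolutions A] [Γ.Additive] in
lemma toResComplex_bijective (θ : F ⋙ Γ ≅ L) (n : ℕ) :
    Function.Bijective (J.toResComplex θ n) :=
  ConcreteCategory.bijective_of_isIso (θ.hom.app (J.res.cocomplex.X n))

omit [HasInjectiveResolutions A] [Γ.Additive] in
lemma toResComplex_dRes (θ : F ⋙ Γ ≅ L) (n m : ℕ) (c : Γ.obj (F.obj (J.res.cocomplex.X n))) :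
    J.toResComplex θ m (J.dRes Γ n m c) = ((J.resComplex L).d n m).hom (J.toResComplex θ n c) :=
  congrArg (fun g => g.hom c) (θ.hom.naturality (J.res.cocomplex.d n m))

lemma representsAbutment_iff (θ : F ⋙ Γ ≅ L) (n : ℕ) (x : (J.doubleComplex Γ).Tot)
    (h : (L.rightDerived n).obj M) :
    J.RepresentsAbutment θ n x h ↔
      ∃ (z : (J.resComplex L).cycles n) (c : Γ.obj (F.obj (J.res.cocomplex.X n))),
        (J.resIso L n).hom.hom h = ((J.resComplex L).homologyπ n).hom z ∧
        ((J.resComplex L).iCycles n).hom z = J.toResComplex θ n c ∧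
        ∃ y ∈ (J.doubleComplex Γ).totDegree (n - 1),
          x = J.aug Γ n c + (J.doubleComplex Γ).totD y :=
  Iff.rfl

/-- The map `Γ(F(Iⁿ)) → Γ(J^{0,n})`. -/
noncomputable def augX (n : ℕ) :
    Γ.obj (F.obj (J.res.cocomplex.X n)) →ₗ[R] ((J.doubleComplex Γ).X 0).X n :=
  (Γ.map (J.ce.ι.f n)).hom

omit [HasInjectiveResolutions A] in
lemma aug_eq (n : ℕ) (c) : J.aug Γ n c = (J.doubleComplex Γ).single 0 n (J.augX Γ n c) := rfl

omit [HasInjectiveResolutions A] in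
lemma aug_add (n : ℕ) (c c') : J.aug Γ n (c + c') = J.aug Γ n c + J.aug Γ n c' := by
  rw [aug_eq, map_add, DoubleComplex.single_add]
  rfl

omit [HasInjectiveResolutions A] in
lemma aug_smul (n : ℕ) (r : R) (c) : J.aug Γ n (r • c) = r • J.aug Γ n c := by
  rw [aug_eq, map_smul, DoubleComplex.single_smul]
  rfl

omit [HasInjectiveResolutions A] in
lemma aug_zero (n : ℕ) : J.aug Γ n 0 = 0 := by
  rw [aug_eq, map_zero, DoubleComplex.single_zero]

omit [HasInjectiveResolutions A] in
lemma aug_mem_totDegree (n : ℕ) (c) : J.aug Γ n c ∈ (J.doubleComplex Γ).totDegree n :=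
  DoubleComplex.single_mem_totDegree _ (by simp)

omit [HasInjectiveResolutions A] in
lemma d_augX (n : ℕ) (c) :
    (((J.doubleComplex Γ).d 0 1).f n).hom (J.augX Γ n c) = 0 := by
  have h := congrArg (fun f => Γ.map (f.f n)) J.ce.ι_comp_d
  rw [HomologicalComplex.comp_f, Γ.map_comp, HomologicalComplex.zero_f, Γ.map_zero] at h
  exact congrArg (fun f => f.hom c) h

omit [HasInjectiveResolutions A] in
lemma augX_dRes (n m : ℕ) (c) :
    J.augX Γ m (J.dRes Γ n m c) = (((J.doubleComplex Γ).X 0).d n m).hom (J.augX Γ n c) := by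
  have h := congrArg Γ.map (J.ce.ι.comm n m)
  rw [Γ.map_comp, Γ.map_comp] at h
  exact congrArg (fun f => f.hom c) h.symm

-- The augmentation is a morphism of complexes to the total complex: its image has no horizontal
-- differential, and the vertical sign in column `0` is `+1`.
omit [HasInjectiveResolutions A] in
lemma totD_aug (n : ℕ) (c) :
    (J.doubleComplex Γ).totD (J.aug Γ n c) = J.aug Γ (n + 1) (J.dRes Γ n (n + 1) c) := by
  rw [aug_eq, DoubleComplex.totD_single, aug_eq, augX_dRes, pow_zero, one_smul]
  have h : (((J.doubleComplex Γ).d 0 (0 + 1)).f n).hom (J.augX Γ n c) = 0 := J.d_augX Γ n c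
  rw [h, DoubleComplex.single_zero, zero_add]

variable {Γ J} {θ : F ⋙ Γ ≅ L} {n : ℕ}

lemma RepresentsAbutment.add {x x' : (J.doubleComplex Γ).Tot} {h h' : (L.rightDerived n).obj M}
    (H : J.RepresentsAbutment θ n x h) (H' : J.RepresentsAbutment θ n x' h') :
    J.RepresentsAbutment θ n (x + x') (h + h') := by
  rw [representsAbutment_iff] at H H' ⊢
  obtain ⟨z, c, h1, h2, y, hy, rfl⟩ := H
  obtain ⟨z', c', h1', h2', y', hy', rfl⟩ := H'
  refine ⟨z + z', c + c', by rw [map_add, map_add, h1, h1'], by rw [map_add, map_add, h2, h2'],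
    y + y', add_mem hy hy', ?_⟩
  rw [aug_add, map_add, add_add_add_comm]

lemma RepresentsAbutment.smul (r : R) {x : (J.doubleComplex Γ).Tot} {h : (L.rightDerived n).obj M}
    (H : J.RepresentsAbutment θ n x h) : J.RepresentsAbutment θ n (r • x) (r • h) := by
  rw [representsAbutment_iff] at H ⊢
  obtain ⟨z, c, h1, h2, y, hy, rfl⟩ := H
  refine ⟨r • z, r • c, by rw [map_smul, map_smul, h1], by rw [map_smul, map_smul, h2],
    r • y, Submodule.smul_mem _ _ hy, ?_⟩
  rw [aug_smul, map_smul, smul_add]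

lemma RepresentsAbutment.add_totD {x y : (J.doubleComplex Γ).Tot} {h : (L.rightDerived n).obj M}
    (H : J.RepresentsAbutment θ n x h) (hy : y ∈ (J.doubleComplex Γ).totDegree (n - 1)) :
    J.RepresentsAbutment θ n (x + (J.doubleComplex Γ).totD y) h := by
  rw [representsAbutment_iff] at H ⊢
  obtain ⟨z, c, h1, h2, y', hy', rfl⟩ := H
  exact ⟨z, c, h1, h2, y' + y, add_mem hy' hy, by rw [map_add, add_assoc]⟩

lemma RepresentsAbutment.mem_totDegree {x : (J.doubleComplex Γ).Tot}
    {h : (L.rightDerived n).obj M} (H : J.RepresentsAbutment θ n x h) :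
    x ∈ (J.doubleComplex Γ).totDegree n := by
  obtain ⟨z, c, h1, h2, y, hy, rfl⟩ := (J.representsAbutment_iff Γ θ n _ h).1 H
  exact add_mem (J.aug_mem_totDegree Γ n c) (DoubleComplex.totD_mem_totDegree hy (by lia))

lemma RepresentsAbutment.totD_eq_zero {x : (J.doubleComplex Γ).Tot}
    {h : (L.rightDerived n).obj M} (H : J.RepresentsAbutment θ n x h) :
    (J.doubleComplex Γ).totD x = 0 := by
  obtain ⟨z, c, h1, h2, y, hy, rfl⟩ := (J.representsAbutment_iff Γ θ n _ h).1 H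
  have h3 : J.dRes Γ n (n + 1) c = 0 := (J.toResComplex_bijective Γ θ (n + 1)).1 (by
    rw [toResComplex_dRes, map_zero, ← h2, HomologicalComplex.d_iCycles_apply])
  rw [map_add, DoubleComplex.totD_totD, totD_aug, h3, aug_zero, add_zero]

variable (θ J) in
lemma exists_representsAbutment (h : (L.rightDerived n).obj M) :
    ∃ x, J.RepresentsAbutment θ n x h := by
  obtain ⟨z, hz⟩ := (J.resComplex L).homologyπ_surjective n
    ((J.resIso L n).hom.hom h)
  obtain ⟨c, hc⟩ := (J.toResComplex_bijective Γ θ n).2 (((J.resComplex L).iCycles n).hom z)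
  exact ⟨J.aug Γ n c, (J.representsAbutment_iff Γ θ n _ h).2 ⟨z, c, hz.symm, hc.symm, 0,
    zero_mem _, by rw [map_zero, add_zero]⟩⟩

variable (J Γ)

variable (hF : ∀ n, Injective (F.obj (J.res.cocomplex.X n)))
include hF

-- Injectivity of `F(Iⁿ)` enters through this lemma, `exists_augX_eq` and `exists_d_eq`: the rows
-- resolve injective objects, so the augmented rows remain exact after applying `Γ`.
omit [HasInjectiveResolutions A] in
lemma augX_injective (n : ℕ) : Function.Injective (J.augX Γ n) :=
  have : Injective (((F.mapHomologicalComplex (ComplexShape.up ℕ)).obj J.res.cocomplex).X n) :=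
    hF n
  (J.ce.terms n).map_injective (Z := ((F.mapHomologicalComplex (ComplexShape.up ℕ)).obj
    J.res.cocomplex).X n) Γ

omit [HasInjectiveResolutions A] in
lemma aug_injective (n : ℕ) : Function.Injective (J.aug Γ n) := fun c c' h => by
  refine J.augX_injective Γ hF n ?_
  have := congrFun (congrFun h 0) n
  rwa [aug_eq, aug_eq, DoubleComplex.single_same, DoubleComplex.single_same] at this

omit [HasInjectiveResolutions A] in
lemma exists_augX_eq (n : ℕ) (x : ((J.doubleComplex Γ).X 0).X n)
    (hx : (((J.doubleComplex Γ).d 0 1).f n).hom x = 0) : ∃ c, J.augX Γ n c = x :=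
  have : Injective (((F.mapHomologicalComplex (ComplexShape.up ℕ)).obj J.res.cocomplex).X n) :=
    hF n
  (J.ce.terms n).map_exact₀ (Z := ((F.mapHomologicalComplex (ComplexShape.up ℕ)).obj
    J.res.cocomplex).X n) Γ x hx

omit [HasInjectiveResolutions A] in
lemma exists_d_eq (a b : ℕ) (x : ((J.doubleComplex Γ).X (a + 1)).X b)
    (hx : (((J.doubleComplex Γ).d (a + 1) (a + 1 + 1)).f b).hom x = 0) :
    ∃ u : ((J.doubleComplex Γ).X a).X b, (((J.doubleComplex Γ).d a (a + 1)).f b).hom u = x :=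
  have : Injective (((F.mapHomologicalComplex (ComplexShape.up ℕ)).obj J.res.cocomplex).X b) :=
    hF b
  (J.ce.terms b).map_exact_succ (Z := ((F.mapHomologicalComplex (ComplexShape.up ℕ)).obj
    J.res.cocomplex).X b) Γ a x hx

omit [HasInjectiveResolutions A] in
lemma exists_aug_eq (n : ℕ) {x : (J.doubleComplex Γ).Tot}
    (hx : x ∈ (J.doubleComplex Γ).totDegree n) (hx' : ∀ a b, 0 < a → x a b = 0)
    (h : (J.doubleComplex Γ).totD x 1 n = 0) : ∃ c, J.aug Γ n c = x := by
  rw [DoubleComplex.totD_apply, hx' 1 _ one_pos, map_zero, smul_zero, add_zero] at h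
  obtain ⟨c, hc⟩ := J.exists_augX_eq Γ hF n (x 0 n) h
  refine ⟨c, ?_⟩
  rw [aug_eq, hc]
  funext a b
  by_cases hab : a = 0 ∧ b = n
  · obtain ⟨rfl, rfl⟩ := hab
    exact DoubleComplex.single_same _ _ _
  · rw [DoubleComplex.single_of_ne _ hab]
    by_cases ha : a = 0
    · exact (hx a b (by lia)).symm
    · exact (hx' a b (by lia)).symm

omit [HasInjectiveResolutions A] in
/-- An element of the total complex whose boundary lies in the image of the augmentation is, up to
a boundary, in the image of the augmentation. -/
lemma exists_eq_aug_add_totD (n : ℕ) {x : (J.doubleComplex Γ).Tot}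
    (hx : x ∈ (J.doubleComplex Γ).totDegree n)
    (h : ∀ a b, 0 < a → (J.doubleComplex Γ).totD x a b = 0) :
    ∃ c, ∃ y ∈ (J.doubleComplex Γ).totDegree (n - 1),
      x = J.aug Γ n c + (J.doubleComplex Γ).totD y := by
  -- An element of degree `n` has no component in columns beyond `n`, which gives the bound on its
  -- support.
  obtain ⟨y, hy, hxy⟩ := DoubleComplex.exists_sub_totD_concentrated (J.exists_d_eq Γ hF) n n x hx
    (DoubleComplex.totD_mem_totDegree hx rfl) h (fun a b hab => hx a b (by lia))
  obtain ⟨c, hc⟩ := J.exists_aug_eq Γ hF n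
    (sub_mem hx (DoubleComplex.totD_mem_totDegree hy (by lia))) hxy (by
      rw [map_sub, DoubleComplex.totD_totD, sub_zero]
      exact h _ _ one_pos)
  exact ⟨c, y, hy, by rw [hc, sub_add_cancel]⟩

/-- Surjectivity of the augmentation on cohomology. Up to a boundary, a total cocycle is the
augmentation of some `c`, and `dc = 0` because the augmentation is injective. -/
lemma exists_representsAbutment' (θ : F ⋙ Γ ≅ L) {x : (J.doubleComplex Γ).Tot}
    (hx : x ∈ (J.doubleComplex Γ).totDegree n) (h : (J.doubleComplex Γ).totD x = 0) :
    ∃ h, J.RepresentsAbutment θ n x h := by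
  obtain ⟨c, y, hy, rfl⟩ := J.exists_eq_aug_add_totD Γ hF n hx (fun a b _ => by rw [h]; rfl)
  rw [map_add, DoubleComplex.totD_totD, add_zero, totD_aug] at h
  have h1 : J.dRes Γ n (n + 1) c = 0 := J.aug_injective Γ hF (n + 1) (h.trans (aug_zero _ _ _).symm)
  obtain ⟨z, hz⟩ := (J.resComplex L).exists_iCycles_eq n (J.toResComplex θ n c) (fun j => by
    by_cases hj : n + 1 = j
    · subst hj
      rw [← toResComplex_dRes, h1, map_zero]
    · rw [(J.resComplex L).shape n j hj]
      rfl)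
  exact ⟨(J.resIso L n).inv.hom (((J.resComplex L).homologyπ n).hom z),
    (J.representsAbutment_iff Γ θ n _ _).2 ⟨z, c, congrArg
      (fun f => f.hom (((J.resComplex L).homologyπ n).hom z))
      (J.resIso L n).inv_hom_id, hz, y, hy, rfl⟩⟩

-- Injectivity of the augmentation on cohomology. If the augmentation of `c` bounds an element, the
-- boundary is concentrated in column `0`, so that element is the augmentation of some `u` up to a
-- boundary; then `c = du`.
variable {Γ J} in
lemma RepresentsAbutment.eq_zero_iff {x : (J.doubleComplex Γ).Tot}
    {h : (L.rightDerived n).obj M} (H : J.RepresentsAbutment θ n x h) :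
    h = 0 ↔ ∃ y ∈ (J.doubleComplex Γ).totDegree (n - 1), x = (J.doubleComplex Γ).totD y := by
  obtain ⟨z, c, h1, h2, y, hy, rfl⟩ := (J.representsAbutment_iff Γ θ n _ h).1 H
  have e : h = 0 ↔ ∃ (j : ℕ) (u : Γ.obj (F.obj (J.res.cocomplex.X j))), J.dRes Γ j n u = c := by
    rw [← ((ConcreteCategory.bijective_of_isIso (J.resIso L n).hom).1).eq_iff]
    change (J.resIso L n).hom.hom h = (J.resIso L n).hom.hom 0 ↔ _
    rw [map_zero, h1, HomologicalComplex.homologyπ_eq_zero_iff, h2]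
    constructor
    · rintro ⟨j, u, hu⟩
      obtain ⟨u, rfl⟩ := (J.toResComplex_bijective Γ θ j).2 u
      exact ⟨j, u, (J.toResComplex_bijective Γ θ n).1 ((J.toResComplex_dRes Γ θ j n u).trans hu)⟩
    · rintro ⟨j, u, rfl⟩
      exact ⟨j, _, (J.toResComplex_dRes Γ θ j n u).symm⟩
  rw [e]
  constructor
  · rintro ⟨j, u, rfl⟩
    by_cases hj : j + 1 = n
    · subst hj
      refine ⟨J.aug Γ j u + y, add_mem ?_ hy, by rw [map_add, totD_aug]⟩
      have : ((j + 1 : ℕ) : ℤ) - 1 = j := by lia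
      rw [this]
      exact J.aug_mem_totDegree Γ j u
    · refine ⟨y, hy, ?_⟩
      have : J.dRes Γ j n u = 0 := by
        unfold dRes
        rw [J.res.cocomplex.shape j n hj, F.map_zero, Γ.map_zero]
        rfl
      rw [this, aug_zero, zero_add]
  · rintro ⟨y', hy', e'⟩
    have h3 : J.aug Γ n c = (J.doubleComplex Γ).totD (y' - y) := by
      rw [map_sub, ← e', add_sub_cancel_right]
    cases n with
    | zero =>
      -- There are no elements of total degree `-1`, so the augmentation of `c` is zero and `c = 0`
      -- is a trivial boundary.
      refine ⟨0, 0, J.aug_injective Γ hF 0 ?_⟩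
      rw [map_zero, aug_zero, h3]
      refine (DoubleComplex.eq_zero_of_mem_fil (n := 0) (s := 1) ?_ ?_ one_pos).symm
      · exact DoubleComplex.totD_mem_totDegree (sub_mem hy' hy) (by simp)
      · rw [DoubleComplex.eq_zero_of_mem_fil (s := 0) (sub_mem hy' hy)
          (DoubleComplex.mem_fil_of_nonpos _ le_rfl) (by simp), map_zero]
        exact zero_mem _
    | succ m =>
      have hm : ((m + 1 : ℕ) : ℤ) - 1 = m := by lia
      rw [hm] at hy hy'
      obtain ⟨u, t, -, ht⟩ := J.exists_eq_aug_add_totD Γ hF m (sub_mem hy' hy) (fun a b ha => by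
        rw [← h3, aug_eq, DoubleComplex.single_of_ne]
        lia)
      refine ⟨m, u, J.aug_injective Γ hF (m + 1) ?_⟩
      rw [h3, ht, map_add, DoubleComplex.totD_totD, totD_aug, add_zero]

end abutment

end CompositeResolution

/-- An additive functional relation between modules is a linear map. -/
lemma exists_linearMap_of_relation {R : Type*} [Ring R] {Z N : Type*} [AddCommGroup Z]
    [Module R Z] [AddCommGroup N] [Module R N] (ρ : Submodule R (Z × N))
    (h₁ : ∀ z, ∃ n, (z, n) ∈ ρ) (h₂ : ∀ n, (0, n) ∈ ρ → n = 0) :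
    ∃ f : Z →ₗ[R] N, ∀ z n, (z, n) ∈ ρ → f z = n := by
  choose f hf using h₁
  have uniq : ∀ z n n', (z, n) ∈ ρ → (z, n') ∈ ρ → n = n' := fun z n n' h h' => by
    have := ρ.sub_mem h h'
    rw [Prod.mk_sub_mk, sub_self] at this
    exact sub_eq_zero.1 (h₂ _ this)
  exact ⟨{ toFun := f
           map_add' z z' := uniq (z + z') _ _ (hf _) (ρ.add_mem (hf z) (hf z'))
           map_smul' c z := uniq (c • z) _ _ (hf _) (ρ.smul_mem c (hf z)) },
    fun z n h => uniq z _ _ (hf z) h⟩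

/-! ### Convergence to the derived functors of the composite -/

namespace CompositeResolution

variable {A : Type*} [Category* A] [Abelian A] [HasInjectiveResolutions A]
  {B : Type*} [Category* B] [Abelian B]
  {R : Type v} [Ring R] {F : A ⥤ B} [F.Additive] {Γ : B ⥤ ModuleCat.{w} R} [Γ.Additive]
  {L : A ⥤ ModuleCat.{w} R} [L.Additive] {M : A} (J : CompositeResolution F M)

section convergence

variable (θ : F ⋙ Γ ≅ L)

/-- The filtration of `RⁿL(M)` induced by the filtration of the total complex. -/
noncomputable def abutmentFil (n s : ℕ) : Submodule R ((L.rightDerived n).obj M) where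
  carrier := {h | ∃ x ∈ (J.doubleComplex Γ).fil s, J.RepresentsAbutment θ n x h}
  zero_mem' := by
    obtain ⟨x, hx⟩ := J.exists_representsAbutment θ (n := n) 0
    have := hx.smul 0
    rw [zero_smul, zero_smul] at this
    exact ⟨0, zero_mem _, this⟩
  add_mem' := by
    rintro h h' ⟨x, hx, H⟩ ⟨x', hx', H'⟩
    exact ⟨x + x', add_mem hx hx', H.add H'⟩
  smul_mem' := by
    rintro c h ⟨x, hx, H⟩
    exact ⟨c • x, Submodule.smul_mem _ _ hx, H.smul c⟩

lemma abutmentFil_antitone (n : ℕ) : Antitone (J.abutmentFil θ n) := by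
  rintro s t hst h ⟨x, hx, H⟩
  exact ⟨x, DoubleComplex.fil_le (by lia) hx, H⟩

lemma abutmentFil_zero (n : ℕ) : J.abutmentFil θ n 0 = ⊤ := by
  refine eq_top_iff.2 fun h _ => ?_
  obtain ⟨x, hx⟩ := J.exists_representsAbutment θ h
  exact ⟨x, DoubleComplex.mem_fil_of_nonpos x le_rfl, hx⟩

variable {J θ} in
lemma RepresentsAbutment.mem_approxCycles {a b : ℕ} {x : (J.doubleComplex Γ).Tot}
    {h : (L.rightDerived (a + b)).obj M} (H : J.RepresentsAbutment θ (a + b) x h)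
    {s : ℤ} (hx : x ∈ (J.doubleComplex Γ).fil s) (r : ℤ) :
    x ∈ (J.doubleComplex Γ).approxCycles r s (a + b) := by
  refine DoubleComplex.mem_approxCycles.2 ⟨?_, hx, by rw [H.totD_eq_zero]; exact zero_mem _⟩
  have := H.mem_totDegree
  rwa [Nat.cast_add] at this

variable (hF : ∀ n, Injective (F.obj (J.res.cocomplex.X n)))
include hF

lemma abutmentFil_succ (n : ℕ) : J.abutmentFil θ n (n + 1) = ⊥ := by
  refine eq_bot_iff.2 ?_
  rintro h ⟨x, hx, H⟩
  refine (H.eq_zero_iff hF).2 ⟨0, zero_mem _, ?_⟩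
  rw [map_zero]
  exact DoubleComplex.eq_zero_of_mem_fil H.mem_totDegree hx (by lia)

variable {J θ} in
/-- Two cocycles with the same class differ by a boundary. -/
lemma RepresentsAbutment.exists_eq_add_totD {n : ℕ} {x x' : (J.doubleComplex Γ).Tot}
    {h : (L.rightDerived n).obj M} (H : J.RepresentsAbutment θ n x h)
    (H' : J.RepresentsAbutment θ n x' h) :
    ∃ y ∈ (J.doubleComplex Γ).totDegree (n - 1), x = x' + (J.doubleComplex Γ).totD y := by
  have H'' := H.add (H'.smul (-1))
  rw [neg_one_smul, neg_one_smul, add_neg_cancel] at H''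
  obtain ⟨y, hy, e⟩ := (H''.eq_zero_iff hF).1 rfl
  exact ⟨y, hy, by rw [← e]; abel⟩

omit hF in
lemma exists_approxCycles_of_mem {r : ℤ} {a b : ℕ} (h : J.abutmentFil θ (a + b) a) :
    ∃ x : (J.doubleComplex Γ).approxCycles r a (a + b), J.RepresentsAbutment θ (a + b) x.1 h.1 := by
  obtain ⟨x, hx, H⟩ := h.2
  exact ⟨⟨x, H.mem_approxCycles hx r⟩, H⟩

/-- For `a < r` the index `a - r + 1` is at most `0`, so the elements `y` of `Z_{r-1}^{a-r+1}`
satisfy no real filtration condition. Hence `x` dies in `E_r` exactly when it is cohomologous to a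
cocycle in `F^{a+1}`. -/
lemma pageπ_eq_zero_iff_of_representsAbutment {r : ℤ} {a b : ℕ} (ha : (a : ℤ) < r)
    (h : (L.rightDerived (a + b)).obj M) (x : (J.doubleComplex Γ).approxCycles r a (a + b))
    (H : J.RepresentsAbutment θ (a + b) x.1 h) :
    (J.doubleComplex Γ).pageπ r a b x = 0 ↔ h ∈ J.abutmentFil θ (a + b) (a + 1) := by
  have hab : ((a + b : ℕ) : ℤ) - 1 = a + b - 1 := by lia
  rw [DoubleComplex.pageπ_eq_zero_iff, DoubleComplex.mem_approxBoundaries]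
  constructor
  · rintro ⟨w, hw, y, hy, e⟩
    have hy' : y ∈ (J.doubleComplex Γ).totDegree ((a + b : ℕ) - 1) := by
      rw [hab]; exact (DoubleComplex.mem_approxCycles.1 hy).1
    refine ⟨w, ?_, ?_⟩
    · rw [Nat.cast_add, Nat.cast_one]
      exact (DoubleComplex.mem_approxCycles.1 hw).2.1
    · have := H.add_totD (neg_mem hy')
      rwa [e, map_neg, add_neg_cancel_right] at this
  · rintro ⟨w, hw, H'⟩
    obtain ⟨y, hy, e⟩ := H.exists_eq_add_totD hF H'
    rw [Nat.cast_add, Nat.cast_one] at hw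
    rw [hab] at hy
    refine ⟨w, H'.mem_approxCycles hw _, y, DoubleComplex.mem_approxCycles.2 ⟨hy,
      DoubleComplex.mem_fil_of_nonpos y (by lia), ?_⟩, e⟩
    rw [← sub_eq_of_eq_add' e]
    exact sub_mem (DoubleComplex.fil_le (by lia) (DoubleComplex.mem_approxCycles.1 x.2).2.1)
      (DoubleComplex.fil_le (by lia) hw)

/-- A class may have many representatives in `F^a`, but those of the zero class die in `E_r`, so
sending a class to the image of a representative is a well-defined linear map. Only `a < r` is
needed; the condition on `b` matters for surjectivity. -/
lemma exists_abutmentπ {r : ℤ} {a b : ℕ} (ha : (a : ℤ) < r) :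
    ∃ f : J.abutmentFil θ (a + b) a →ₗ[R] (J.doubleComplex Γ).PageX r a b,
      ∀ (h : J.abutmentFil θ (a + b) a) (x : (J.doubleComplex Γ).approxCycles r a (a + b)),
        J.RepresentsAbutment θ (a + b) x.1 h.1 → f h = (J.doubleComplex Γ).pageπ r a b x := by
  let ρ : Submodule R (J.abutmentFil θ (a + b) a × (J.doubleComplex Γ).PageX r a b) :=
    { carrier := {p | ∃ x : (J.doubleComplex Γ).approxCycles r a (a + b),
        J.RepresentsAbutment θ (a + b) x.1 p.1.1 ∧ (J.doubleComplex Γ).pageπ r a b x = p.2}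
      zero_mem' := by
        obtain ⟨x, hx⟩ := J.exists_approxCycles_of_mem θ (r := r) (a := a) (b := b) 0
        have := hx.smul 0
        rw [zero_smul] at this
        exact ⟨0, by rwa [zero_smul] at this, map_zero _⟩
      add_mem' := by
        rintro _ _ ⟨x, H, e⟩ ⟨x', H', e'⟩
        exact ⟨x + x', H.add H', by rw [map_add, e, e']; rfl⟩
      smul_mem' := by
        rintro c _ ⟨x, H, e⟩
        exact ⟨c • x, H.smul c, by rw [map_smul, e]; rfl⟩ }
  obtain ⟨f, hf⟩ := exists_linearMap_of_relation ρ (fun h => by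
    obtain ⟨x, hx⟩ := J.exists_approxCycles_of_mem θ (r := r) h
    exact ⟨_, x, hx, rfl⟩) (by
    rintro _ ⟨x, H, rfl⟩
    exact (J.pageπ_eq_zero_iff_of_representsAbutment θ hF ha 0 x H).2 (zero_mem _))
  exact ⟨f, fun h x H => hf _ _ ⟨x, H, rfl⟩⟩

/-- The map `F^a R^{a+b}L(M) → E_r^{a,b}` for `a < r`. -/
noncomputable def abutmentπ (r : ℤ) (a b : ℕ) (ha : (a : ℤ) < r) :
    J.abutmentFil θ (a + b) a →ₗ[R] (J.doubleComplex Γ).PageX r a b :=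
  (J.exists_abutmentπ θ hF ha).choose

lemma abutmentπ_eq {r : ℤ} {a b : ℕ} (ha : (a : ℤ) < r) (h : J.abutmentFil θ (a + b) a)
    (x : (J.doubleComplex Γ).approxCycles r a (a + b))
    (H : J.RepresentsAbutment θ (a + b) x.1 h.1) :
    J.abutmentπ θ hF r a b ha h = (J.doubleComplex Γ).pageπ r a b x :=
  (J.exists_abutmentπ θ hF ha).choose_spec h x H

/-- The spectral sequence of the double complex `Γ(J)` converges to the right derived functors
of `L`. -/
noncomputable def convergence :
    SpectralSequenceConvergence (J.doubleComplex Γ).spectralSequence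
      (fun n => (L.rightDerived n).obj M) where
  fil := J.abutmentFil θ
  fil_antitone := J.abutmentFil_antitone θ
  fil_zero := J.abutmentFil_zero θ
  fil_succ := J.abutmentFil_succ θ hF
  π r _ a b ha _ := J.abutmentπ θ hF r a b ha
  π_surjective r hr a b ha hb e := by
    obtain ⟨x, rfl⟩ := (J.doubleComplex Γ).pageπ_surjective r a b e
    have hx := DoubleComplex.mem_approxCycles.1 x.2
    -- The condition `b + 1 < r` places `F^{a+r}` beyond the total degree `a + b + 1`, so elements
    -- of `Z_r` are genuine cocycles.
    have h0 : (J.doubleComplex Γ).totD x.1 = 0 :=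
      DoubleComplex.eq_zero_of_mem_fil (DoubleComplex.totD_mem_totDegree hx.1 rfl) hx.2.2 (by lia)
    obtain ⟨h, H⟩ := J.exists_representsAbutment' Γ hF (n := a + b) θ (x := x.1)
      (by rw [Nat.cast_add]; exact hx.1) h0
    exact ⟨⟨h, x.1, hx.2.1, H⟩, J.abutmentπ_eq θ hF ha _ x H⟩
  π_eq_zero_iff r hr a b ha hb h := by
    obtain ⟨x, H⟩ := J.exists_approxCycles_of_mem θ (r := r) h
    exact (iff_of_eq (congrArg (fun t => t = 0) (J.abutmentπ_eq θ hF ha h x H))).trans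
      (J.pageπ_eq_zero_iff_of_representsAbutment θ hF ha h.1 x H)
  iso_π r hr a b ha hb h z hz := by
    obtain ⟨x, H⟩ := J.exists_approxCycles_of_mem θ (r := r) h
    have hx := H.mem_approxCycles (DoubleComplex.mem_approxCycles.1 x.2).2.1 (r + 1)
    exact ((J.doubleComplex Γ).spectralSequenceData.iso_π r hr a b x ⟨x.1, hx⟩ rfl z
      (hz.trans (J.abutmentπ_eq θ hF ha h x H))).trans
        (J.abutmentπ_eq θ hF (show (a : ℤ) < r + 1 by lia) h ⟨x.1, hx⟩ H).symm

end convergence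

end CompositeResolution

/-! ### Morphisms of resolutions and naturality of the identifications -/

namespace CompositeResolution

variable {A : Type*} [Category* A] [Abelian A] [HasInjectiveResolutions A]
  {B : Type*} [Category* B] [Abelian B]
  {R : Type v} [Ring R] {F : A ⥤ B} [F.Additive] {M N : A}

/-- A morphism between the resolutions of `M` and `N` which lifts `f : M ⟶ N`. -/
structure Lift (J : CompositeResolution F M) (J' : CompositeResolution F N) (f : M ⟶ N) where
  /-- the morphism between the injective resolutions -/
  res : J.res.cocomplex ⟶ J'.res.cocomplex
  /-- the morphism between the Cartan–Eilenberg resolutions -/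
  ce : J.ce.cocomplex ⟶ J'.ce.cocomplex
  ι_res : J.res.ι.f 0 ≫ res.f 0 = f ≫ J'.res.ι.f 0
  ι_ce : J.ce.ι ≫ ce.f 0 = (F.mapHomologicalComplex (ComplexShape.up ℕ)).map res ≫ J'.ce.ι

namespace Lift

variable {J : CompositeResolution F M} {J' : CompositeResolution F N} {f : M ⟶ N}
  (φ : J.Lift J' f) (Γ : B ⥤ ModuleCat.{w} R) [Γ.Additive]
  {L : A ⥤ ModuleCat.{w} R} [L.Additive]

/-- The induced morphism `Γ(J) ⟶ Γ(J')` of double complexes. -/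
noncomputable def doubleComplex : J.doubleComplex Γ ⟶ J'.doubleComplex Γ :=
  ((Γ.mapHomologicalComplex (ComplexShape.up ℕ)).mapHomologicalComplex (ComplexShape.up ℕ)).map φ.ce

/-- The induced map `Γ(F(Iⁿ)) → Γ(F(I'ⁿ))`. -/
noncomputable def mapRes (n : ℕ) :
    Γ.obj (F.obj (J.res.cocomplex.X n)) →ₗ[R] Γ.obj (F.obj (J'.res.cocomplex.X n)) :=
  (Γ.map (F.map (φ.res.f n))).hom

omit [HasInjectiveResolutions A] in
lemma totMap_aug (n : ℕ) (c) : DoubleComplex.totMap (φ.doubleComplex Γ) (J.aug Γ n c) =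
    J'.aug Γ n (φ.mapRes Γ n c) := by
  have h := congrArg (fun g => Γ.map (g.f n)) φ.ι_ce
  rw [HomologicalComplex.comp_f, Γ.map_comp, HomologicalComplex.comp_f, Γ.map_comp] at h
  rw [aug_eq, aug_eq, DoubleComplex.totMap_single]
  exact congrArg _ (congrArg (fun g => g.hom c) h)

variable (L) in
/-- The induced morphism `L(I) ⟶ L(I')`. -/
noncomputable def resComplex : J.resComplex L ⟶ J'.resComplex L :=
  (L.mapHomologicalComplex (ComplexShape.up ℕ)).map φ.res

variable (L) in
lemma resIso_naturality (n : ℕ) (h : (L.rightDerived n).obj M) :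
    (J'.resIso L n).hom.hom (((L.rightDerived n).map f).hom h) =
      (HomologicalComplex.homologyMap (φ.resComplex L) n).hom ((J.resIso L n).hom.hom h) :=
  congrArg (fun g => g.hom h)
    (InjectiveResolution.isoRightDerivedObj_hom_naturality f J.res J'.res φ.res φ.ι_res L n)

-- Every witness of the representation is carried along by the lift. This and `representsE₂` give
-- the naturality of the convergence and of the second page.
variable {Γ} in
lemma representsAbutment (θ : F ⋙ Γ ≅ L) (n : ℕ) {x : (J.doubleComplex Γ).Tot}
    {h : (L.rightDerived n).obj M} (H : J.RepresentsAbutment θ n x h) :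
    J'.RepresentsAbutment θ n (DoubleComplex.totMap (φ.doubleComplex Γ) x)
      (((L.rightDerived n).map f).hom h) := by
  obtain ⟨z, c, h1, h2, y, hy, rfl⟩ := (J.representsAbutment_iff Γ θ n _ h).1 H
  refine (J'.representsAbutment_iff Γ θ n _ _).2
    ⟨(HomologicalComplex.cyclesMap (φ.resComplex L) n).hom z, φ.mapRes Γ n c, ?_, ?_,
      DoubleComplex.totMap (φ.doubleComplex Γ) y, DoubleComplex.totMap_mem_totDegree _ hy, ?_⟩
  · rw [resIso_naturality, h1]
    exact congrArg (fun g => g.hom z)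
      (HomologicalComplex.homologyπ_naturality (φ.resComplex L) n)
  · refine (congrArg (fun g => g.hom z)
      (HomologicalComplex.cyclesMap_i (φ.resComplex L) n)).trans ?_
    exact (congrArg (((φ.resComplex L).f n).hom) h2).trans
      (congrArg (fun g => g.hom c) (θ.hom.naturality (φ.res.f n))).symm
  · rw [map_add, totMap_aug, DoubleComplex.totMap_totD]

variable [HasInjectiveResolutions B]

/-- The induced morphism `Γ(H^b(J)) ⟶ Γ(H^b(J'))`. -/
noncomputable def homologyComplex (b : ℕ) : J.homologyComplex Γ b ⟶ J'.homologyComplex Γ b :=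
  (Γ.mapHomologicalComplex (ComplexShape.up ℕ)).map
    (((HomologicalComplex.homologyFunctor B (ComplexShape.up ℕ) b).mapHomologicalComplex
      (ComplexShape.up ℕ)).map φ.ce)

omit [HasInjectiveResolutions A] [HasInjectiveResolutions B] in
lemma ι_homology (b : ℕ) :
    (J.ce.homology b).toInjectiveResolution.ι.f 0 ≫
      HomologicalComplex.homologyMap (φ.ce.f 0) b =
    HomologicalComplex.homologyMap ((F.mapHomologicalComplex (ComplexShape.up ℕ)).map φ.res) b ≫
      (J'.ce.homology b).toInjectiveResolution.ι.f 0 := by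
  have e : (J.ce.homology b).toInjectiveResolution.ι.f 0 =
      HomologicalComplex.homologyMap J.ce.ι b :=
    CochainComplex.fromSingle₀Equiv_symm_apply_f_zero _ _
  have e' : (J'.ce.homology b).toInjectiveResolution.ι.f 0 =
      HomologicalComplex.homologyMap J'.ce.ι b :=
    CochainComplex.fromSingle₀Equiv_symm_apply_f_zero _ _
  have h := congrArg (fun g => HomologicalComplex.homologyMap g b) φ.ι_ce
  rw [HomologicalComplex.homologyMap_comp, HomologicalComplex.homologyMap_comp] at h
  exact (congrArg (fun g => g ≫ HomologicalComplex.homologyMap (φ.ce.f 0) b) e).trans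
    (h.trans (congrArg (fun g => HomologicalComplex.homologyMap
      ((F.mapHomologicalComplex (ComplexShape.up ℕ)).map φ.res) b ≫ g) e').symm)

lemma rightDerivedIso_hom (a b : ℕ) :
    (Γ.rightDerived a).map ((F.rightDerived b).map f) ≫ (J'.rightDerivedIso Γ a b).hom =
      (J.rightDerivedIso Γ a b).hom ≫
        HomologicalComplex.homologyMap (φ.homologyComplex Γ b) a := by
  have h1 := InjectiveResolution.isoRightDerivedObj_hom_naturality f J.res J'.res φ.res φ.ι_res F b
  have h2 := InjectiveResolution.isoRightDerivedObj_hom_naturality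
    (HomologicalComplex.homologyMap ((F.mapHomologicalComplex (ComplexShape.up ℕ)).map φ.res) b)
    (J.ce.homology b).toInjectiveResolution (J'.ce.homology b).toInjectiveResolution
    (((HomologicalComplex.homologyFunctor B (ComplexShape.up ℕ) b).mapHomologicalComplex
      (ComplexShape.up ℕ)).map φ.ce) (φ.ι_homology b) Γ a
  have h1' := congrArg (Γ.rightDerived a).map h1
  rw [Functor.map_comp, Functor.map_comp] at h1'
  exact comp_square h1' h2.symm

variable {Γ} in
lemma representsE₂ (a b : ℕ) {x : (J.doubleComplex Γ).Tot}
    {e : (Γ.rightDerived a).obj ((F.rightDerived b).obj M)} (H : J.RepresentsE₂ a b x e) :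
    J'.RepresentsE₂ a b (DoubleComplex.totMap (φ.doubleComplex Γ) x)
      (((Γ.rightDerived a).map ((F.rightDerived b).map f)).hom e) := by
  obtain ⟨y, ζ, h1, h2, h3⟩ := (J.representsE₂_iff Γ a b x e).1 H
  refine (J'.representsE₂_iff Γ a b _ _).2
    ⟨(Γ.map (HomologicalComplex.cyclesMap (φ.ce.f a) b)).hom y,
      (HomologicalComplex.cyclesMap (φ.homologyComplex Γ b) a).hom ζ, ?_, ?_, ?_⟩
  · have h := congrArg Γ.map (HomologicalComplex.cyclesMap_i (φ.ce.f a) b)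
    rw [Γ.map_comp, Γ.map_comp] at h
    have h4 : J'.inclZ Γ a b ((Γ.map (HomologicalComplex.cyclesMap (φ.ce.f a) b)).hom y) =
        (((φ.doubleComplex Γ).f a).f b).hom (J.inclZ Γ a b y) := congrArg (fun g => g.hom y) h
    rw [h4, ← DoubleComplex.totMap_single, ← map_sub]
    exact DoubleComplex.totMap_mem_fil _ h1
  · have h := congrArg Γ.map (HomologicalComplex.homologyπ_naturality (φ.ce.f a) b)
    rw [Γ.map_comp, Γ.map_comp] at h
    refine (congrArg (fun g => g.hom ζ)
      (HomologicalComplex.cyclesMap_i (φ.homologyComplex Γ b) a)).trans ?_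
    exact (congrArg (((φ.homologyComplex Γ b).f a).hom) h2).trans
      (congrArg (fun g => g.hom y) h)
  · refine (congrArg (fun g => g.hom e) (φ.rightDerivedIso_hom Γ a b)).trans ?_
    refine (congrArg (HomologicalComplex.homologyMap (φ.homologyComplex Γ b) a).hom h3).trans ?_
    exact congrArg (fun g => g.hom ζ)
      (HomologicalComplex.homologyπ_naturality (φ.homologyComplex Γ b) a)

end Lift

end CompositeResolution

/-! ### The composite functor spectral sequence -/

namespace CompositeResolution.Lift

variable {A : Type*} [Category* A] [Abelian A] [HasInjectiveResolutions A]
  {B : Type*} [Category* B] [Abelian B]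
  {R : Type v} [Ring R] {F : A ⥤ B} [F.Additive] {Γ : B ⥤ ModuleCat.{w} R} [Γ.Additive]
  {L : A ⥤ ModuleCat.{w} R} [L.Additive] {M N : A} {J : CompositeResolution F M}
  {J' : CompositeResolution F N} {f : M ⟶ N} (φ : J.Lift J' f) (θ : F ⋙ Γ ≅ L)

include φ in
lemma map_mem_abutmentFil {n s : ℕ} {h : (L.rightDerived n).obj M}
    (hh : h ∈ J.abutmentFil θ n s) :
    ((L.rightDerived n).map f).hom h ∈ J'.abutmentFil θ n s := by
  obtain ⟨x, hx, H⟩ := hh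
  exact ⟨_, DoubleComplex.totMap_mem_fil _ hx, φ.representsAbutment θ n H⟩

lemma abutmentπ_naturality (hF : ∀ n, Injective (F.obj (J.res.cocomplex.X n)))
    (hF' : ∀ n, Injective (F.obj (J'.res.cocomplex.X n))) (r : ℤ) (a b : ℕ) (ha : (a : ℤ) < r)
    (h : J.abutmentFil θ (a + b) a) :
    DoubleComplex.pageXMap (φ.doubleComplex Γ) r a b (J.abutmentπ θ hF r a b ha h) =
      J'.abutmentπ θ hF' r a b ha ⟨_, φ.map_mem_abutmentFil θ h.2⟩ := by
  obtain ⟨x, H⟩ := exists_approxCycles_of_mem J θ (r := r) h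
  rw [abutmentπ_eq J θ hF ha h x H, DoubleComplex.pageXMap_pageπ]
  exact (abutmentπ_eq J' θ hF' ha _ ⟨_, DoubleComplex.totMap_mem_approxCycles _ x.2⟩
    (φ.representsAbutment θ (a + b) H)).symm

end CompositeResolution.Lift

namespace CompositeResolution

variable {A : Type*} [Category* A] [Abelian A] {B : Type*} [Category* B] [Abelian B]
  (EA : FunctorialEmbedding A) (hA : ∀ X, Injective (EA.T.obj X))
  (EB : FunctorialEmbedding B) (hB : ∀ X, Injective (EB.T.obj X))
  (F : A ⥤ B) [F.Additive]

/-- The resolutions of `M` given by functorial embeddings into injective objects. -/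
noncomputable def ofFunctorialEmbedding (M : A) : CompositeResolution F M where
  res := (EA.isInjectiveResolution hA M).toInjectiveResolution
  ce := EB.cartanEilenbergResolution hB _

/-- The functoriality of `ofFunctorialEmbedding`. -/
noncomputable def liftOfFunctorialEmbedding {M N : A} (f : M ⟶ N) :
    (ofFunctorialEmbedding EA hA EB hB F M).Lift (ofFunctorialEmbedding EA hA EB hB F N) f where
  res := EA.coresolution.map f
  ce := EB.complexEmbedding.coresolution.map
    ((F.mapHomologicalComplex (ComplexShape.up ℕ)).map (EA.coresolution.map f))
  ι_res := by
    have e : ∀ X, (EA.isInjectiveResolution hA X).toInjectiveResolution.ι.f 0 =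
      EA.augmentation X := fun X => CochainComplex.fromSingle₀Equiv_symm_apply_f_zero _ _
    exact (congrArg (fun g => g ≫ (EA.coresolution.map f).f 0) (e M)).trans
      ((EA.augmentation_naturality f).trans (congrArg (fun g => f ≫ g) (e N)).symm)
  ι_ce := EB.complexEmbedding.augmentation_naturality _

variable {R : Type v} [Ring R] (Γ : B ⥤ ModuleCat.{w} R) [Γ.Additive]

/-- The spectral sequence of the functorial resolutions. -/
noncomputable def spectralSequenceFunctor :
    A ⥤ E₂CohomologicalSpectralSequenceNat (ModuleCat.{w} R) :=
  EA.coresolution ⋙ F.mapHomologicalComplex (ComplexShape.up ℕ) ⋙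
    EB.complexEmbedding.coresolution ⋙
    (Γ.mapHomologicalComplex (ComplexShape.up ℕ)).mapHomologicalComplex (ComplexShape.up ℕ) ⋙
    DoubleComplex.spectralSequenceFunctor R

variable [HasInjectiveResolutions A] [HasInjectiveResolutions B]

omit [HasInjectiveResolutions A] [HasInjectiveResolutions B] in
lemma isSplit_ofFunctorialEmbedding (M : A) (a : ℕ) :
    ((ofFunctorialEmbedding EA hA EB hB F M).ce.cocomplex.X a).IsSplit :=
  EB.isSplit_cartanEilenbergResolution hB _ a

/-- The isomorphism `E_2^{a,b} ≅ RᵃΓ(RᵇF(M))`. -/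
noncomputable def e₂Equiv (M : A) (a b : ℕ) :
    ((ofFunctorialEmbedding EA hA EB hB F M).doubleComplex Γ).PageX 2 a b ≃ₗ[R]
      (Γ.rightDerived a).obj ((F.rightDerived b).obj M) :=
  (exists_e₂Equiv Γ _ (isSplit_ofFunctorialEmbedding EA hA EB hB F M) a b).choose

lemma e₂Equiv_pageπ (M : A) (a b : ℕ)
    (x : ((ofFunctorialEmbedding EA hA EB hB F M).doubleComplex Γ).approxCycles 2 a (a + b))
    (e : (Γ.rightDerived a).obj ((F.rightDerived b).obj M))
    (h : (ofFunctorialEmbedding EA hA EB hB F M).RepresentsE₂ a b x.1 e) :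
    e₂Equiv EA hA EB hB F Γ M a b
      (((ofFunctorialEmbedding EA hA EB hB F M).doubleComplex Γ).pageπ 2 a b x) = e :=
  (exists_e₂Equiv Γ _ (isSplit_ofFunctorialEmbedding EA hA EB hB F M) a b).choose_spec x e h

/-- The isomorphism is determined by its values on represented classes, and lifts of morphisms
preserve representation. -/
lemma e₂Equiv_naturality {M N : A} (f : M ⟶ N) (a b : ℕ)
    (x : ((ofFunctorialEmbedding EA hA EB hB F M).doubleComplex Γ).PageX 2 a b) :
    e₂Equiv EA hA EB hB F Γ N a b (DoubleComplex.pageXMap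
      ((liftOfFunctorialEmbedding EA hA EB hB F f).doubleComplex Γ) 2 a b x) =
    ((Γ.rightDerived a).map ((F.rightDerived b).map f)).hom (e₂Equiv EA hA EB hB F Γ M a b x) := by
  obtain ⟨x, rfl⟩ := DoubleComplex.pageπ_surjective _ _ _ _ x
  obtain ⟨e, he⟩ := exists_representsE₂ Γ _ (isSplit_ofFunctorialEmbedding EA hA EB hB F M) a b x.2
  rw [e₂Equiv_pageπ EA hA EB hB F Γ M a b x e he, DoubleComplex.pageXMap_pageπ]
  exact e₂Equiv_pageπ EA hA EB hB F Γ N a b _ _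
    ((liftOfFunctorialEmbedding EA hA EB hB F f).representsE₂ a b he)

variable {F Γ} [F.PreservesInjectiveObjects]

omit [HasInjectiveResolutions A] [HasInjectiveResolutions B] in
lemma injective_ofFunctorialEmbedding (M : A) (n : ℕ) :
    Injective (F.obj ((ofFunctorialEmbedding EA hA EB hB F M).res.cocomplex.X n)) :=
  have := (ofFunctorialEmbedding EA hA EB hB F M).res.injective n
  F.injective_obj _

/-- The Grothendieck spectral sequence for a functor `F` preserving injective objects, between
categories with functorial embeddings into injective objects. -/
noncomputable def grothendieckSpectralSequence {L : A ⥤ ModuleCat.{w} R} [L.Additive]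
    (θ : F ⋙ Γ ≅ L) : GrothendieckSpectralSequence θ where
  E := spectralSequenceFunctor EA EB F Γ
  e₂ p q := NatIso.ofComponents (fun M => (e₂Equiv EA hA EB hB F Γ M p q).toModuleIso)
    (fun f => ModuleCat.hom_ext (LinearMap.ext fun x =>
      e₂Equiv_naturality EA hA EB hB F Γ f p q x))
  conv M := convergence (ofFunctorialEmbedding EA hA EB hB F M) θ
    (injective_ofFunctorialEmbedding EA hA EB hB M)
  map_mem_fil f _ _ _ hh := (liftOfFunctorialEmbedding EA hA EB hB F f).map_mem_abutmentFil θ hh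
  map_π {M N} f r _ a b ha _ h := (liftOfFunctorialEmbedding EA hA EB hB F f).abutmentπ_naturality
    θ (injective_ofFunctorialEmbedding EA hA EB hB M)
    (injective_ofFunctorialEmbedding EA hA EB hB N)
    r a b ha h
  res M := ofFunctorialEmbedding EA hA EB hB F M
  data M := ((ofFunctorialEmbedding EA hA EB hB F M).doubleComplex Γ).spectralSequenceData
  e₂_eq M a b x e h := e₂Equiv_pageπ EA hA EB hB F Γ M a b x e h
  mem_fil_iff _ _ _ _ := Iff.rfl
  conv_π_eq M _ _ _ _ ha _ h x hx :=
    abutmentπ_eq _ θ (injective_ofFunctorialEmbedding EA hA EB hB M) ha h x hx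

end CompositeResolution

/-! ### Functorial injective embeddings of representations -/

namespace Rep

variable (k : Type v) [CommRing k] (G : Type u) [Group G]

/-- The functorial embedding of `G`-modules in injective ones. -/
noncomputable def functorialEmbedding : FunctorialEmbedding (Rep.{max u v} k G) :=
  .ofAdjunction (Rep.equivalenceModuleMonoidAlgebra (k := k) (G := G)).toAdjunction
    (.ofIsGrothendieckAbelian.{max u v} (ModuleCat.{max u v} (MonoidAlgebra k G)))

lemma injective_functorialEmbedding (M : Rep.{max u v} k G) :
    Injective ((functorialEmbedding k G).T.obj M) :=
  Injective.injective_of_adjoint (Rep.equivalenceModuleMonoidAlgebra (k := k) (G := G)).toAdjunction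
    ((FunctorialEmbedding.ofIsGrothendieckAbelian.{max u v} (ModuleCat.{max u v}
      (MonoidAlgebra k G))).T.obj _)

end Rep

namespace AdmissibleFamily

variable (k : Type v) [CommRing k] {G : Type u} [Group G] (S : AdmissibleFamily G)

/-- The functorial embedding of the objects of `Mod-kG/S` in injective ones. -/
noncomputable def functorialEmbedding : FunctorialEmbedding (S.Mod k) :=
  .ofAdjunction S.adj (Rep.functorialEmbedding k G)

lemma injective_functorialEmbedding (M : S.Mod k) :
    Injective ((S.functorialEmbedding k).T.obj M) :=
  have := Rep.injective_functorialEmbedding k G M.obj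
  Injective.injective_of_adjoint S.adj ((Rep.functorialEmbedding k G).T.obj M.obj)

/-- A right adjoint of a functor that preserves monomorphisms preserves injectives; here the left
adjoint is the inclusion. -/
instance : (S.H0 k).PreservesInjectiveObjects where
  injective_obj {I} _ := Injective.injective_of_adjoint S.adj I

/-- The Grothendieck spectral sequence of the factorization of the `G`-fixed point functor. -/
noncomputable def grothendieckSpectralSequence : GrothendieckSpectralSequence (S.factorization k) :=
  CompositeResolution.grothendieckSpectralSequence (Rep.functorialEmbedding k G)
    (Rep.injective_functorialEmbedding k G) (S.functorialEmbedding k)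
    (S.injective_functorialEmbedding k) (S.factorization k)

end AdmissibleFamily

/-! ### Right derived functors and exact functors -/

namespace HomologicalComplex

variable {B C : Type*} [Category* B] [Category* C] [Abelian B] [Abelian C]
  (T : B ⥤ C) [T.Additive] [T.PreservesHomology] (T' : B ⥤ C) [T'.Additive] [T'.PreservesHomology]

/-- An exact functor commutes with the homology of complexes. -/
noncomputable def mapHomologyIso (K : CochainComplex B ℕ) (n : ℕ) :
    ((T.mapHomologicalComplex (ComplexShape.up ℕ)).obj K).homology n ≅ T.obj (K.homology n) :=
  (K.sc n).mapHomologyIso T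

lemma mapHomologyIso_hom_naturality {K L : CochainComplex B ℕ} (φ : K ⟶ L) (n : ℕ) :
    homologyMap ((T.mapHomologicalComplex (ComplexShape.up ℕ)).map φ) n ≫
      (mapHomologyIso T L n).hom = (mapHomologyIso T K n).hom ≫ T.map (homologyMap φ n) :=
  ShortComplex.mapHomologyIso_hom_naturality ((shortComplexFunctor B _ n).map φ) T

variable {T T'} in
lemma mapHomologyIso_hom_app (τ : T ⟶ T') (K : CochainComplex B ℕ) (n : ℕ) :
    homologyMap ((NatTrans.mapHomologicalComplex τ (ComplexShape.up ℕ)).app K) n ≫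
      (mapHomologyIso T' K n).hom = (mapHomologyIso T K n).hom ≫ τ.app (K.homology n) := by
  have h := ShortComplex.homologyMap_mapNatTrans (K.sc n) τ
  rw [← Category.assoc, Iso.eq_comp_inv] at h
  exact h

end HomologicalComplex

section rightDerivedExact

variable {A B C : Type*} [Category* A] [Category* B] [Category* C] [Abelian A] [Abelian B]
  [Abelian C] [HasInjectiveResolutions A] (F : A ⥤ B) [F.Additive]
  (T : B ⥤ C) [T.Additive] [T.PreservesHomology] (T' : B ⥤ C) [T'.Additive] [T'.PreservesHomology]

namespace CategoryTheory.InjectiveResolution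

variable {F} {X Y : A}

/-- The isomorphism `Rⁿ(T ∘ F)(X) ≅ T(RⁿF(X))` given by an injective resolution of `X`. -/
noncomputable def rightDerivedExactIso (I : InjectiveResolution X) (n : ℕ) :
    ((F ⋙ T).rightDerived n).obj X ≅ T.obj ((F.rightDerived n).obj X) :=
  I.isoRightDerivedObj (F ⋙ T) n ≪≫
    HomologicalComplex.mapHomologyIso T ((F.mapHomologicalComplex _).obj I.cocomplex) n ≪≫
    T.mapIso (I.isoRightDerivedObj F n).symm

lemma rightDerivedExactIso_hom_naturality (f : X ⟶ Y) (I : InjectiveResolution X)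
    (J : InjectiveResolution Y) (n : ℕ) :
    ((F ⋙ T).rightDerived n).map f ≫ (J.rightDerivedExactIso (F := F) T n).hom =
      (I.rightDerivedExactIso T n).hom ≫ T.map ((F.rightDerived n).map f) := by
  let φ : I.cocomplex ⟶ J.cocomplex := InjectiveResolution.desc f J I
  have hφ : I.ι.f 0 ≫ φ.f 0 = f ≫ J.ι.f 0 := InjectiveResolution.desc_commutes_zero f J I
  have h1 := isoRightDerivedObj_hom_naturality f I J φ hφ (F ⋙ T) n
  have h2 := HomologicalComplex.mapHomologyIso_hom_naturality T
    ((F.mapHomologicalComplex (ComplexShape.up ℕ)).map φ) n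
  have h3 := congrArg T.map (isoRightDerivedObj_inv_naturality f I J φ hφ F n)
  rw [T.map_comp, T.map_comp] at h3
  exact comp_square h1 (comp_square h2 h3).symm

-- Applied to multiplication by `g` as `τ`, this matches the action of `g` on `H^q(S, M)` with the
-- derived action on the functor `H⁰(S, -)`.
variable {T T'} in
lemma rightDerivedExactIso_hom_app (τ : T ⟶ T') (I : InjectiveResolution X) (n : ℕ) :
    (NatTrans.rightDerived (Functor.whiskerLeft F τ) n).app X ≫ (I.rightDerivedExactIso T' n).hom =
      (I.rightDerivedExactIso T n).hom ≫ τ.app ((F.rightDerived n).obj X) := by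
  have h1 : (NatTrans.rightDerived (Functor.whiskerLeft F τ) n).app X ≫
      (I.isoRightDerivedObj (F ⋙ T') n).hom = (I.isoRightDerivedObj (F ⋙ T) n).hom ≫
        (HomologicalComplex.homologyFunctor C (ComplexShape.up ℕ) n).map
          ((NatTrans.mapHomologicalComplex (Functor.whiskerLeft F τ) _).app I.cocomplex) := by
    rw [I.rightDerived_app_eq, Category.assoc, Category.assoc, Iso.inv_hom_id, Category.comp_id]
  have h2 := HomologicalComplex.mapHomologyIso_hom_app τ
    ((F.mapHomologicalComplex (ComplexShape.up ℕ)).obj I.cocomplex) n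
  have h3 := τ.naturality (I.isoRightDerivedObj F n).inv
  exact comp_square h1 (comp_square h2 h3).symm

end CategoryTheory.InjectiveResolution

/-- If `T` is exact, then `Rⁿ(T ∘ F) ≅ T ∘ RⁿF`. -/
noncomputable def rightDerivedExactIso (n : ℕ) :
    (F ⋙ T).rightDerived n ≅ F.rightDerived n ⋙ T :=
  NatIso.ofComponents (fun X => (injectiveResolution X).rightDerivedExactIso T n)
    (fun f => InjectiveResolution.rightDerivedExactIso_hom_naturality T f _ _ n)

variable {T T'} in
lemma rightDerivedExactIso_hom_comp (τ : T ⟶ T') (n : ℕ) :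
    NatTrans.rightDerived (Functor.whiskerLeft F τ) n ≫ (rightDerivedExactIso F T' n).hom =
      (rightDerivedExactIso F T n).hom ≫ Functor.whiskerLeft (F.rightDerived n) τ := by
  ext X : 2
  exact InjectiveResolution.rightDerivedExactIso_hom_app τ _ n

end rightDerivedExact

/-! ### Filtered colimits of modules -/

/-- For another cocone `s`, the pairs of images of a common element form a relation between the two
vertices. It is additive by filteredness, defined everywhere by `h₁` and single-valued by `h₂`, so
it is the graph of the required map. -/
lemma ModuleCat.nonempty_isColimit_of_isFiltered {R : Type v} [Ring R] {J : Type*} [Category* J]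
    [IsFiltered J] {F : J ⥤ ModuleCat.{w} R} (c : Cocone F)
    (h₁ : ∀ x : c.pt, ∃ (j : J) (y : F.obj j), (c.ι.app j).hom y = x)
    (h₂ : ∀ (j : J) (y : F.obj j), (c.ι.app j).hom y = 0 →
      ∃ (j' : J) (f : j ⟶ j'), (F.map f).hom y = 0) : Nonempty (IsColimit c) := by
  have hw : ∀ (s : Cocone F) {j j' : J} (f : j ⟶ j') (y : F.obj j),
      (s.ι.app j').hom ((F.map f).hom y) = (s.ι.app j).hom y :=
    fun s _ _ f y => congrArg (fun g => g.hom y) (s.w f)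
  have key : ∀ s : Cocone F, ∃ d : c.pt →ₗ[R] s.pt, ∀ (j : J) (y : F.obj j),
      d ((c.ι.app j).hom y) = (s.ι.app j).hom y := fun s => by
    let ρ : Submodule R (c.pt × s.pt) :=
      { carrier := {p | ∃ (j : J) (y : F.obj j), ((c.ι.app j).hom y, (s.ι.app j).hom y) = p}
        zero_mem' := ⟨IsFiltered.nonempty.some, 0, by rw [map_zero, map_zero]; rfl⟩
        add_mem' := by
          rintro _ _ ⟨j, y, rfl⟩ ⟨j', y', rfl⟩
          refine ⟨IsFiltered.max j j', (F.map (IsFiltered.leftToMax j j')).hom y +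
            (F.map (IsFiltered.rightToMax j j')).hom y', ?_⟩
          rw [map_add, map_add, hw, hw, hw, hw]
          rfl
        smul_mem' := by
          rintro r _ ⟨j, y, rfl⟩
          exact ⟨j, r • y, by rw [map_smul, map_smul]; rfl⟩ }
    obtain ⟨d, hd⟩ := exists_linearMap_of_relation ρ (fun x => by
      obtain ⟨j, y, rfl⟩ := h₁ x
      exact ⟨_, j, y, rfl⟩) (by
      rintro n ⟨j, y, e⟩
      obtain ⟨e₁, rfl⟩ := Prod.mk.inj e
      obtain ⟨j', f, hf⟩ := h₂ j y e₁
      rw [← hw s f, hf, map_zero])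
    exact ⟨d, fun j y => hd _ _ ⟨j, y, rfl⟩⟩
  choose d hd using key
  exact ⟨{ desc s := ModuleCat.ofHom (d s)
           fac s j := ModuleCat.hom_ext (LinearMap.ext fun y => hd s j y)
           uniq s m hm := ModuleCat.hom_ext (LinearMap.ext fun x => by
             obtain ⟨j, y, rfl⟩ := h₁ x
             exact (congrArg (fun g => g.hom y) (hm j)).trans (hd s j y).symm) }⟩

/-! ### Right derived functors and unions -/

section rightDerivedUnion

variable {A : Type*} [Category* A] [Abelian A] [HasInjectiveResolutions A]
  {R : Type v} [Ring R] {P P' Q : A ⥤ ModuleCat.{w} R} [P.Additive] [P'.Additive] [Q.Additive]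

namespace CategoryTheory.InjectiveResolution

variable {M : A} (I : InjectiveResolution M)

variable (P) in
/-- The complex `P(I)`. -/
noncomputable abbrev mapComplex : CochainComplex (ModuleCat.{w} R) ℕ :=
  (P.mapHomologicalComplex (ComplexShape.up ℕ)).obj I.cocomplex

variable (P) in
/-- The isomorphism `RⁿP(M) ≅ Hⁿ(P(I))`. -/
noncomputable def rightDerivedIsoHomology (n : ℕ) :
    (P.rightDerived n).obj M ≅ (I.mapComplex P).homology n :=
  I.isoRightDerivedObj P n

/-- The morphism `P(I) ⟶ Q(I)`. -/
noncomputable def mapComplexHom (α : P ⟶ Q) : I.mapComplex P ⟶ I.mapComplex Q :=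
  (NatTrans.mapHomologicalComplex α _).app I.cocomplex

lemma rightDerivedIsoHomology_hom_apply (α : P ⟶ Q) (n : ℕ) (ξ : (P.rightDerived n).obj M) :
    (I.rightDerivedIsoHomology Q n).hom.hom (((NatTrans.rightDerived α n).app M).hom ξ) =
      (HomologicalComplex.homologyMap (I.mapComplexHom α) n).hom
        ((I.rightDerivedIsoHomology P n).hom.hom ξ) := by
  have h : (NatTrans.rightDerived α n).app M ≫ (I.isoRightDerivedObj Q n).hom =
      (I.isoRightDerivedObj P n).hom ≫ (HomologicalComplex.homologyFunctor _ _ n).map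
          ((NatTrans.mapHomologicalComplex α _).app I.cocomplex) := by
    rw [I.rightDerived_app_eq, Category.assoc, Category.assoc, Iso.inv_hom_id, Category.comp_id]
  exact congrArg (fun g => g.hom ξ) h

lemma rightDerivedIsoHomology_injective (n : ℕ) :
    Function.Injective (I.rightDerivedIsoHomology P n).hom.hom :=
  (ConcreteCategory.bijective_of_isIso (I.rightDerivedIsoHomology P n).hom).1

lemma rightDerivedIsoHomology_surjective (n : ℕ) :
    Function.Surjective (I.rightDerivedIsoHomology P n).hom.hom :=
  (ConcreteCategory.bijective_of_isIso (I.rightDerivedIsoHomology P n).hom).2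

end CategoryTheory.InjectiveResolution

namespace HomologicalComplex

variable {ι : Type*} {c : ComplexShape ι} {K L N : HomologicalComplex (ModuleCat.{w} R) c}

lemma homologyMap_homologyπ_apply (f : K ⟶ L) (i : ι) (z : K.cycles i) :
    (homologyMap f i).hom ((K.homologyπ i).hom z) =
      (L.homologyπ i).hom ((cyclesMap f i).hom z) :=
  congrArg (fun g => g.hom z) (homologyπ_naturality f i)

lemma iCycles_cyclesMap_apply (f : K ⟶ L) (i : ι) (z : K.cycles i) :
    (L.iCycles i).hom ((cyclesMap f i).hom z) = (f.f i).hom ((K.iCycles i).hom z) :=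
  congrArg (fun g => g.hom z) (cyclesMap_i f i)

lemma comm_apply (f : K ⟶ L) (i j : ι) (x : K.X i) :
    (L.d i j).hom ((f.f i).hom x) = (f.f j).hom ((K.d i j).hom x) :=
  congrArg (fun g => g.hom x) (f.comm i j)

end HomologicalComplex

/-- If `RⁿQ(M)` is represented by a cocycle which lies in the image of `P`, then it comes from
`RⁿP(M)`. -/
lemma exists_rightDerived_app_eq {M : A} (n : ℕ) (e : (Q.rightDerived n).obj M) :
    ∃ (X : A) (x : Q.obj X), ∀ (P : A ⥤ ModuleCat.{w} R) [P.Additive] (α : P ⟶ Q),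
      (∀ Y, Function.Injective (α.app Y).hom) → (∃ y, (α.app X).hom y = x) →
      ∃ ξ, ((NatTrans.rightDerived α n).app M).hom ξ = e := by
  let I := injectiveResolution M
  obtain ⟨z, hz⟩ := (I.mapComplex Q).homologyπ_surjective n
    ((I.rightDerivedIsoHomology Q n).hom.hom e)
  -- The witness is a cocycle representing `e`. It does not depend on `P`, so `P` can be chosen
  -- afterwards so as to contain it; injectivity of `α` then makes its preimage a cocycle.
  refine ⟨I.cocomplex.X n, ((I.mapComplex Q).iCycles n).hom z, fun P _ α hα ⟨y, hy⟩ => ?_⟩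
  have hy' : ((I.mapComplexHom α).f n).hom y = ((I.mapComplex Q).iCycles n).hom z := hy
  obtain ⟨t, ht⟩ := (I.mapComplex P).exists_iCycles_eq n y (fun j => hα _ (by
    refine (HomologicalComplex.comm_apply (I.mapComplexHom α) n j y).symm.trans ?_
    rw [hy', HomologicalComplex.d_iCycles_apply]
    exact (map_zero (α.app (I.cocomplex.X j)).hom).symm))
  obtain ⟨ξ, hξ⟩ := I.rightDerivedIsoHomology_surjective n (((I.mapComplex P).homologyπ n).hom t)
  refine ⟨ξ, I.rightDerivedIsoHomology_injective n ?_⟩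
  rw [I.rightDerivedIsoHomology_hom_apply, hξ, ← hz,
    HomologicalComplex.homologyMap_homologyπ_apply]
  refine congrArg _ ((I.mapComplex Q).iCycles_injective n ?_)
  rw [HomologicalComplex.iCycles_cyclesMap_apply, ht, hy']

/-- If a class in `RⁿP(M)` vanishes in `RⁿQ(M)`, it already vanishes in `RⁿP'(M)` for `P'` large
enough. -/
lemma exists_rightDerived_app_eq_zero {M : A} (n : ℕ) (α : P ⟶ Q) (ξ : (P.rightDerived n).obj M)
    (hξ : ((NatTrans.rightDerived α n).app M).hom ξ = 0) :
    ∃ (X : A) (x : Q.obj X), ∀ (P' : A ⥤ ModuleCat.{w} R) [P'.Additive] (β : P ⟶ P')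
      (α' : P' ⟶ Q), β ≫ α' = α → (∀ Y, Function.Injective (α'.app Y).hom) →
      (∃ y, (α'.app X).hom y = x) → ((NatTrans.rightDerived β n).app M).hom ξ = 0 := by
  let I := injectiveResolution M
  obtain ⟨z, hz⟩ := (I.mapComplex P).homologyπ_surjective n
    ((I.rightDerivedIsoHomology P n).hom.hom ξ)
  have h := congrArg (I.rightDerivedIsoHomology Q n).hom.hom hξ
  rw [I.rightDerivedIsoHomology_hom_apply, ← hz, HomologicalComplex.homologyMap_homologyπ_apply,
    map_zero, HomologicalComplex.homologyπ_eq_zero_iff,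
    HomologicalComplex.iCycles_cyclesMap_apply] at h
  obtain ⟨j, x, hx⟩ := h
  -- The witness is a cochain of `Q(I)` that bounds the image of the cocycle; any `P'` containing it
  -- kills the class.
  refine ⟨I.cocomplex.X j, x, fun P' _ β α' hβ hα ⟨y, hy⟩ => ?_⟩
  have hy' : ((I.mapComplexHom α').f j).hom y = x := hy
  refine I.rightDerivedIsoHomology_injective n ?_
  rw [I.rightDerivedIsoHomology_hom_apply, ← hz, HomologicalComplex.homologyMap_homologyπ_apply,
    map_zero, HomologicalComplex.homologyπ_eq_zero_iff,
    HomologicalComplex.iCycles_cyclesMap_apply]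
  refine ⟨j, y, hα _ ?_⟩
  refine (HomologicalComplex.comm_apply (I.mapComplexHom α') j n y).symm.trans ?_
  rw [hy', hx]
  subst hβ
  rfl

end rightDerivedUnion

/-! ### The derived functors of `H⁰(S, -)` as colimits -/

namespace CategoryTheory.ObjectProperty

/-- The inclusion of a full subcategory closed under kernels and cokernels is exact. -/
lemma preservesHomology_ι {C : Type*} [Category* C] [Abelian C] (P : ObjectProperty C)
    [P.IsClosedUnderKernels] [P.IsClosedUnderCokernels] : P.ι.PreservesHomology where
  preservesKernels _ _ f := P.preservesKernels_ι f
  preservesCokernels _ _ f := P.preservesCokernels_ι f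

end CategoryTheory.ObjectProperty

namespace AdmissibleFamily

variable (k : Type v) [CommRing k] {G : Type u} [Group G] (S : AdmissibleFamily G)

/-- The subcategory is closed under kernels and cokernels, so its inclusion is exact, and the
forgetful functor to modules is exact. -/
instance : (S.toModule k).PreservesHomology := by
  have := (S.isUnionOfFixed k).preservesHomology_ι
  have := (S.isUnionOfFixed k).ι.preservesFiniteLimits_of_preservesHomology
  have := (S.isUnionOfFixed k).ι.preservesFiniteColimits_of_preservesHomology
  have : PreservesFiniteLimits (forget₂ (Rep.{max u v} k G) (ModuleCat.{max u v} k)) :=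
    ⟨fun _ _ _ => inferInstance⟩
  have : PreservesFiniteColimits (forget₂ (Rep.{max u v} k G) (ModuleCat.{max u v} k)) :=
    ⟨fun _ _ _ => inferInstance⟩
  have : PreservesFiniteLimits (S.toModule k) := comp_preservesFiniteLimits _ _
  have : PreservesFiniteColimits (S.toModule k) := comp_preservesFiniteColimits _ _
  infer_instance

variable {S} in
/-- The inclusion of `M^H` in `⋃_{H ∈ S} M^H`. -/
noncomputable def fixedPointsInclusion (H : {H : Subgroup G // H ∈ S.carrier}) :
    H.1.fixedPoints k ⟶ S.H0 k ⋙ S.toModule k where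
  app M := ModuleCat.ofHom ((Submodule.subtype _).codRestrict (S.fixedSubmodule M)
    fun m => ⟨H.1, H.2, fun h hh => m.2 ⟨h, hh⟩⟩)
  naturality _ _ _ := rfl

/-- The action of `g ∈ G` on the objects of `Mod-kG/S`. -/
noncomputable def action (g : G) : S.toModule k ⟶ S.toModule k where
  app M := ModuleCat.ofHom (M.obj.ρ g)
  naturality M N f := by
    ext m
    exact (Rep.hom_comm_apply f.hom g m).symm

variable {S}

lemma fixedPointsInclusion_injective (H : {H : Subgroup G // H ∈ S.carrier})
    (M : Rep.{max u v} k G) :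
    Function.Injective ((fixedPointsInclusion k H).app M).hom := fun _ _ h =>
  Subtype.ext (congrArg (fun m : S.fixedSubmodule M => m.1) h)

/-- On elements both sides are `m ↦ gm`. This is the source of the equivariance, and for `g = 1` of
the compatibility with restriction maps. -/
lemma fixedPointsMap_comp_inclusion {H K : {H : Subgroup G // H ∈ S.carrier}} (g : G)
    (h : ∀ x ∈ K.1, g⁻¹ * x * g ∈ H.1) :
    Subgroup.fixedPointsMap k g h ≫ fixedPointsInclusion k K =
      fixedPointsInclusion k H ≫ Functor.whiskerLeft (S.H0 k) (S.action k g) := rfl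

lemma action_one : S.action k 1 = 𝟙 _ := by
  ext M m
  exact congrArg (fun f => f m) M.obj.ρ.map_one

lemma fixedPointsMap_one_comp_inclusion {H K : {H : Subgroup G // H ∈ S.carrier}}
    (h : ∀ x ∈ K.1, (1 : G)⁻¹ * x * 1 ∈ H.1) :
    Subgroup.fixedPointsMap k 1 h ≫ fixedPointsInclusion k K = fixedPointsInclusion k H := by
  rw [fixedPointsMap_comp_inclusion, action_one, Functor.whiskerLeft_id', Category.comp_id]

/-- The map `H^q(H, M) → H^q(S, M)`. -/
noncomputable def toColimit (q : ℕ) (H : {H : Subgroup G // H ∈ S.carrier}) :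
    H.1.cohomology k q ⟶ S.H k q ⋙ S.toModule k :=
  (H.1.cohomologyIso k q).inv ≫ NatTrans.rightDerived (fixedPointsInclusion k H) q ≫
    (rightDerivedExactIso (S.H0 k) (S.toModule k) q).hom

/-- This is the derived form of `fixedPointsMap_comp_inclusion`: derived functors are functorial in
natural transformations, and the comparison isomorphisms of `K` cancel. -/
lemma cohomologyMap_comp_toColimit (q : ℕ) {H K : {H : Subgroup G // H ∈ S.carrier}} (g : G)
    (h : ∀ x ∈ K.1, g⁻¹ * x * g ∈ H.1) :
    Subgroup.cohomologyMap k q g h ≫ toColimit k q K =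
      toColimit k q H ≫ Functor.whiskerLeft (S.H k q) (S.action k g) := by
  have h₁ := (NatTrans.rightDerived_comp (Subgroup.fixedPointsMap k g h)
    (fixedPointsInclusion k K) q).symm.trans
      (NatTrans.rightDerived_comp (fixedPointsInclusion k H)
        (Functor.whiskerLeft (S.H0 k) (S.action k g)) q)
  have h₂ := rightDerivedExactIso_hom_comp (S.H0 k) (S.action k g) q
  unfold Subgroup.cohomologyMap toColimit
  rw [Category.assoc, Category.assoc, Iso.hom_inv_id_assoc, Category.assoc, Category.assoc, ← h₂,
    reassoc_of% h₁]

variable (S) in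
/-- The cocone formed by the maps `H^q(H, M) → H^q(S, M)`. -/
noncomputable def cohomologyCocone (q : ℕ) :
    S.cohomologyDiagram k q ⟶ (Functor.const _).obj (S.H k q ⋙ S.toModule k) where
  app H := toColimit k q H.unop
  naturality H K f := by
    refine (cohomologyMap_comp_toColimit k q 1 _).trans ?_
    rw [action_one, Functor.whiskerLeft_id', Category.comp_id]
    exact (Category.comp_id _).symm

variable {k}

/-- The order is reverse inclusion, and the intersection of two members contains a member. -/
instance : IsFiltered {H : Subgroup G // H ∈ S.carrier}ᵒᵖ where
  cocone_objs H K := by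
    obtain ⟨L, hL, h₁, h₂⟩ := S.exists_le H.unop.2 K.unop.2
    exact ⟨Opposite.op ⟨L, hL⟩, (homOfLE h₁ : (⟨L, hL⟩ : {H // H ∈ S.carrier}) ⟶ H.unop).op,
      (homOfLE h₂ : (⟨L, hL⟩ : {H // H ∈ S.carrier}) ⟶ K.unop).op, trivial⟩
  cocone_maps H K f g := ⟨K, 𝟙 K, by rw [Subsingleton.elim f g]⟩
  nonempty := by
    obtain ⟨K, hK⟩ := S.exists_mem
    exact ⟨Opposite.op ⟨K, hK⟩⟩

lemma exists_fixedPointsInclusion_eq {M : Rep.{max u v} k G} (x : (S.H0 k ⋙ S.toModule k).obj M) :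
    ∃ H : {H : Subgroup G // H ∈ S.carrier}, ∀ K : {H : Subgroup G // H ∈ S.carrier}, K ≤ H →
      ∃ y, ((fixedPointsInclusion k K).app M).hom y = x := by
  obtain ⟨m, H, hH, hm⟩ := x
  exact ⟨⟨H, hH⟩, fun K hK => ⟨⟨m, fun h => hm h (hK h.2)⟩, rfl⟩⟩

/-- A class is represented by a single element of `⋃ (I^q)^H`, which is fixed by one member of the
family. -/
lemma exists_toColimit_eq (q : ℕ) (M : Rep.{max u v} k G)
    (x : (S.H k q ⋙ S.toModule k).obj M) :
    ∃ (H : {H : Subgroup G // H ∈ S.carrier}) (ξ : (H.1.cohomology k q).obj M),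
      ((toColimit k q H).app M).hom ξ = x := by
  obtain ⟨X, y, h⟩ := exists_rightDerived_app_eq q
    (((rightDerivedExactIso (S.H0 k) (S.toModule k) q).inv.app M).hom x)
  obtain ⟨H, hH⟩ := exists_fixedPointsInclusion_eq y
  obtain ⟨ξ, hξ⟩ := h _ (fixedPointsInclusion k H) (fixedPointsInclusion_injective k H)
    (hH H le_rfl)
  refine ⟨H, ((H.1.cohomologyIso k q).hom.app M).hom ξ, ?_⟩
  have e₁ := congrArg (fun g => g.hom ξ) ((H.1.cohomologyIso k q).hom_inv_id_app M)
  have e₂ := congrArg (fun g => g.hom x)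
    ((rightDerivedExactIso (S.H0 k) (S.toModule k) q).inv_hom_id_app M)
  have e₃ := (congrArg ((NatTrans.rightDerived (fixedPointsInclusion k H) q).app M).hom e₁).trans hξ
  exact (congrArg ((rightDerivedExactIso (S.H0 k) (S.toModule k) q).hom.app M).hom e₃).trans e₂

/-- A single cochain of the union bounds the cocycle. It is fixed by some `H'`, and `K` is a member
contained in both `H` and `H'`. -/
lemma exists_cohomologyMap_eq_zero (q : ℕ) (M : Rep.{max u v} k G)
    (H : {H : Subgroup G // H ∈ S.carrier}) (ξ : (H.1.cohomology k q).obj M)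
    (hξ : ((toColimit k q H).app M).hom ξ = 0) :
    ∃ (K : {H : Subgroup G // H ∈ S.carrier}) (hK : K ≤ H),
      ((Subgroup.cohomologyMap k q 1 fun x hx => by simpa using hK hx :
        H.1.cohomology k q ⟶ K.1.cohomology k q).app M).hom ξ = 0 := by
  have h₁ : ((NatTrans.rightDerived (fixedPointsInclusion k H) q).app M).hom
      (((H.1.cohomologyIso k q).inv.app M).hom ξ) = 0 :=
    (ConcreteCategory.bijective_of_isIso
      ((rightDerivedExactIso (S.H0 k) (S.toModule k) q).hom.app M)).1 (hξ.trans (map_zero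
        ((rightDerivedExactIso (S.H0 k) (S.toModule k) q).hom.app M).hom).symm)
  obtain ⟨X, x, h⟩ := exists_rightDerived_app_eq_zero q _ _ h₁
  obtain ⟨H', hH'⟩ := exists_fixedPointsInclusion_eq x
  obtain ⟨L, hL, h₂, h₃⟩ := S.exists_le H.2 H'.2
  refine ⟨⟨L, hL⟩, h₂, ?_⟩
  have h₄ := h _ (Subgroup.fixedPointsMap k 1 fun x hx => by simpa using h₂ hx)
    (fixedPointsInclusion k ⟨L, hL⟩) (fixedPointsMap_one_comp_inclusion k _)
    (fixedPointsInclusion_injective k _) (hH' _ h₃)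
  exact (congrArg ((Subgroup.cohomologyIso k L q).hom.app M).hom h₄).trans (map_zero _)

/-- Colimits of functors are computed objectwise, and for each `M` the two preceding lemmas are the
two conditions of the filtered colimit criterion. -/
lemma nonempty_isColimit_cohomologyCocone (q : ℕ) :
    Nonempty (IsColimit (Cocone.mk _ (S.cohomologyCocone k q))) := by
  have h : ∀ M : Rep.{max u v} k G, Nonempty (IsColimit (((evaluation _ _).obj M).mapCocone
      (Cocone.mk _ (S.cohomologyCocone k q)))) := fun M =>
    ModuleCat.nonempty_isColimit_of_isFiltered _
      (fun x => by
        obtain ⟨H, ξ, h⟩ := exists_toColimit_eq q M x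
        exact ⟨Opposite.op H, ξ, h⟩)
      (fun H ξ h => by
        obtain ⟨K, hK, e⟩ := exists_cohomologyMap_eq_zero q M H.unop ξ h
        exact ⟨Opposite.op K, (homOfLE hK).op, e⟩)
  exact ⟨evaluationJointlyReflectsColimits _ fun M => (h M).some⟩

end AdmissibleFamily

/-- Let `S` be an admissible family of subgroups of a group `G`. The factorization of the `G`-fixed
point functor through `Mod-ℤG/S` has a Grothendieck spectral sequence
`Hᵖ(G/S, H^q(S, M)) ⇒ H^{p+q}(G, M)`, natural in `M`, and `H^q(S, M)` is naturally, and
`G`-equivariantly, the colimit of the `H^q(H, M)` over `H` in `S`. -/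
theorem theoremA {G : Type u} [Group G] (S : AdmissibleFamily G) :
    Nonempty (GrothendieckSpectralSequence (S.factorization ℤ)) ∧
    ∀ q : ℕ, ∃ κ : S.cohomologyDiagram ℤ q ⟶ (Functor.const _).obj (S.H ℤ q ⋙ S.toModule ℤ),
      Nonempty (IsColimit (Cocone.mk _ κ)) ∧
      ∀ (g : G) (H K : {H : Subgroup G // H ∈ S.carrier})
        (h : ∀ x ∈ K.1, g⁻¹ * x * g ∈ H.1) (M : Rep.{u} ℤ G) (ξ : (H.1.cohomology ℤ q).obj M),
        ((κ.app (Opposite.op K)).app M).hom (((Subgroup.cohomologyMap ℤ q g h).app M).hom ξ) =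
          ((S.H ℤ q).obj M).obj.ρ g (((κ.app (Opposite.op H)).app M).hom ξ) :=
  ⟨⟨S.grothendieckSpectralSequence ℤ⟩, fun q => ⟨S.cohomologyCocone ℤ q,
    AdmissibleFamily.nonempty_isColimit_cohomologyCocone q, fun g _ _ h M ξ =>
      congrArg (fun f => (f.app M).hom ξ)
        (AdmissibleFamily.cohomologyMap_comp_toColimit ℤ q g h)⟩⟩
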